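/- Let $G=(V,E)$ be a finite hypergraph with nonnegative edge weights $w(e)$ in which every edge has at most $\eta$ vertices, where $\eta\ge 2$ is a constant. Let $\mathcal M=(V,\mathcal I)$ be a matroid of rank $k$ on $V$, and $n=|V|$. For $S\subseteq V$ let $E_G(S)=\sum_{e\in E,\ e\cap S\ne\emptyset}w(e)$, and let $\deg_w(v)=\sum_{e\ni v}w(e)$. A set $S\in\mathcal I$ is a $\rho$-approximation if $E_G(S)\ge \rho\, E_G(O)$ for every $O\in\mathcal I$. We consider - partition matroids, given by a partition $V_1,\dots,V_r$ of $V$ into nonempty parts and bounds $k_i\in\mathbb N$ ($S\in\mathcal I$ iff $|S\cap V_i|\le k_i$ for all $i$); - laminar matroids, given in the same way by a family of distinct sets $V_1,\dots,V_r\subseteq V$ any two of which are disjoint or nested; - transversal matroids, given by a family $V_1,\dots,V_r\subseteq V$ (repetitions allowed; $S\in\mathcal I$ iff there is an injective map $\phi:S\to\{1,\dots,r\}$ with $u\in V_{\phi(u)}$ for all $u\in S$). For an integer $\tau\ge1$ let $\tau\mathcal M$ be the union of $\tau$ copies of $\mathcal M$: its independent sets are the sets that can be partitioned into $\tau$ (possibly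 empty) members of $\mathcal I$. A greedy kernel of $\tau\mathcal M$ is a set $V'$ obtained by starting with $V'=\emptyset$, processing all vertices in an order of non-increasing $\deg_w$ (ties broken arbitrarily), and adding a vertex whenever $V'$ stays independent in $\tau\mathcal M$. (1) Kernels. Let $\varepsilon>0$ and $t=\lceil 1/\varepsilon\rceil$. Every greedy kernel $V'$ of $\tau\mathcal M$ contains a $(1-(\eta-1)\varepsilon)$-approximation, where $\tau=t$ for partition matroids, $\tau=2t$ for laminar matroids and $\tau=t+k-1$ for transversal matroids. Moreover $|V'|\le kt$, $|V'|\le 2kt$ and $|V'|\le kt+k(k-1)$, respectively. (2) Algorithms. For each of the three classes of matroids and every fixed $\eta\ge 2$ there is an algorithm which, given $n$, $\varepsilon>0$, the list of the weighted edges of $G$, and the sets $V_i$ (with the bounds $k_i$ for partition and laminar matroids), computes a $(1-(\eta-1)\varepsilon)$-approximation. There are constants $C,c$ depending only on $\eta$ such that its running time (number of unit-cost operations on natural and real numbers, pairs and lists; the only arithmetic is addition, subtraction and comparison) is at most $$C\,\max(2,1/\varepsilon)^{ck}\,(n+1)^{c}$$ for partition and laminar matroids, that is, $(1/\varepsilon)^{O(k)}n^{O(1)}$,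 and at most $$C\,(1/\varepsilon+k)^{ck}\,(n+r+1)^{c}$$ for transversal matroids given by $r$ sets, that is, $(1/\varepsilon+k)^{O(k)}n^{O(1)}$ when, as usual, $r=k$ (or $r\le n$). -/

import Mathlib

universe u

/-! ## Weighted hypergraphs and matroid-constrained vertex cover -/

/-- A finite hypergraph on the vertex set `V` (edges are subsets of `V`, without repetition)
with a nonnegative weight on every edge. -/
structure WHypergraph (V : Type u) where
  edges : Finset (Finset V)
  weight : Finset V → ℝ
  weight_nonneg : ∀ e ∈ edges, 0 ≤ weight e

namespace WHypergraph

variable {V : Type u} [DecidableEq V]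

/-- Every edge has at most `η` vertices. -/
def EdgeSizeLE (G : WHypergraph V) (η : ℕ) : Prop := ∀ e ∈ G.edges, e.card ≤ η

/-- The weighted degree of a vertex: the total weight of the edges containing it. -/
def wdeg (G : WHypergraph V) (v : V) : ℝ := ∑ e ∈ G.edges with v ∈ e, G.weight e

/-- The total weight of the edges covered by `S`, that is, having at least one vertex in `S`. -/
def cover (G : WHypergraph V) (S : Finset V) : ℝ :=
  ∑ e ∈ G.edges with (e ∩ S).Nonempty, G.weight e

/-- `S` is independent and covers at least `ρ` times the weight that any independent set covers. -/
def IsApprox (G : WHypergraph V) (M : Matroid V) (ρ : ℝ) (S : Finset V) : Prop :=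
  M.Indep (S : Set V) ∧ ∀ O : Finset V, M.Indep (O : Set V) → ρ * G.cover O ≤ G.cover S

end WHypergraph

/-! ## The three classes of matroids, given by a presentation -/

section Matroids

variable {V : Type u} [DecidableEq V]

/-- `M` is the matroid on `V` whose independent sets are the `S` with `|S ∩ F i| ≤ b i` for all
`i`. -/
def IsCapacityMatroid (M : Matroid V) {r : ℕ} (F : Fin r → Finset V) (b : Fin r → ℕ) : Prop :=
  M.E = Set.univ ∧ ∀ S : Finset V, M.Indep (S : Set V) ↔ ∀ i, (S ∩ F i).card ≤ b i

/-- `M` is the partition matroid given by the partition `F` of `V` into nonempty parts and the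
bounds `b`. -/
def IsPartitionMatroid (M : Matroid V) {r : ℕ} (F : Fin r → Finset V) (b : Fin r → ℕ) : Prop :=
  (∀ i, (F i).Nonempty) ∧ (∀ i j, i ≠ j → Disjoint (F i) (F j)) ∧ (∀ v, ∃ i, v ∈ F i) ∧
    IsCapacityMatroid M F b

/-- `M` is the laminar matroid given by the laminar family `F` of (distinct) subsets of `V` and
the bounds `b`. -/
def IsLaminarMatroid (M : Matroid V) {r : ℕ} (F : Fin r → Finset V) (b : Fin r → ℕ) : Prop :=
  Function.Injective F ∧
    (∀ i j, i ≠ j → Disjoint (F i) (F j) ∨ F i ⊆ F j ∨ F j ⊆ F i) ∧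
    IsCapacityMatroid M F b

/-- `M` is the transversal matroid given by the family `F` of subsets of `V`: a set is independent
iff its elements can be assigned to distinct indices `i` of sets `F i` containing them. -/
def IsTransversalMatroid (M : Matroid V) {r : ℕ} (F : Fin r → Finset V) : Prop :=
  M.E = Set.univ ∧ ∀ S : Finset V, M.Indep (S : Set V) ↔
    ∃ φ : {u // u ∈ S} → Fin r, Function.Injective φ ∧ ∀ u, u.1 ∈ F (φ u)

/-! ## Matroid union and the greedy kernel -/

/-- `S` is independent in the union `τ M` of `τ` copies of `M`: it can be partitioned into `τ`
(possibly empty) independent sets of `M`. -/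
def UnionIndep (M : Matroid V) (τ : ℕ) (S : Finset V) : Prop :=
  ∃ f : Fin τ → Finset V, (∀ i, M.Indep (f i : Set V)) ∧
    (∀ i j, i ≠ j → Disjoint (f i) (f j)) ∧ S = Finset.univ.biUnion f

open Classical in
/-- The greedy procedure: process the elements of `l` in order, and keep an element whenever
independence (with respect to `indep`) is preserved. -/
noncomputable def greedy (indep : Finset V → Prop) (l : List V) : Finset V :=
  l.foldl (fun A u => if indep (insert u A) then insert u A else A) ∅

/-- `K` is a result of the greedy procedure on `τ M` which processes all vertices by non-increasing
weighted degree (ties are broken arbitrarily). -/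
def IsGreedyKernel (G : WHypergraph V) (M : Matroid V) (τ : ℕ) (K : Finset V) : Prop :=
  ∃ l : List V, l.Nodup ∧ (∀ v, v ∈ l) ∧ l.Pairwise (fun u v => G.wdeg v ≤ G.wdeg u) ∧
    K = greedy (UnionIndep M τ) l

/-- The set `K` contains a `ρ`-approximate solution. -/
def ContainsApprox (G : WHypergraph V) (M : Matroid V) (ρ : ℝ) (K : Finset V) : Prop :=
  ∃ S ⊆ K, G.IsApprox M ρ S

end Matroids

/-! ## Programs and their running time

Algorithms are programs of a small typed first-order language over Booleans, natural numbers,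
real numbers (the weights and `ε`, handled by unit-cost addition, subtraction and comparison),
pairs and linked lists. Values are immutable, so pairs and lists are built and passed on by
reference, and every primitive operation is a constant number of steps of a unit-cost
random-access machine with real registers. The only means of repetition are loops over a list and
counted loops. `Prog.cost p x` is the number of elementary steps of `p` on the input `x`. -/

/-- Data types of the language. -/
inductive Ty : Type
  | unit : Ty
  | bool : Ty
  | nat : Ty
  | real : Ty
  | prod : Ty → Ty → Ty
  | list : Ty → Ty

/-- The values of a data type. -/
abbrev Ty.Val : Ty → Type
  | .unit => Unit
  | .bool => Bool
  | .nat => ℕ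
  | .real => ℝ
  | .prod a b => a.Val × b.Val
  | .list a => List a.Val

/-- `Prog a b` is the type of programs (finite pieces of syntax) with input type `a` and output
type `b`. -/
inductive Prog : Ty → Ty → Type
  | id {a : Ty} : Prog a a
  /-- first the second program, then the first one on its output -/
  | comp {a b c : Ty} : Prog b c → Prog a b → Prog a c
  | unit {a : Ty} : Prog a .unit
  | pair {a b c : Ty} : Prog a b → Prog a c → Prog a (.prod b c)
  | fst {a b : Ty} : Prog (.prod a b) a
  | snd {a b : Ty} : Prog (.prod a b) b
  | boolLit {a : Ty} : Bool → Prog a .bool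
  /-- `ite c p q`: evaluate the test `c`, then run `p` or `q` on the same input -/
  | ite {a b : Ty} : Prog a .bool → Prog a b → Prog a b → Prog a b
  | natLit {a : Ty} : ℕ → Prog a .nat
  | natAdd : Prog (.prod .nat .nat) .nat
  /-- truncated subtraction -/
  | natSub : Prog (.prod .nat .nat) .nat
  | natLe : Prog (.prod .nat .nat) .bool
  | realZero {a : Ty} : Prog a .real
  | realOne {a : Ty} : Prog a .real
  | realAdd : Prog (.prod .real .real) .real
  | realSub : Prog (.prod .real .real) .real
  | realLe : Prog (.prod .real .real) .bool
  | nil {a b : Ty} : Prog a (.list b)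
  | cons {a : Ty} : Prog (.prod a (.list a)) (.list a)
  /-- case distinction on a list: empty, or head and tail -/
  | listCase {a b c : Ty} : Prog a c → Prog (.prod a (.prod b (.list b))) c →
      Prog (.prod a (.list b)) c
  /-- loop over a list: on input `(x, s, l)` update the state `s` by the body applied to
  `(x, s, y)`, for the entries `y` of `l` in order -/
  | fold {a b c : Ty} : Prog (.prod a (.prod c b)) c → Prog (.prod a (.prod c (.list b))) c
  /-- counted loop: on input `(x, s, m)` update the state `s` by the body applied to `(x, s)`,
  `m` times -/
  | loop {a c : Ty} : Prog (.prod a c) c → Prog (.prod a (.prod c .nat)) c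

namespace Prog

/-- The number of steps of a loop over a list whose body has the effect `step` and the running
time `cost`. -/
def foldCost {β γ : Type} (step : γ → β → γ) (cost : γ → β → ℕ) : γ → List β → ℕ
  | _, [] => 1
  | s, y :: l => cost s y + 1 + foldCost step cost (step s y) l

/-- The number of steps of a counted loop whose body has the effect `step` and the running time
`cost`. -/
def loopCost {γ : Type} (step : γ → γ) (cost : γ → ℕ) : γ → ℕ → ℕ
  | _, 0 => 1
  | s, m + 1 => cost s + 1 + loopCost step cost (step s) m

/-- The output of a program on an input. -/
noncomputable def eval : {a b : Ty} → Prog a b → a.Val → b.Val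
  | _, _, .id, x => x
  | _, _, .comp p q, x => p.eval (q.eval x)
  | _, _, .unit, _ => ()
  | _, _, .pair p q, x => (p.eval x, q.eval x)
  | _, _, .fst, x => x.1
  | _, _, .snd, x => x.2
  | _, _, .boolLit t, _ => t
  | _, _, .ite c p q, x => if c.eval x = true then p.eval x else q.eval x
  | _, _, .natLit m, _ => m
  | _, _, .natAdd, x => x.1 + x.2
  | _, _, .natSub, x => x.1 - x.2
  | _, _, .natLe, x => decide (x.1 ≤ x.2)
  | _, _, .realZero, _ => 0
  | _, _, .realOne, _ => 1
  | _, _, .realAdd, x => x.1 + x.2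
  | _, _, .realSub, x => x.1 - x.2
  | _, _, .realLe, x => decide (x.1 ≤ x.2)
  | _, _, .nil, _ => []
  | _, _, .cons, x => x.1 :: x.2
  | _, _, .listCase p _, (x, []) => p.eval x
  | _, _, .listCase _ q, (x, y :: l) => q.eval (x, y, l)
  | _, _, .fold p, (x, s, l) => l.foldl (fun s y => p.eval (x, s, y)) s
  | _, _, .loop p, (x, s, m) => (fun s => p.eval (x, s))^[m] s

/-- The number of elementary steps of a program on an input. -/
noncomputable def cost : {a b : Ty} → Prog a b → a.Val → ℕ
  | _, _, .comp p q, x => q.cost x + p.cost (q.eval x) + 1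
  | _, _, .pair p q, x => p.cost x + q.cost x + 1
  | _, _, .ite c p q, x => c.cost x + (if c.eval x = true then p.cost x else q.cost x) + 1
  | _, _, .listCase p _, (x, []) => p.cost x + 1
  | _, _, .listCase _ q, (x, y :: l) => q.cost (x, y, l) + 1
  | _, _, .fold p, (x, s, l) =>
      foldCost (fun s y => p.eval (x, s, y)) (fun s y => p.cost (x, s, y)) s l
  | _, _, .loop p, (x, s, m) => loopCost (fun s => p.eval (x, s)) (fun s => p.cost (x, s)) s m
  | _, _, .id, _ => 1
  | _, _, .unit, _ => 1
  | _, _, .fst, _ => 1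
  | _, _, .snd, _ => 1
  | _, _, .boolLit _, _ => 1
  | _, _, .natLit _, _ => 1
  | _, _, .natAdd, _ => 1
  | _, _, .natSub, _ => 1
  | _, _, .natLe, _ => 1
  | _, _, .realZero, _ => 1
  | _, _, .realOne, _ => 1
  | _, _, .realAdd, _ => 1
  | _, _, .realSub, _ => 1
  | _, _, .realLe, _ => 1
  | _, _, .nil, _ => 1
  | _, _, .cons, _ => 1

end Prog

/-! ## Encoding of inputs and outputs (the vertices are `0, …, n - 1`) -/

/-- The list `l` enumerates the set `S` of vertices, without repetition, in some order. -/
def EncodesSet {n : ℕ} (l : List ℕ) (S : Finset (Fin n)) : Prop :=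
  ∃ l' : List (Fin n), l'.Nodup ∧ l'.toFinset = S ∧ l = l'.map Fin.val

/-- The list `L` enumerates the edges of `G` with their weights, without repetition, in some
order. -/
def EncodesEdges {n : ℕ} (L : List (List ℕ × ℝ)) (G : WHypergraph (Fin n)) : Prop :=
  ∃ es : List (Finset (Fin n)), es.Nodup ∧ es.toFinset = G.edges ∧
    List.Forall₂ (fun p e => EncodesSet p.1 e ∧ p.2 = G.weight e) L es

/-- The list `L` consists of the sets `F i` with their bounds `b i`. -/
def EncodesCapacities {n r : ℕ} (L : List (List ℕ × ℕ)) (F : Fin r → Finset (Fin n))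
    (b : Fin r → ℕ) : Prop :=
  List.Forall₂ (fun p i => EncodesSet p.1 (F i) ∧ p.2 = b i) L (List.finRange r)

/-- The list `L` consists of the sets `F i`. -/
def EncodesFamily {n r : ℕ} (L : List (List ℕ)) (F : Fin r → Finset (Fin n)) : Prop :=
  List.Forall₂ (fun l i => EncodesSet l (F i)) L (List.finRange r)

/-- Inputs `(n, ε, edges, matroid)`, the matroid being described by a value of type `m`. -/
abbrev InputTy (m : Ty) : Ty :=
  .prod .nat (.prod .real (.prod (.list (.prod (.list .nat) .real)) m))

/-- Descriptions of partition and laminar matroids. -/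
abbrev CapacityTy : Ty := .list (.prod (.list .nat) .nat)

/-- Descriptions of transversal matroids. -/
abbrev FamilyTy : Ty := .list (.list .nat)

/-! Write `t = ⌈1/ε⌉`. The existence part is proved for every matroid and every number `τ ≥ t` of
copies, through the property `HasSpanningLayers`: for each degree threshold `d`, the kernel `K`
contains disjoint layers of vertices of degree at least `d`, each of which spans all vertices
outside `K` of degree at least `d`.

A greedy kernel of `τM` has this property by matroid union in the form of `Matroid.exists_tight`: if
none of the elements of `A` can be added to a coloured set, then `A` lies in a set `D` that is
spanned by the part of each colour class inside `D` (`IsGreedyKernel.hasSpanningLayers`).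

Now let `O` be an optimum and `C = O ∩ K`. A second greedy run, in the contraction `M / C`, produces
`K' ⊆ K \ O`, split into `t` classes each extending `C` independently, with `deg(K') ≥ t · deg(O \
K)` (`HasSpanningLayers.exists_extensions`). Hence the vector with value `1` on `C` and `1/t` on
`K'` is an average of `t` independent sets. The degrees overcount edges with several vertices in `C
∪ K'`, but as every edge has at most `η` vertices this costs only a factor `1 - (η-1)/t`; this is
measured by a quadratic potential, inclusion-exclusion cut off after the pairs
(`WHypergraph.le_coverPot`). The potential is convex along exchange directions, so swap rounding
(`Matroid.exists_round`) turns the average into one independent set between `C` and `K` without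
loss, and on indicator vectors of supersets of `C` the potential is at most the covered weight
(`coverPot_indVec_le`).

The algorithm avoids computing in `τM`. It takes up to `t` successive greedy bases, each among the
vertices left by the previous ones. Each basis spans a vertex left over at the end by elements of at
least its degree, so the union again has spanning layers (`KernelInv.hasSpanningLayers`), and it has
at most `kt` elements. All independent subsets of it are enumerated, at most `(3t)^k` many
(`EnumInv.length_le`), and the best one is returned. Only the independence test depends on the class
of matroids: counting for capacities, Hall's condition over all subsets for transversal matroids. -/

/-- `S` can be coloured with the colours `ι` so that every colour class is independent. -/
def Matroid.Colorable {V : Type*} (N : Matroid V) (ι : Type*) (S : Set V) : Prop :=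
  ∃ c : V → ι, ∀ j, N.Indep {u | u ∈ S ∧ c u = j}

/-! ### Matroid union: coloured sets that cannot be extended. -/

namespace Matroid

variable {V ι : Type*} {N : Matroid V} {S : Set V} {c : V → ι}

lemma Colorable.subset {T : Set V} (h : N.Colorable ι S) (hT : T ⊆ S) : N.Colorable ι T := by
  obtain ⟨c, hc⟩ := h
  exact ⟨c, fun j => (hc j).subset fun u hu => ⟨hT hu.1, hu.2⟩⟩

/-- The elements surviving `i` rounds of restricting every colour class to the current set and
keeping only what all of the restricted classes span. -/
def stage (N : Matroid V) (c : V → ι) (S : Set V) : ℕ → Set V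
  | 0 => Set.univ
  | i + 1 => {x ∈ stage N c S i | ∀ j, x ∈ N.closure ({u | u ∈ S ∧ c u = j} ∩ stage N c S i)}

lemma stage_antitone (N : Matroid V) (c : V → ι) (S : Set V) : Antitone (N.stage c S) :=
  antitone_nat_of_succ_le fun _ _ hx => hx.1

-- The stage at which `v` is lost bounds the length of an augmenting sequence of exchanges, hence
-- the induction on `m`. If `v` does not fit into the class `j` that fails to span it, some element
-- `u` of its fundamental circuit is lost strictly before `v`. Exchanging `u` for `v` keeps the
-- earlier stages, and the induction hypothesis inserts `u` again.
open Classical in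
lemma colorable_insert_of_notMem_stage (m : ℕ) : ∀ (S : Set V) (c : V → ι) (v : V), v ∉ S →
    v ∈ N.E → (∀ j, N.Indep {u | u ∈ S ∧ c u = j}) → v ∉ N.stage c S m →
    N.Colorable ι (insert v S) := by
  induction m using Nat.strong_induction_on with
  | _ m ih =>
  intro S c v hvS hvE hc hvm
  have hex : ∃ i, v ∉ N.stage c S i := ⟨m, hvm⟩
  obtain ⟨i, hi⟩ : ∃ i, Nat.find hex = i + 1 := by
    apply Nat.exists_eq_succ_of_ne_zero
    intro h0
    have := Nat.find_spec hex
    rw [h0] at this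
    exact this (Set.mem_univ _)
  have hiv : v ∈ N.stage c S i := by
    by_contra h
    have := Nat.find_min' hex h
    omega
  have hiv' : v ∉ N.stage c S (i + 1) := hi ▸ Nat.find_spec hex
  have him : i + 1 ≤ m := hi ▸ Nat.find_min' hex hvm
  obtain ⟨j, hj⟩ : ∃ j, v ∉ N.closure ({u | u ∈ S ∧ c u = j} ∩ N.stage c S i) := by
    by_contra! h
    exact hiv' ⟨hiv, h⟩
  set J := {u | u ∈ S ∧ c u = j} with hJ
  have hvJ : v ∉ J := fun h => hvS h.1
  by_cases hins : N.Indep (insert v J)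
  · refine ⟨Function.update c v j, fun j' => ?_⟩
    by_cases hjj : j' = j
    · subst hjj
      refine hins.subset ?_
      rintro u ⟨hu, hcu⟩
      by_cases huv : u = v
      · exact Or.inl huv
      · rw [Function.update_of_ne huv] at hcu
        exact Or.inr ⟨hu.resolve_left huv, hcu⟩
    · refine (hc j').subset ?_
      rintro u ⟨hu, hcu⟩
      by_cases huv : u = v
      · subst huv
        rw [Function.update_self] at hcu
        exact absurd hcu.symm hjj
      · rw [Function.update_of_ne huv] at hcu
        exact ⟨hu.resolve_left huv, hcu⟩
  have hvcl : v ∈ N.closure J := by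
    by_contra h
    exact hins (((hc j).notMem_closure_iff_of_notMem hvJ hvE).1 h)
  set C := N.fundCircuit v J with hCdef
  have hCc : N.IsCircuit C := (hc j).fundCircuit_isCircuit hvcl hvJ
  have hCJ : C ⊆ insert v J := N.fundCircuit_subset_insert v J
  have hvC : v ∈ C := N.mem_fundCircuit v J
  -- If the whole circuit survived, `C \ {v}` would span `v` from inside stage `i`, against the
  -- choice of `j`. The same argument gives `l ≤ i` below.
  have hleave : ∃ l, ∃ u ∈ C, u ∉ N.stage c S l := by
    by_contra! h
    refine hj (N.closure_subset_closure ?_ (hCc.mem_closure_sdiff_singleton_of_mem hvC))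
    rintro u ⟨huC, huv⟩
    exact ⟨(hCJ huC).resolve_left huv, h i u huC⟩
  obtain ⟨u, huC, hul⟩ := Nat.find_spec hleave
  set l := Nat.find hleave with hl
  have hlmin : ∀ l' < l, C ⊆ N.stage c S l' := by
    intro l' hl' x hx
    by_contra h
    exact Nat.find_min hleave hl' ⟨x, hx, h⟩
  have hli : l ≤ i := by
    by_contra h
    refine hj (N.closure_subset_closure ?_ (hCc.mem_closure_sdiff_singleton_of_mem hvC))
    rintro u ⟨huC, huv⟩
    exact ⟨(hCJ huC).resolve_left huv, hlmin i (by omega) huC⟩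
  have huv : u ≠ v := by
    rintro rfl
    exact hul (N.stage_antitone c S hli hiv)
  have huJ : u ∈ J := (hCJ huC).resolve_left huv
  set S' := insert v (S \ {u}) with hS'
  set c' := Function.update c v j with hc'
  have hclass : ∀ j', j' ≠ j → {x | x ∈ S' ∧ c' x = j'} = {x | x ∈ S ∧ c x = j'} := by
    intro j' hj'
    ext x
    by_cases hxv : x = v
    · subst hxv
      simp [hc', hvS, Ne.symm hj']
    · by_cases hxu : x = u
      · subst hxu
        have : c x ≠ j' := by rw [huJ.2]; exact hj'.symm
        simp [hS', hc', hxv, this]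
      · simp [hS', hc', hxv, hxu]
  have hclassj : {x | x ∈ S' ∧ c' x = j} = insert v J \ {u} := by
    ext x
    by_cases hxv : x = v
    · subst hxv
      simp [hS', hc', Ne.symm huv]
    · simp only [hS', hc', hJ, Function.update_of_ne hxv, Set.mem_insert_iff, hxv, false_or,
        Set.mem_sdiff, Set.mem_singleton_iff, Set.mem_ofPred_eq]
      tauto
  have hindj : N.Indep (insert v J \ {u}) :=
    ((hc j).mem_fundCircuit_iff hvcl hvJ).1 huC
  -- Before stage `l` the whole circuit is present, so inside the stage `u` and `v` are each spanned
  -- by the rest of the circuit; the exchange does not change the closure of class `j`.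
  have hstage : ∀ l' ≤ l, N.stage c' S' l' = N.stage c S l' := by
    intro l'
    induction l' with
    | zero => intro _; rfl
    | succ l' ihl =>
      intro hll
      have hsub := hlmin l' (by omega)
      have key : ∀ j', N.closure ({x | x ∈ S' ∧ c' x = j'} ∩ N.stage c S l') =
          N.closure ({x | x ∈ S ∧ c x = j'} ∩ N.stage c S l') := by
        intro j'
        by_cases hjj : j' = j
        · subst hjj
          rw [hclassj]
          apply subset_antisymm <;> apply N.closure_subset_closure_of_subset_closure
          · rintro x ⟨⟨hx1, hx2⟩, hx3⟩
            rcases hx1 with rfl | hx1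
            · refine N.closure_subset_closure ?_ (hCc.mem_closure_sdiff_singleton_of_mem hvC)
              rintro y ⟨hyC, hyv⟩
              exact ⟨(hCJ hyC).resolve_left hyv, hsub hyC⟩
            · exact N.mem_closure_of_mem' ⟨hx1, hx3⟩ ((hc _).subset_ground hx1)
          · rintro x ⟨hx1, hx3⟩
            by_cases hxu : x = u
            · subst hxu
              refine N.closure_subset_closure ?_ (hCc.mem_closure_sdiff_singleton_of_mem huC)
              rintro y ⟨hyC, hyv⟩
              exact ⟨⟨hCJ hyC, hyv⟩, hsub hyC⟩
            · exact N.mem_closure_of_mem' ⟨⟨Or.inr hx1, hxu⟩, hx3⟩ ((hc _).subset_ground hx1)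
        · rw [hclass j' hjj]
      simp only [stage, ihl (by omega), key]
  have huS' : u ∉ S' := by simp [hS', huv]
  -- `u` is missing from stage `l < m` of the new colouring as well, and `S' ∪ {u} = S ∪ {v}`.
  have := ih l (by omega) S' c' u huS' ((hc j).subset_ground huJ) (fun j' => by
    by_cases hjj : j' = j
    · subst hjj; rw [hclassj]; exact hindj
    · rw [hclass j' hjj]; exact hc j') (by rw [hstage l le_rfl]; exact hul)
  have hSS : insert u S' = insert v S := by
    rw [hS', Set.insert_comm, Set.insert_sdiff_singleton, Set.insert_eq_of_mem huJ.1]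
  rwa [hSS] at this

/-- If no element of `A` can be added to the coloured set `S`, then `A` lies in a set which is
spanned by the part inside of it of every colour class. -/
lemma exists_tight [Finite V] {A : Set V} (hc : ∀ j, N.Indep {u | u ∈ S ∧ c u = j})
    (hA : ∀ v ∈ A, v ∈ N.E ∧ v ∉ S ∧ ¬ N.Colorable ι (insert v S)) :
    ∃ D : Set V, A ⊆ D ∧ ∀ j, D ⊆ N.closure ({u | u ∈ S ∧ c u = j} ∩ D) := by
  have hmem : ∀ v ∈ A, ∀ m, v ∈ N.stage c S m := by
    intro v hv m
    by_contra h
    obtain ⟨h1, h2, h3⟩ := hA v hv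
    exact h3 (colorable_insert_of_notMem_stage m S c v h2 h1 hc h)
  obtain ⟨m, hm⟩ : ∃ m, N.stage c S m = N.stage c S (m + 1) := by
    obtain ⟨m, hm⟩ := WellFounded.has_min (r := (· < ·)) (wellFounded_lt (α := Set V))
      (Set.range (N.stage c S)) ⟨_, 0, rfl⟩
    obtain ⟨⟨i, rfl⟩, hm⟩ := hm
    refine ⟨i, ?_⟩
    have h1 := N.stage_antitone c S (Nat.le_succ i)
    rcases h1.eq_or_lt with h | h
    · exact h.symm
    · exact absurd h (hm _ ⟨i + 1, rfl⟩)
  refine ⟨N.stage c S m, fun v hv => hmem v hv m, fun j x hx => ?_⟩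
  rw [hm] at hx
  exact hx.2 j

end Matroid

/-! ### Rounding a convex combination of independent sets -/

namespace Matroid

variable {V : Type*} [DecidableEq V] {M : Matroid V}

/-- The indicator vector of a finite set. -/
def indVec (I : Finset V) : V → ℝ := fun v => if v ∈ I then 1 else 0

lemma indVec_insert {I : Finset V} {i : V} (hi : i ∉ I) :
    indVec (insert i I) = indVec I + Pi.single i 1 := by
  ext v
  by_cases hv : v = i
  · subst hv; simp [indVec, hi]
  · simp [indVec, hv]

lemma indVec_erase {I : Finset V} {i : V} (hi : i ∈ I) :
    indVec (I.erase i) = indVec I - Pi.single i 1 := by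
  ext v
  by_cases hv : v = i
  · subst hv; simp [indVec, hi]
  · simp [indVec, hv]

/-- `Φ` does not decrease in at least one of the directions `d` and `-d`, where `d` is a unit
vector or a difference of two unit vectors. -/
def SwapConvex (Φ : (V → ℝ) → ℝ) : Prop :=
  ∀ (x : V → ℝ) (α β : ℝ) (i : V), 0 ≤ α → 0 ≤ β →
    (Φ x ≤ Φ (x + α • Pi.single i 1) ∨ Φ x ≤ Φ (x - β • Pi.single i 1)) ∧
    ∀ j, Φ x ≤ Φ (x + α • (Pi.single i 1 - Pi.single j 1)) ∨
      Φ x ≤ Φ (x - β • (Pi.single i 1 - Pi.single j 1))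

/-- The circuit of `i` in `I₂ + i`, without `i`, cannot lie in the closure of `I₁ - i`, since that
closure would then contain `i`. An element `j` of the circuit outside the closure serves both
exchanges. -/
lemma exists_symm_exchange {I₁ I₂ : Finset V} (h₁ : M.Indep I₁) (h₂ : M.Indep I₂) {i : V}
    (hi₁ : i ∈ I₁) (hi₂ : i ∉ I₂) (hi : ¬ M.Indep (insert i I₂ : Finset V)) :
    ∃ j ∈ I₂, j ∉ I₁ ∧ M.Indep (insert j (I₁.erase i) : Finset V) ∧
      M.Indep (insert i (I₂.erase j) : Finset V) := by
  have hiE : i ∈ M.E := h₁.subset_ground hi₁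
  have hicl : i ∈ M.closure I₂ := by
    by_contra h
    apply hi
    rw [Finset.coe_insert]
    exact (h₂.notMem_closure_iff_of_notMem (by simpa using hi₂) hiE).1 h
  have hC := h₂.fundCircuit_isCircuit hicl (by simpa using hi₂)
  have hCsub := M.fundCircuit_subset_insert i (I₂ : Set V)
  have hiC := M.mem_fundCircuit i (I₂ : Set V)
  obtain ⟨j, ⟨hjC, hji⟩, hjcl⟩ : ∃ j ∈ M.fundCircuit i I₂ \ {i},
      j ∉ M.closure ((I₁ : Set V) \ {i}) := by
    by_contra! h
    exact h₁.notMem_closure_sdiff_of_mem hi₁ (M.closure_subset_closure_of_subset_closure h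
      (hC.mem_closure_sdiff_singleton_of_mem hiC))
  have hj₂ : j ∈ I₂ := by simpa using (hCsub hjC).resolve_left hji
  have hji' : j ≠ i := hji
  have hjE := h₂.subset_ground (Finset.mem_coe.2 hj₂)
  have hj₁ : j ∉ I₁ := fun h =>
    hjcl (M.mem_closure_of_mem' ⟨Finset.mem_coe.2 h, hji⟩ hjE)
  refine ⟨j, hj₂, hj₁, ?_, ?_⟩
  · rw [Finset.coe_insert, Finset.coe_erase]
    exact ((h₁.sdiff {i}).notMem_closure_iff_of_notMem (fun h => hj₁ h.1) hjE).1 hjcl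
  · have := (h₂.mem_fundCircuit_iff hicl (by simpa using hi₂)).1 hjC
    rw [Finset.coe_insert, Finset.coe_erase, Set.insert_sdiff_singleton_comm hji'.symm]
    exact this

/-- Swap rounding: an element or a pair in the symmetric difference allows a change of `I₁` or a
change of `I₂`. These move the weighted sum in opposite directions along the same vector, so
swap-convexity permits one of them, and either one brings the two sets closer. -/
lemma exists_merge {Φ : (V → ℝ) → ℝ} (hΦ : SwapConvex Φ) {β₁ β₂ : ℝ} (hβ₁ : 0 ≤ β₁)
    (hβ₂ : 0 ≤ β₂) (z : V → ℝ) (N : ℕ) : ∀ I₁ I₂ : Finset V, M.Indep I₁ → M.Indep I₂ →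
    (I₁ \ I₂).card + (I₂ \ I₁).card ≤ N →
    ∃ I : Finset V, M.Indep I ∧ I₁ ∩ I₂ ⊆ I ∧ I ⊆ I₁ ∪ I₂ ∧
      Φ (z + β₁ • indVec I₁ + β₂ • indVec I₂) ≤ Φ (z + (β₁ + β₂) • indVec I) := by
  induction N using Nat.strong_induction_on generalizing β₁ β₂ with
  | _ N ih =>
  -- The weights are quantified again so that the case `I₂ \ I₁ ≠ ∅` follows by exchanging the roles
  -- of the two sets.
  have main : ∀ {β₁ β₂ : ℝ}, 0 ≤ β₁ → 0 ≤ β₂ → ∀ I₁ I₂ : Finset V, M.Indep I₁ → M.Indep I₂ →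
      (I₁ \ I₂).card + (I₂ \ I₁).card ≤ N → (I₁ \ I₂).Nonempty →
      ∃ I : Finset V, M.Indep I ∧ I₁ ∩ I₂ ⊆ I ∧ I ⊆ I₁ ∪ I₂ ∧
        Φ (z + β₁ • indVec I₁ + β₂ • indVec I₂) ≤ Φ (z + (β₁ + β₂) • indVec I) := by
    intro β₁ β₂ hβ₁ hβ₂ I₁ I₂ h₁ h₂ hN hne
    obtain ⟨i, hi⟩ := hne
    obtain ⟨hi₁, hi₂⟩ := Finset.mem_sdiff.1 hi
    have cards : ∀ A B : Finset V, A ⊆ I₁ \ I₂ → B ⊆ I₂ \ I₁ → i ∉ A →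
        A.card + B.card < N := by
      intro A B hA hB hiA
      have h1 : A.card < (I₁ \ I₂).card :=
        Finset.card_lt_card ⟨hA, fun h => hiA (h hi)⟩
      have h2 := Finset.card_le_card hB
      omega
    by_cases hins : M.Indep (insert i I₂ : Finset V)
    · have hA : ∀ β : ℝ, β • indVec (insert i I₂) = β • indVec I₂ + β • Pi.single i 1 := by
        intro β; rw [indVec_insert hi₂, smul_add]
      have hB : ∀ β : ℝ, β • indVec (I₁.erase i) = β • indVec I₁ - β • Pi.single i 1 := by
        intro β; rw [indVec_erase hi₁, smul_sub]
      -- Adding `i` to `I₂` moves by `+β₂` along the unit vector of `i`; deleting `i` from `I₁`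
      -- moves by `-β₁`.
      rcases (hΦ (z + β₁ • indVec I₁ + β₂ • indVec I₂) β₂ β₁ i hβ₂ hβ₁).1 with h | h
      · obtain ⟨I, hI, hsub, hsup, hval⟩ := ih _ (cards (I₁ \ insert i I₂) (insert i I₂ \ I₁)
          (by intro x; simp +contextual) (by
            intro x; simp only [Finset.mem_sdiff, Finset.mem_insert]
            rintro ⟨rfl | hx, hx'⟩
            · exact absurd hi₁ hx'
            · exact ⟨hx, hx'⟩) (by simp)) hβ₁ hβ₂ I₁ (insert i I₂) h₁ hins le_rfl
        refine ⟨I, hI, fun x hx => hsub ?_, fun x hx => ?_, h.trans (le_trans (le_of_eq ?_) hval)⟩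
        · simp only [Finset.mem_inter, Finset.mem_insert] at hx ⊢; tauto
        · have := hsup hx
          simp only [Finset.mem_union, Finset.mem_insert] at this ⊢
          rcases this with h | rfl | h <;> tauto
        · rw [hA]; congr 1; abel
      · obtain ⟨I, hI, hsub, hsup, hval⟩ := ih _ (cards (I₁.erase i \ I₂) (I₂ \ I₁.erase i)
          (by intro x; simp +contextual) (by
            intro x; simp only [Finset.mem_sdiff, Finset.mem_erase]
            rintro ⟨hx, hx'⟩
            refine ⟨hx, fun h => hx' ⟨?_, h⟩⟩
            rintro rfl
            exact hi₂ hx) (by simp)) hβ₁ hβ₂ (I₁.erase i) I₂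
              (h₁.subset (by simp)) h₂ le_rfl
        refine ⟨I, hI, fun x hx => hsub ?_, fun x hx => ?_, h.trans (le_trans (le_of_eq ?_) hval)⟩
        · simp only [Finset.mem_inter, Finset.mem_erase] at hx ⊢
          refine ⟨⟨?_, hx.1⟩, hx.2⟩
          rintro rfl
          exact hi₂ hx.2
        · have := hsup hx
          simp only [Finset.mem_union, Finset.mem_erase] at this ⊢
          tauto
        · rw [hB]; congr 1; abel
    · obtain ⟨j, hj₂, hj₁, hJ₁, hJ₂⟩ := exists_symm_exchange h₁ h₂ hi₁ hi₂ hins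
      have hji : j ≠ i := by rintro rfl; exact hj₁ hi₁
      have hA : ∀ β : ℝ, β • indVec (insert i (I₂.erase j)) =
          β • indVec I₂ + β • (Pi.single i 1 - Pi.single j 1) := by
        intro β
        rw [indVec_insert (by simp [hi₂]), indVec_erase hj₂, ← smul_add]
        congr 1; abel
      have hB : ∀ β : ℝ, β • indVec (insert j (I₁.erase i)) =
          β • indVec I₁ - β • (Pi.single i 1 - Pi.single j 1) := by
        intro β
        rw [indVec_insert (by simp [hj₁]), indVec_erase hi₁, ← smul_sub]
        congr 1; abel
      -- The same choice along the difference of the unit vectors of `i` and `j`: exchange in `I₂`,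
      -- or the reverse exchange in `I₁`.
      rcases (hΦ (z + β₁ • indVec I₁ + β₂ • indVec I₂) β₂ β₁ i hβ₂ hβ₁).2 j with h | h
      · obtain ⟨I, hI, hsub, hsup, hval⟩ := ih _ (cards (I₁ \ insert i (I₂.erase j))
          (insert i (I₂.erase j) \ I₁)
          (by
            intro x; simp only [Finset.mem_sdiff, Finset.mem_insert, Finset.mem_erase]
            rintro ⟨hx, hx'⟩
            refine ⟨hx, fun h => hx' (Or.inr ⟨?_, h⟩)⟩
            rintro rfl
            exact hj₁ hx)
          (by
            intro x; simp only [Finset.mem_sdiff, Finset.mem_insert, Finset.mem_erase]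
            rintro ⟨rfl | hx, hx'⟩
            · exact absurd hi₁ hx'
            · exact ⟨hx.2, hx'⟩) (by simp)) hβ₁ hβ₂ I₁ (insert i (I₂.erase j)) h₁ hJ₂ le_rfl
        refine ⟨I, hI, fun x hx => hsub ?_, fun x hx => ?_, h.trans (le_trans (le_of_eq ?_) hval)⟩
        · simp only [Finset.mem_inter, Finset.mem_insert, Finset.mem_erase] at hx ⊢
          refine ⟨hx.1, Or.inr ⟨?_, hx.2⟩⟩
          rintro rfl
          exact hj₁ hx.1
        · have := hsup hx
          simp only [Finset.mem_union, Finset.mem_insert, Finset.mem_erase] at this ⊢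
          rcases this with h | rfl | h <;> tauto
        · rw [hA]; congr 1; abel
      · obtain ⟨I, hI, hsub, hsup, hval⟩ := ih _ (cards (insert j (I₁.erase i) \ I₂)
          (I₂ \ insert j (I₁.erase i))
          (by
            intro x; simp only [Finset.mem_sdiff, Finset.mem_insert, Finset.mem_erase]
            rintro ⟨rfl | hx, hx'⟩
            · exact absurd hj₂ hx'
            · exact ⟨hx.2, hx'⟩)
          (by
            intro x; simp only [Finset.mem_sdiff, Finset.mem_insert, Finset.mem_erase]
            rintro ⟨hx, hx'⟩
            refine ⟨hx, fun h => hx' (Or.inr ⟨?_, h⟩)⟩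
            rintro rfl
            exact hi₂ hx) (by simp [hji.symm])) hβ₁ hβ₂ (insert j (I₁.erase i)) I₂ hJ₁ h₂ le_rfl
        refine ⟨I, hI, fun x hx => hsub ?_, fun x hx => ?_, h.trans (le_trans (le_of_eq ?_) hval)⟩
        · simp only [Finset.mem_inter, Finset.mem_insert, Finset.mem_erase] at hx ⊢
          refine ⟨Or.inr ⟨?_, hx.1⟩, hx.2⟩
          rintro rfl
          exact hi₂ hx.2
        · have := hsup hx
          simp only [Finset.mem_union, Finset.mem_insert, Finset.mem_erase] at this ⊢
          rcases this with (rfl | h) | h <;> tauto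
        · rw [hB]; congr 1; abel
  intro I₁ I₂ h₁ h₂ hN
  by_cases h12 : (I₁ \ I₂).Nonempty
  · exact main hβ₁ hβ₂ I₁ I₂ h₁ h₂ hN h12
  by_cases h21 : (I₂ \ I₁).Nonempty
  · obtain ⟨I, hI, hsub, hsup, hval⟩ := main hβ₂ hβ₁ I₂ I₁ h₂ h₁ (by omega) h21
    refine ⟨I, hI, by rwa [Finset.inter_comm], by rwa [Finset.union_comm], ?_⟩
    rwa [add_comm β₁ β₂, add_right_comm]
  · rw [Finset.not_nonempty_iff_eq_empty, Finset.sdiff_eq_empty_iff_subset] at h12 h21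
    obtain rfl := Finset.Subset.antisymm h12 h21
    exact ⟨I₁, h₁, by simp, by simp, by rw [add_smul, add_assoc]⟩

/-- A combination of independent sets between `C` and `U` with equal weights can be rounded to a
single such set without decreasing a swap-convex function. -/
lemma exists_round {ι : Type*} {Φ : (V → ℝ) → ℝ} (hΦ : SwapConvex Φ) {β : ℝ}
    (hβ : 0 ≤ β) {C U : Finset V} (I : ι → Finset V) {s : Finset ι} (hs : s.Nonempty)
    (hI : ∀ j, M.Indep (I j)) (hC : ∀ j, C ⊆ I j) (hU : ∀ j, I j ⊆ U) (z : V → ℝ) :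
    ∃ S : Finset V, M.Indep S ∧ C ⊆ S ∧ S ⊆ U ∧
      Φ (z + ∑ j ∈ s, β • indVec (I j)) ≤ Φ (z + (s.card * β) • indVec S) := by
  induction hs using Finset.Nonempty.cons_induction generalizing z with
  | singleton j => exact ⟨I j, hI j, hC j, hU j, by simp⟩
  | cons j s hj _ ih =>
    obtain ⟨S, hS, hCS, hSU, hval⟩ := ih (z + β • indVec (I j))
    obtain ⟨T, hT, hsub, hsup, hval'⟩ := exists_merge hΦ hβ
      (mul_nonneg (Nat.cast_nonneg s.card) hβ) z _ (I j) S (hI j) hS le_rfl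
    refine ⟨T, hT, (Finset.subset_inter (hC j) hCS).trans hsub,
      hsup.trans (Finset.union_subset (hU j) hSU), ?_⟩
    rw [Finset.sum_cons, Finset.card_cons, ← add_assoc]
    refine hval.trans (hval'.trans (le_of_eq ?_))
    congr 3
    push_cast; ring

end Matroid

/-! ### A swap-convex lower bound of the covered weight -/

namespace WHypergraph

open Matroid

variable {V : Type u} [DecidableEq V] (G : WHypergraph V)

lemma cover_nonneg (S : Finset V) : 0 ≤ G.cover S :=
  Finset.sum_nonneg fun e he => G.weight_nonneg e (Finset.mem_filter.1 he).1

lemma wdeg_nonneg (v : V) : 0 ≤ G.wdeg v :=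
  Finset.sum_nonneg fun e he => G.weight_nonneg e (Finset.mem_filter.1 he).1

lemma cover_empty : G.cover ∅ = 0 := by simp [cover]

lemma cover_singleton (v : V) : G.cover {v} = G.wdeg v := by
  unfold cover wdeg
  congr 1
  ext e
  simp [Finset.Nonempty]

/-- The quadratic part of the potential of an edge: the mass of the edge minus the mass of its
pairs. -/
noncomputable def edgePot (e : Finset V) (x : V → ℝ) : ℝ :=
  ∑ v ∈ e, x v - ((∑ v ∈ e, x v) ^ 2 - ∑ v ∈ e, x v ^ 2) / 2

/-- A quadratic lower bound of the weight covered by a superset of `C`. -/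
noncomputable def coverPot (C : Finset V) (x : V → ℝ) : ℝ :=
  G.cover C + ∑ e ∈ G.edges with ¬ (e ∩ C).Nonempty, G.weight e * edgePot e x

omit [DecidableEq V] in
lemma edgePot_add_smul (e : Finset V) (x d : V → ℝ) (s : ℝ) :
    edgePot e (x + s • d) = edgePot e x +
      s * (∑ v ∈ e, d v - (∑ v ∈ e, x v) * (∑ v ∈ e, d v) + ∑ v ∈ e, x v * d v) +
      s ^ 2 * ((∑ v ∈ e, d v ^ 2 - (∑ v ∈ e, d v) ^ 2) / 2) := by
  have h1 : ∑ v ∈ e, (x + s • d) v = ∑ v ∈ e, x v + s * ∑ v ∈ e, d v := by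
    simp [Finset.sum_add_distrib, Finset.mul_sum]
  have h2 : ∑ v ∈ e, (x + s • d) v ^ 2 =
      ∑ v ∈ e, x v ^ 2 + 2 * s * ∑ v ∈ e, x v * d v + s ^ 2 * ∑ v ∈ e, d v ^ 2 := by
    rw [Finset.mul_sum, Finset.mul_sum, ← Finset.sum_add_distrib, ← Finset.sum_add_distrib]
    refine Finset.sum_congr rfl fun v _ => ?_
    simp; ring
  rw [edgePot, h1, h2, edgePot]; ring

/-- On every line the potential is a quadratic polynomial; `hd` makes the second-order coefficient
of each edge nonnegative. -/
lemma exists_coverPot_add_smul (C : Finset V) (x d : V → ℝ)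
    (hd : ∀ e : Finset V, (∑ v ∈ e, d v) ^ 2 ≤ ∑ v ∈ e, d v ^ 2) :
    ∃ b c : ℝ, 0 ≤ c ∧ ∀ s : ℝ,
      G.coverPot C (x + s • d) = G.coverPot C x + s * b + s ^ 2 * c := by
  refine ⟨∑ e ∈ G.edges with ¬ (e ∩ C).Nonempty, G.weight e *
    (∑ v ∈ e, d v - (∑ v ∈ e, x v) * (∑ v ∈ e, d v) + ∑ v ∈ e, x v * d v),
    ∑ e ∈ G.edges with ¬ (e ∩ C).Nonempty, G.weight e *
      ((∑ v ∈ e, d v ^ 2 - (∑ v ∈ e, d v) ^ 2) / 2), ?_, ?_⟩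
  · refine Finset.sum_nonneg fun e he => mul_nonneg
      (G.weight_nonneg e (Finset.mem_filter.1 he).1) ?_
    have := hd e
    linarith
  · intro s
    rw [coverPot, coverPot, add_assoc, add_assoc, Finset.mul_sum, Finset.mul_sum,
      ← Finset.sum_add_distrib, ← Finset.sum_add_distrib]
    congr 1
    refine Finset.sum_congr rfl fun e _ => ?_
    rw [edgePot_add_smul]; ring

/-- Second-order terms vanish along unit vectors; along a difference of two of them only edges
containing both vertices contribute, with the sign of their weight. A convex quadratic does not
decrease on the side indicated by its slope. -/
lemma swapConvex_coverPot (C : Finset V) : SwapConvex (G.coverPot C) := by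
  have key : ∀ (x d : V → ℝ) (α β : ℝ), 0 ≤ α → 0 ≤ β →
      (∀ e : Finset V, (∑ v ∈ e, d v) ^ 2 ≤ ∑ v ∈ e, d v ^ 2) →
      G.coverPot C x ≤ G.coverPot C (x + α • d) ∨ G.coverPot C x ≤ G.coverPot C (x - β • d) := by
    intro x d α β hα hβ hd
    obtain ⟨b, c, hc, h⟩ := G.exists_coverPot_add_smul C x d hd
    rcases le_total 0 b with hb | hb
    · left
      rw [h]
      nlinarith [mul_nonneg hα hb, mul_nonneg (sq_nonneg α) hc]
    · right
      rw [sub_eq_add_neg, ← neg_smul, h]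
      nlinarith [mul_nonneg hβ (neg_nonneg.2 hb), mul_nonneg (sq_nonneg β) hc]
  have hs : ∀ (i : V) (e : Finset V),
      ∑ v ∈ e, (Pi.single i 1 : V → ℝ) v = if i ∈ e then 1 else 0 := by
    intro i e
    simp [Pi.single_apply]
  intro x α β i hα hβ
  refine ⟨key x _ α β hα hβ fun e => ?_, fun j => key x _ α β hα hβ fun e => ?_⟩
  · have h2 : ∑ v ∈ e, (Pi.single i 1 : V → ℝ) v ^ 2 = if i ∈ e then 1 else 0 := by
      rw [← hs]
      refine Finset.sum_congr rfl fun v _ => ?_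
      by_cases hv : v = i <;> simp [hv]
    rw [h2, hs]
    split_ifs <;> norm_num
  · by_cases hij : i = j
    · subst hij; simp
    have h2 : ∑ v ∈ e, (Pi.single i 1 - Pi.single j 1 : V → ℝ) v ^ 2 =
        (if i ∈ e then 1 else 0) + if j ∈ e then 1 else 0 := by
      rw [← hs, ← hs, ← Finset.sum_add_distrib]
      refine Finset.sum_congr rfl fun v _ => ?_
      by_cases hv : v = i
      · subst hv; simp [hij]
      · by_cases hv' : v = j
        · subst hv'; simp [hv]
        · simp [hv, hv']
    have h1 : ∑ v ∈ e, (Pi.single i 1 - Pi.single j 1 : V → ℝ) v =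
        (if i ∈ e then 1 else 0) - if j ∈ e then 1 else 0 := by
      rw [← hs, ← hs, ← Finset.sum_sub_distrib]; rfl
    rw [h1, h2]
    split_ifs <;> norm_num

/-- Bonferroni: an edge with `m ≥ 1` vertices in `S` has potential `m - m(m-1)/2 ≤ 1`, and an edge
with none has potential `0`. -/
lemma coverPot_indVec_le {C S : Finset V} (hCS : C ⊆ S) :
    G.coverPot C (indVec S) ≤ G.cover S := by
  have hsplit : G.cover S = G.cover C +
      ∑ e ∈ G.edges with ¬ (e ∩ C).Nonempty, if (e ∩ S).Nonempty then G.weight e else 0 := by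
    unfold cover
    rw [Finset.sum_filter, Finset.sum_filter, Finset.sum_filter, ← Finset.sum_add_distrib]
    refine Finset.sum_congr rfl fun e _ => ?_
    by_cases h : (e ∩ C).Nonempty
    · have : (e ∩ S).Nonempty := h.mono (Finset.inter_subset_inter_left hCS)
      simp [h, this]
    · simp [h]
  rw [hsplit, coverPot]
  refine add_le_add le_rfl (Finset.sum_le_sum fun e he => ?_)
  have hw := G.weight_nonneg e (Finset.mem_filter.1 he).1
  have h1 : ∑ v ∈ e, indVec S v = (e ∩ S).card := by
    simp [indVec, Finset.sum_ite_mem]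
  have h2 : ∑ v ∈ e, indVec S v ^ 2 = (e ∩ S).card := by
    rw [← h1]
    refine Finset.sum_congr rfl fun v _ => ?_
    unfold indVec
    split_ifs <;> norm_num
  rw [edgePot, h1, h2]
  split_ifs with h
  · refine mul_le_of_le_one_right hw ?_
    obtain h0 | h0 : (e ∩ S).card = 1 ∨ 2 ≤ (e ∩ S).card := by
      have := h.card_pos
      omega
    · rw [h0]; norm_num
    · have : (2 : ℝ) ≤ (e ∩ S).card := by exact_mod_cast h0
      nlinarith
  · rw [Finset.not_nonempty_iff_eq_empty] at h
    simp [h]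

/-- A lower bound of the potential at the uniform fractional choice with value `1 / t` on `K'`. -/
lemma le_coverPot {η t : ℕ} (hG : G.EdgeSizeLE η) (hη : 1 ≤ η) (ht : 0 < t)
    (hρ : ((η : ℝ) - 1) / t ≤ 1) {C O K' : Finset V}
    (hCK : Disjoint C K')
    (hdeg : (t : ℝ) * ∑ v ∈ O \ C, G.wdeg v ≤ ∑ v ∈ K', G.wdeg v) {x : V → ℝ}
    (hx : ∀ v ∉ C, x v = if v ∈ K' then (t : ℝ)⁻¹ else 0) :
    (1 - ((η : ℝ) - 1) / t) * G.cover O ≤ G.coverPot C x := by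
  have ht' : (0 : ℝ) < t := by exact_mod_cast ht
  have hη' : (1 : ℝ) ≤ η := by exact_mod_cast hη
  set ρ := 1 - ((η : ℝ) - 1) / t with hρdef
  have hρ0 : 0 ≤ ρ := by simp only [hρdef]; linarith
  have hρ1 : ρ ≤ 1 := by
    have : 0 ≤ ((η : ℝ) - 1) / t := div_nonneg (by linarith) ht'.le
    simp only [hρdef]; linarith
  -- Union bound: an edge met by `O` but not by `C` is counted in the degree of a vertex of `O \ C`.
  have hO : G.cover O ≤ G.cover C + ∑ v ∈ O \ C, G.wdeg v := by
    have hdegsum : ∑ v ∈ O \ C, G.wdeg v =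
        ∑ e ∈ G.edges, ∑ v ∈ O \ C, if v ∈ e then G.weight e else 0 := by
      rw [Finset.sum_comm]
      refine Finset.sum_congr rfl fun v _ => ?_
      rw [wdeg, Finset.sum_filter]
    rw [hdegsum]
    unfold cover
    rw [Finset.sum_filter, Finset.sum_filter, ← Finset.sum_add_distrib]
    refine Finset.sum_le_sum fun e he => ?_
    have hw := G.weight_nonneg e he
    have hnn : ∀ v ∈ O \ C, 0 ≤ if v ∈ e then G.weight e else 0 := fun v _ => by
      split_ifs <;> simp [hw]
    by_cases hc : (e ∩ C).Nonempty
    · have := Finset.sum_nonneg hnn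
      split_ifs <;> linarith
    · by_cases ho : (e ∩ O).Nonempty
      · obtain ⟨v, hv⟩ := ho
        rw [Finset.mem_inter] at hv
        have hvC : v ∉ C := fun h => hc ⟨v, Finset.mem_inter.2 ⟨hv.1, h⟩⟩
        have := Finset.single_le_sum hnn (Finset.mem_sdiff.2 ⟨hv.2, hvC⟩)
        rw [if_pos hv.1] at this
        split_ifs <;> linarith
      · rw [if_neg hc, if_neg ho]
        have := Finset.sum_nonneg hnn
        linarith
  -- As `C` and `K'` are disjoint, an edge meeting `C` has at most `η - 1` vertices in `K'`; all
  -- other edges are counted exactly.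
  have hK' : ∑ v ∈ K', G.wdeg v ≤ (∑ e ∈ G.edges with ¬ (e ∩ C).Nonempty,
      G.weight e * (e ∩ K').card) + ((η : ℝ) - 1) * G.cover C := by
    have hdegsum : ∑ v ∈ K', G.wdeg v = ∑ e ∈ G.edges, G.weight e * (e ∩ K').card := by
      have : ∀ v, G.wdeg v = ∑ e ∈ G.edges, if v ∈ e then G.weight e else 0 := fun v => by
        rw [wdeg, Finset.sum_filter]
      simp only [this]
      rw [Finset.sum_comm]
      refine Finset.sum_congr rfl fun e _ => ?_
      rw [← Finset.sum_filter, Finset.sum_const, nsmul_eq_mul, mul_comm, Finset.filter_mem_eq_inter,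
        Finset.inter_comm]
    rw [hdegsum]
    unfold cover
    rw [Finset.mul_sum, Finset.sum_filter, Finset.sum_filter, ← Finset.sum_add_distrib]
    refine Finset.sum_le_sum fun e he => ?_
    have hw := G.weight_nonneg e he
    by_cases hc : (e ∩ C).Nonempty
    · simp only [hc, not_true_eq_false, if_false, if_true, zero_add]
      rw [mul_comm]
      refine mul_le_mul_of_nonneg_right ?_ hw
      have h1 : (e ∩ K').card + (e ∩ C).card ≤ e.card := by
        rw [← Finset.card_union_of_disjoint]
        · exact Finset.card_le_card (by intro; simp; tauto)
        · exact (hCK.symm.mono Finset.inter_subset_right Finset.inter_subset_right)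
      have h2 := hc.card_pos
      have h3 := hG e he
      have h4 : (e ∩ K').card + 1 ≤ η := by omega
      have : ((e ∩ K').card : ℝ) + 1 ≤ η := by exact_mod_cast h4
      linarith
    · simp [hc]
  -- With `m = |e ∩ K'| ≤ η`, an edge missing `C` has potential `m/t - m(m-1)/(2t²)`, which is at
  -- least `(m/t)(1 - (η-1)/t) = ρm/t`.
  have hpot : G.cover C + ρ / t * ∑ e ∈ G.edges with ¬ (e ∩ C).Nonempty,
      G.weight e * (e ∩ K').card ≤ G.coverPot C x := by
    rw [coverPot, Finset.mul_sum]
    refine add_le_add le_rfl (Finset.sum_le_sum fun e he => ?_)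
    obtain ⟨he, hc⟩ := Finset.mem_filter.1 he
    have hw := G.weight_nonneg e he
    have hxe : ∀ v ∈ e, x v = if v ∈ K' then (t : ℝ)⁻¹ else 0 := fun v hv =>
      hx v fun h => hc ⟨v, Finset.mem_inter.2 ⟨hv, h⟩⟩
    have h1 : ∑ v ∈ e, x v = (e ∩ K').card * (t : ℝ)⁻¹ := by
      rw [Finset.sum_congr rfl hxe]
      simp [Finset.sum_ite_mem]
    have h2 : ∑ v ∈ e, x v ^ 2 = (e ∩ K').card * ((t : ℝ)⁻¹) ^ 2 := by
      rw [Finset.sum_congr rfl fun v hv => by rw [hxe v hv, ite_pow, zero_pow two_ne_zero]]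
      simp [Finset.sum_ite_mem]
    rw [edgePot, h1, h2, mul_left_comm]
    refine mul_le_mul_of_nonneg_left ?_ hw
    set m : ℝ := ((e ∩ K').card : ℝ) with hm
    have hm0 : 0 ≤ m := Nat.cast_nonneg _
    have hmη : m ≤ η := by
      have : (e ∩ K').card ≤ η := (Finset.card_le_card Finset.inter_subset_left).trans (hG e he)
      rw [hm]
      exact_mod_cast this
    rw [hρdef, div_eq_mul_inv, div_eq_mul_inv]
    set s := (t : ℝ)⁻¹ with hs
    have hs0 : 0 ≤ s := inv_nonneg.2 ht'.le
    have : m * s ^ 2 * (m - 1) / 2 ≤ m * s ^ 2 * ((η : ℝ) - 1) := by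
      have h3 : 0 ≤ m * s ^ 2 := by positivity
      nlinarith
    nlinarith
  have hst : ∑ v ∈ O \ C, G.wdeg v ≤ (∑ v ∈ K', G.wdeg v) / t := by
    rw [le_div_iff₀ ht']; linarith
  have hcov := G.cover_nonneg C
  have e1 : ρ * ∑ v ∈ O \ C, G.wdeg v ≤ ρ / t * ∑ v ∈ K', G.wdeg v := by
    rw [div_mul_eq_mul_div, mul_div_assoc]
    exact mul_le_mul_of_nonneg_left hst hρ0
  have e2 : ρ / t * ∑ v ∈ K', G.wdeg v ≤ ρ / t * ((∑ e ∈ G.edges with ¬ (e ∩ C).Nonempty,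
      G.weight e * (e ∩ K').card) + ((η : ℝ) - 1) * G.cover C) :=
    mul_le_mul_of_nonneg_left hK' (div_nonneg hρ0 ht'.le)
  -- Since `(η-1)/t = 1 - ρ`, the left side is `ρ(1-ρ)` times the weight covered by `C`. Together
  -- with the term `ρ * G.cover C` of `e4` it does not exceed `G.cover C`.
  have e3 : ρ / t * (((η : ℝ) - 1) * G.cover C) ≤ (1 - ρ) * G.cover C := by
    have : ρ / t * (((η : ℝ) - 1) * G.cover C) = ρ * ((1 - ρ) * G.cover C) := by
      rw [hρdef]; field_simp; ring
    rw [this]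
    exact mul_le_of_le_one_left (mul_nonneg (by linarith) hcov) hρ1
  have e4 := mul_le_mul_of_nonneg_left hO hρ0
  rw [mul_add] at e2 e4
  linarith

end WHypergraph

/-! ### Kernels -/

/-! ### The greedy procedure and independence in a matroid union. -/

section Greedy

variable {V : Type u} [DecidableEq V]

lemma greedy_append_singleton (indep : Finset V → Prop) (l : List V) (a : V) [Decidable
    (indep (insert a (greedy indep l)))] :
    greedy indep (l ++ [a]) = if indep (insert a (greedy indep l)) then
      insert a (greedy indep l) else greedy indep l := by
  rw [greedy, List.foldl_append, List.foldl_cons, List.foldl_nil, ← greedy]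
  split_ifs <;> rfl

open Classical in
/-- The greedy procedure on a list with non-increasing values `f` yields a feasible set, and every
rejected element is infeasible together with the chosen elements of at least the same value. -/
lemma greedy_spec {indep : Finset V → Prop} (hmono : ∀ S T, S ⊆ T → indep T → indep S)
    (hempty : indep ∅) (f : V → ℝ) (l : List V) (hl : l.Pairwise fun u v => f v ≤ f u) :
    indep (greedy indep l) ∧ (∀ u ∈ greedy indep l, u ∈ l) ∧
      ∀ v ∈ l, v ∉ greedy indep l →
        ¬ indep (insert v {u ∈ greedy indep l | f v ≤ f u}) := by
  induction l using List.reverseRecOn with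
  | nil => exact ⟨by simpa [greedy] using hempty, by simp [greedy], by simp⟩
  | append_singleton l a ih =>
    rw [List.pairwise_append] at hl
    obtain ⟨h1, h2, h3⟩ := ih hl.1
    have hsub : greedy indep l ⊆ greedy indep (l ++ [a]) := by
      rw [greedy_append_singleton]
      split_ifs
      · exact Finset.subset_insert _ _
      · exact subset_rfl
    refine ⟨?_, ?_, ?_⟩
    · rw [greedy_append_singleton]
      split_ifs with h
      exacts [h, h1]
    · intro u hu
      rw [greedy_append_singleton] at hu
      rw [List.mem_append, List.mem_singleton]
      split_ifs at hu
      · rcases Finset.mem_insert.1 hu with rfl | hu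
        · exact Or.inr rfl
        · exact Or.inl (h2 u hu)
      · exact Or.inl (h2 u hu)
    · intro v hv hv'
      rw [List.mem_append, List.mem_singleton] at hv
      by_cases hvl : v ∈ l
      · exact fun h => h3 v hvl (fun h => hv' (hsub h)) (hmono _ _
          (Finset.insert_subset_insert _ (Finset.filter_subset_filter _ hsub)) h)
      · obtain rfl := hv.resolve_left hvl
        intro h
        have hrej : ¬ indep (insert v (greedy indep l)) := by
          intro h'
          rw [greedy_append_singleton, if_pos h'] at hv'
          exact hv' (Finset.mem_insert_self _ _)
        refine hrej (hmono _ _ (Finset.insert_subset_insert _ fun u hu => ?_) h)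
        -- Everything chosen before the last entry precedes it in the order, so the filter by value
        -- removes none of it.
        exact Finset.mem_filter.2 ⟨hsub hu, hl.2.2 u (h2 u hu) v (by simp)⟩

lemma unionIndep_empty (M : Matroid V) (τ : ℕ) : UnionIndep M τ ∅ :=
  ⟨fun _ => ∅, by simp, by simp, by ext; simp⟩

-- A colouring is defined on all of `V`, so vertices outside `S` need a default colour; hence `0 <
-- τ`.
open Classical in
lemma unionIndep_iff_colorable {M : Matroid V} {τ : ℕ} (hτ : 0 < τ) (S : Finset V) :
    UnionIndep M τ S ↔ M.Colorable (Fin τ) (S : Set V) := by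
  constructor
  · rintro ⟨f, hf, -, rfl⟩
    refine ⟨fun v => if h : ∃ i, v ∈ f i then h.choose else ⟨0, hτ⟩, fun j => ?_⟩
    refine (hf j).subset ?_
    rintro u ⟨hu, rfl⟩
    have h : ∃ i, u ∈ f i := by simpa using hu
    simpa only [dif_pos h, Finset.mem_coe] using h.choose_spec
  · rintro ⟨c, hc⟩
    refine ⟨fun j => {u ∈ S | c u = j}, fun j => by simpa using hc j, fun i j hij => ?_, ?_⟩
    · rw [Finset.disjoint_left]
      intro u hu hu'
      exact hij ((Finset.mem_filter.1 hu).2.symm.trans (Finset.mem_filter.1 hu').2)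
    · ext u; simp

end Greedy

/-- If the super-level sets of `f` in `B` are `t` times smaller than those in `A`, so is the sum. -/
lemma mul_sum_le_sum_of_card_le {α β : Type*} {A : Finset α} {B : Finset β} {f : α → ℝ}
    {g : β → ℝ} {t : ℕ} (hf : ∀ a, 0 ≤ f a) (hg : ∀ b, 0 ≤ g b)
    (h : ∀ d : ℝ, t * {b ∈ B | d ≤ g b}.card ≤ {a ∈ A | d ≤ f a}.card) :
    t * ∑ b ∈ B, g b ≤ ∑ a ∈ A, f a := by
  classical
  -- Layer-cake formula: a value `c` in `[0, m]` is the integral over `d` in `[0, m]` of the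
  -- indicator of `d ≤ c`. Any common bound `m` works, and the hypothesis is then integrated over
  -- `d`.
  obtain ⟨m, hm0, hmA, hmB⟩ : ∃ m : ℝ, 0 ≤ m ∧ (∀ a ∈ A, f a ≤ m) ∧ ∀ b ∈ B, g b ≤ m :=
    ⟨∑ a ∈ A, f a + ∑ b ∈ B, g b,
      add_nonneg (Finset.sum_nonneg fun _ _ => hf _) (Finset.sum_nonneg fun _ _ => hg _),
      fun a ha => (Finset.single_le_sum (fun i _ => hf i) ha).trans
        (le_add_of_nonneg_right (Finset.sum_nonneg fun _ _ => hg _)),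
      fun b hb => (Finset.single_le_sum (fun i _ => hg i) hb).trans
        (le_add_of_nonneg_left (Finset.sum_nonneg fun _ _ => hf _))⟩
  have hanti : ∀ c : ℝ, Antitone fun d : ℝ => if d ≤ c then (1 : ℝ) else 0 := by
    intro c x y hxy
    by_cases hy : y ≤ c
    · simp [hy, hxy.trans hy]
    · simp only [hy, if_false]; split_ifs <;> norm_num
  have hint : ∀ c : ℝ, IntervalIntegrable (fun d : ℝ => if d ≤ c then (1 : ℝ) else 0)
      MeasureTheory.volume 0 m := fun c => (hanti c).intervalIntegrable
  have hval : ∀ c : ℝ, 0 ≤ c → c ≤ m → ∫ d in (0 : ℝ)..m, (if d ≤ c then (1 : ℝ) else 0) = c := by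
    intro c h0 hcm
    rw [← intervalIntegral.integral_add_adjacent_intervals (b := c)
      (hanti c).intervalIntegrable (hanti c).intervalIntegrable]
    have e1 : ∫ d in (0 : ℝ)..c, (if d ≤ c then (1 : ℝ) else 0) = ∫ _ in (0 : ℝ)..c, (1 : ℝ) := by
      refine intervalIntegral.integral_congr fun d hd => ?_
      rw [Set.uIcc_of_le h0] at hd
      simp [hd.2]
    have e2 : ∫ d in c..m, (if d ≤ c then (1 : ℝ) else 0) = ∫ _ in c..m, (0 : ℝ) := by
      refine intervalIntegral.integral_congr_ae (Filter.Eventually.of_forall fun d hd => ?_)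
      rw [Set.uIoc_of_le hcm] at hd
      simp [hd.1]
    rw [e1, e2]
    simp
  have hlev : ∀ {γ : Type _} (s : Finset γ) (φ : γ → ℝ), (∀ x, 0 ≤ φ x) → (∀ x ∈ s, φ x ≤ m) →
      ∑ x ∈ s, φ x = ∫ d in (0 : ℝ)..m, ∑ x ∈ s, if d ≤ φ x then (1 : ℝ) else 0 := by
    intro γ s φ h0 hm
    rw [intervalIntegral.integral_finsetSum fun x _ => hint _]
    exact Finset.sum_congr rfl fun x hx => (hval _ (h0 x) (hm x hx)).symm
  have hlev' : ∑ b ∈ B, g b = ∫ d in (0 : ℝ)..m, ∑ x ∈ B, if d ≤ g x then (1 : ℝ) else 0 := by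
    rw [intervalIntegral.integral_finsetSum fun x _ => hint _]
    exact Finset.sum_congr rfl fun x hx => (hval _ (hg x) (hmB x hx)).symm
  have hintA : IntervalIntegrable (fun d : ℝ => ∑ x ∈ A, if d ≤ f x then (1 : ℝ) else 0)
      MeasureTheory.volume 0 m := by
    simpa only [Finset.sum_fn] using IntervalIntegrable.sum A fun x _ => hint (f x)
  have hintB : IntervalIntegrable (fun d : ℝ => ∑ x ∈ B, if d ≤ g x then (1 : ℝ) else 0)
      MeasureTheory.volume 0 m := by
    simpa only [Finset.sum_fn] using IntervalIntegrable.sum B fun x _ => hint (g x)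
  rw [hlev A f hf hmA, hlev', ← intervalIntegral.integral_const_mul]
  refine intervalIntegral.integral_mono_on hm0 (hintB.const_mul _) hintA fun d _ => ?_
  rw [Finset.sum_boole, Finset.sum_boole]
  exact_mod_cast h d

/-! ### Spanning layers and the approximate solutions they yield. -/

section Kernel

variable {V : Type u} [DecidableEq V]

/-- At every degree threshold `d`, there are `t` disjoint subsets of `K` of elements of degree at
least `d` each of which spans all elements outside of `K` of degree at least `d`. -/
def HasSpanningLayers (G : WHypergraph V) (M : Matroid V) (t : ℕ) (K : Finset V) : Prop :=
  ∀ d : ℝ, ∃ X : Fin t → Finset V, (∀ i j, i ≠ j → Disjoint (X i) (X j)) ∧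
    (∀ j, ∀ u ∈ X j, u ∈ K ∧ d ≤ G.wdeg u) ∧
    ∀ v ∉ K, d ≤ G.wdeg v → ∀ j, v ∈ M.closure (X j)

variable {G : WHypergraph V} {M : Matroid V} {K : Finset V}

lemma exists_tight_finset [Finite V] {N : Matroid V} {ι : Type*} {S : Finset V} {c : V → ι}
    {A : Set V} (hc : ∀ j, N.Indep {u | u ∈ (S : Set V) ∧ c u = j})
    (hA : ∀ v ∈ A, v ∈ N.E ∧ v ∉ S ∧ ¬ N.Colorable ι (insert v S : Finset V)) :
    ∃ D : Set V, A ⊆ D ∧ ∀ j, D ⊆ N.closure {u | u ∈ S ∧ u ∈ D ∧ c u = j} := by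
  obtain ⟨D, hAD, hD⟩ := Matroid.exists_tight hc (A := A) fun v hv => by
    obtain ⟨h1, h2, h3⟩ := hA v hv
    exact ⟨h1, by simpa using h2, by simpa using h3⟩
  refine ⟨D, hAD, fun j => (hD j).trans (N.closure_subset_closure ?_)⟩
  rintro u ⟨⟨h1, h2⟩, h3⟩
  exact ⟨h1, h3, h2⟩

-- A rejected vertex of degree at least `d` is already blocked by chosen vertices of at least its
-- own degree, so it cannot be added to the part of `K` above the threshold. The layers are the
-- colour classes of that part inside the tight set containing all these rejected vertices.
open Classical in
lemma IsGreedyKernel.hasSpanningLayers [Finite V] {τ : ℕ} (hτ : 0 < τ) (hE : M.E = Set.univ)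
    (hK : IsGreedyKernel G M τ K) : HasSpanningLayers G M τ K := by
  obtain ⟨l, -, hall, hpw, rfl⟩ := hK
  have hmono : ∀ S T : Finset V, S ⊆ T → UnionIndep M τ T → UnionIndep M τ S := by
    intro S T hST hT
    rw [unionIndep_iff_colorable hτ] at hT ⊢
    exact hT.subset (by simpa using hST)
  obtain ⟨h1, -, h3⟩ := greedy_spec hmono (unionIndep_empty M τ) G.wdeg l hpw
  set K := greedy (UnionIndep M τ) l
  intro d
  obtain ⟨c, hc⟩ := (unionIndep_iff_colorable hτ K).1 h1
  obtain ⟨D, hAD, hD⟩ := exists_tight_finset (N := M) (S := {u ∈ K | d ≤ G.wdeg u}) (c := c)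
    (A := {v | v ∉ K ∧ d ≤ G.wdeg v})
    (fun j => (hc j).subset fun u hu => ⟨by have := hu.1; simp at this; exact this.1, hu.2⟩) (by
      rintro v ⟨hvK, hdv⟩
      refine ⟨by simp [hE], by simp [hvK], fun h => h3 v (hall v) hvK ?_⟩
      rw [unionIndep_iff_colorable hτ]
      refine h.subset ?_
      rw [Finset.coe_subset]
      exact Finset.insert_subset_insert _ (Finset.monotone_filter_right _ fun u _ hu => hdv.trans hu))
  refine ⟨fun j => {u ∈ {u ∈ K | d ≤ G.wdeg u} | u ∈ D ∧ c u = j}, fun i j hij => ?_, ?_,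
    fun v hv hdv j => M.closure_subset_closure (fun u hu => ?_) (hD j (hAD ⟨hv, hdv⟩))⟩
  · rw [Finset.disjoint_left]
    intro u hu hu'
    exact hij ((Finset.mem_filter.1 hu).2.2.symm.trans (Finset.mem_filter.1 hu').2.2)
  · intro j u hu
    simpa using (Finset.mem_filter.1 hu).1
  · exact Finset.mem_coe.2 (Finset.mem_filter.2 hu)

open Classical in
/-- From the layers one obtains, for every independent set `O`, disjoint extensions of `O ∩ K`
inside of `K` whose total degree is at least `t` times that of `O \ K`. -/
lemma HasSpanningLayers.exists_extensions [Fintype V] {t : ℕ} (ht : 0 < t) (hE : M.E = Set.univ)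
    (hK : HasSpanningLayers G M t K) {O : Finset V} (hO : M.Indep (O : Set V)) :
    ∃ (K' : Finset V) (c : V → Fin t), K' ⊆ K \ O ∧
      (∀ j, M.Indep (((O ∩ K) ∪ {u ∈ K' | c u = j} : Finset V) : Set V)) ∧
      (t : ℝ) * ∑ v ∈ O \ K, G.wdeg v ≤ ∑ v ∈ K', G.wdeg v := by
  set C := O ∩ K with hCdef
  have hC : M.Indep (C : Set V) := hO.subset (by simp [hCdef])
  -- In the contraction, a colour class is independent exactly if it is disjoint from `C` and
  -- independent together with `C` in `M`.
  set N := M.contract (C : Set V) with hN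
  have hNE : ∀ v ∉ C, v ∈ N.E := fun v hv => by simp [hN, hE, hv]
  set indep : Finset V → Prop := fun S => N.Colorable (Fin t) (S : Set V) with hindep
  have hmono : ∀ S T, S ⊆ T → indep T → indep S := fun S T hST hT =>
    Matroid.Colorable.subset hT (by simpa using hST)
  have hempty : indep ∅ := ⟨fun _ => ⟨0, ht⟩, by simp⟩
  obtain ⟨l, hlmem, hlpw⟩ : ∃ l : List V, (∀ v, v ∈ l ↔ v ∈ K \ C) ∧
      l.Pairwise fun u v => G.wdeg v ≤ G.wdeg u := by
    refine ⟨(K \ C).toList.insertionSort fun u v => G.wdeg v ≤ G.wdeg u, fun v => ?_, ?_⟩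
    · rw [List.mem_insertionSort, Finset.mem_toList]
    · have : Std.Total (fun u v : V => G.wdeg v ≤ G.wdeg u) := ⟨fun u v => le_total _ _⟩
      have : IsTrans V (fun u v : V => G.wdeg v ≤ G.wdeg u) := ⟨fun u v w h h' => h'.trans h⟩
      exact List.pairwise_insertionSort _ _
  obtain ⟨h1, h2, h3⟩ := greedy_spec hmono hempty G.wdeg l hlpw
  set K' := greedy indep l with hK'
  have hK'sub : K' ⊆ K \ C := fun u hu => (hlmem u).1 (h2 u hu)
  obtain ⟨c, hc⟩ := h1
  refine ⟨K', c, fun u hu => ?_, fun j => ?_, mul_sum_le_sum_of_card_le G.wdeg_nonneg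
    G.wdeg_nonneg fun d => ?_⟩
  · have := hK'sub hu
    simp only [hCdef, Finset.mem_sdiff, Finset.mem_inter] at this ⊢
    tauto
  · have := (hC.contract_indep_iff.1 (hc j)).2
    rw [Set.union_comm] at this
    simpa using this
  obtain ⟨X, hXdisj, hXK, hXcl⟩ := hK d
  set Kd' : Finset V := {a ∈ K' | d ≤ G.wdeg a} with hKd'
  -- Tightness once more, for the vertices of `K \ C` above the threshold that the second greedy run
  -- rejects. Those outside `D` must therefore have been chosen into `K'`.
  obtain ⟨D, hAD, hD⟩ := exists_tight_finset (N := N) (S := Kd') (c := c)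
    (A := {v | v ∈ K ∧ v ∉ C ∧ v ∉ K' ∧ d ≤ G.wdeg v})
    (fun j => (hc j).subset fun u hu => ⟨by have := hu.1; simp [hKd'] at this; exact this.1, hu.2⟩)
    (by
      rintro v ⟨hvK, hvC, hvK', hdv⟩
      refine ⟨hNE v hvC, by simp [hKd', hvK'], fun h => h3 v ((hlmem v).2 (by simp [hvK, hvC])) hvK'
        (h.subset ?_)⟩
      rw [Finset.coe_subset]
      exact Finset.insert_subset_insert _ (Finset.monotone_filter_right _ fun u _ hu => hdv.trans hu))
  set I : Fin t → Finset V := fun j => {u ∈ Kd' | u ∈ D ∧ c u = j} with hI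
  set Z : Fin t → Finset V := fun j => {u ∈ X j | u ∉ D ∧ u ∉ C} with hZ
  -- `C ∪ I j` spans the part of the layer `X j` in `D`, and `Z j` is what remains outside `D` and
  -- `C`. So `C ∪ I j ∪ Z j` spans `X j`, hence also the part of `O \ K` above the threshold;
  -- comparing ranks and cancelling `|C|` gives the bound.
  have hspan : ∀ j, ({b ∈ O \ K | d ≤ G.wdeg b} : Finset V).card ≤ (I j).card + (Z j).card := by
    intro j
    set Od : Finset V := {b ∈ O \ K | d ≤ G.wdeg b} with hOd
    set Y : Finset V := C ∪ (I j ∪ Z j) with hY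
    have hground : ∀ u : V, u ∈ M.E := fun u => by simp [hE]
    have hYcl : ∀ u ∈ Y, u ∈ M.closure (Y : Set V) := fun u hu =>
      M.mem_closure_of_mem' (by simpa using hu) (hground u)
    have hXcl' : (X j : Set V) ⊆ M.closure (Y : Set V) := by
      intro u hu
      have hu : u ∈ X j := hu
      by_cases huC : u ∈ C
      · exact hYcl u (by simp [hY, huC])
      by_cases huD : u ∈ D
      · have := hD j huD
        rw [hN, Matroid.contract_closure_eq] at this
        refine M.closure_subset_closure ?_ this.1
        rintro w (hw | hw)
        · exact Finset.mem_coe.2 (Finset.mem_union_right _ (Finset.mem_union_left _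
            (Finset.mem_filter.2 hw)))
        · exact Finset.mem_coe.2 (Finset.mem_union_left _ hw)
      · exact hYcl u (by simp [hY, hZ, hu, huC, huD])
    have hsub : ((C ∪ Od : Finset V) : Set V) ⊆ M.closure (Y : Set V) := by
      intro u hu
      rcases Finset.mem_union.1 (Finset.mem_coe.1 hu) with hu | hu
      · exact hYcl u (by simp [hY, hu])
      · obtain ⟨hu, hdu⟩ := Finset.mem_filter.1 hu
        exact M.closure_subset_closure_of_subset_closure hXcl'
          (hXcl u (Finset.mem_sdiff.1 hu).2 hdu j)
    have hindO : M.Indep ((C ∪ Od : Finset V) : Set V) := hO.subset (by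
      rw [Finset.coe_subset]
      refine Finset.union_subset Finset.inter_subset_left fun u hu => ?_
      exact (Finset.mem_sdiff.1 (Finset.mem_filter.1 hu).1).1)
    have hcard : (C ∪ Od).card ≤ Y.card := by
      have e1 := hindO.encard_le_eRk_of_subset hsub
      rw [Matroid.eRk_closure_eq] at e1
      have e2 := e1.trans (M.eRk_le_encard _)
      rw [Set.encard_coe_eq_coe_finsetCard, Set.encard_coe_eq_coe_finsetCard] at e2
      exact_mod_cast e2
    rw [Finset.card_union_of_disjoint (by
      rw [Finset.disjoint_left]
      intro u hu hu'
      exact (Finset.mem_sdiff.1 (Finset.mem_filter.1 hu').1).2 (Finset.mem_inter.1 hu).2)] at hcard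
    have e3 : Y.card ≤ C.card + ((I j).card + (Z j).card) :=
      (Finset.card_union_le _ _).trans (Nat.add_le_add_left (Finset.card_union_le _ _) _)
    omega
  have hdisjI : ∀ i j, i ≠ j → Disjoint (I i) (I j) := by
    intro i j hij
    rw [Finset.disjoint_left]
    intro u hu hu'
    exact hij ((Finset.mem_filter.1 hu).2.2.symm.trans (Finset.mem_filter.1 hu').2.2)
  have hdisjZ : ∀ i j, i ≠ j → Disjoint (Z i) (Z j) := fun i j hij =>
    (hXdisj i j hij).mono (Finset.filter_subset _ _) (Finset.filter_subset _ _)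
  -- All the `I j` and `Z j` are pairwise disjoint, the former inside `D` and the latter outside,
  -- and all lie in the part of `K'` above the threshold.
  calc t * ({b ∈ O \ K | d ≤ G.wdeg b} : Finset V).card
      = ∑ j : Fin t, ({b ∈ O \ K | d ≤ G.wdeg b} : Finset V).card := by simp
    _ ≤ ∑ j : Fin t, ((I j).card + (Z j).card) := Finset.sum_le_sum fun j _ => hspan j
    _ = (Finset.univ.biUnion I).card + (Finset.univ.biUnion Z).card := by
        rw [Finset.sum_add_distrib, Finset.card_biUnion fun i _ j _ hij => hdisjI i j hij,
          Finset.card_biUnion fun i _ j _ hij => hdisjZ i j hij]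
    _ = (Finset.univ.biUnion I ∪ Finset.univ.biUnion Z).card := by
        rw [Finset.card_union_of_disjoint]
        rw [Finset.disjoint_left]
        intro u hu hu'
        obtain ⟨i, -, hu⟩ := Finset.mem_biUnion.1 hu
        obtain ⟨j, -, hu'⟩ := Finset.mem_biUnion.1 hu'
        exact (Finset.mem_filter.1 hu').2.1 (Finset.mem_filter.1 hu).2.1
    _ ≤ Kd'.card := by
        refine Finset.card_le_card (Finset.union_subset (fun u hu => ?_) fun u hu => ?_)
        · obtain ⟨i, -, hu⟩ := Finset.mem_biUnion.1 hu
          exact (Finset.mem_filter.1 hu).1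
        · obtain ⟨i, -, hu⟩ := Finset.mem_biUnion.1 hu
          obtain ⟨huX, huD, huC⟩ := Finset.mem_filter.1 hu
          obtain ⟨huK, hdu⟩ := hXK i u huX
          refine Finset.mem_filter.2 ⟨?_, hdu⟩
          by_contra huK'
          exact huD (hAD ⟨huK, huC, huK', hdu⟩)

open Classical in
/-- A set with `t` spanning layers, where `t ≥ 1 / ε`, contains an approximate solution. -/
theorem HasSpanningLayers.containsApprox [Fintype V] {η t : ℕ} (hη : 1 ≤ η) {ε : ℝ} (hε : 0 < ε)
    (ht : 1 / ε ≤ t) (hG : G.EdgeSizeLE η) (hE : M.E = Set.univ)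
    (hK : HasSpanningLayers G M t K) : ContainsApprox G M (1 - ((η : ℝ) - 1) * ε) K := by
  have ht' : (0 : ℝ) < t := lt_of_lt_of_le (by positivity) ht
  have ht0 : 0 < t := by exact_mod_cast ht'
  have hη' : (0 : ℝ) ≤ (η : ℝ) - 1 := by
    have : (1 : ℝ) ≤ η := by exact_mod_cast hη
    linarith
  have hle : ((η : ℝ) - 1) / t ≤ ((η : ℝ) - 1) * ε := by
    rw [div_eq_mul_inv]
    refine mul_le_mul_of_nonneg_left ?_ hη'
    rw [inv_le_comm₀ ht' hε]
    simpa using ht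
  -- For a negative factor the empty set qualifies; otherwise `(η-1)/t ≤ 1`, as `le_coverPot`
  -- requires.
  by_cases hneg : 1 - ((η : ℝ) - 1) * ε < 0
  · refine ⟨∅, by simp, by simp, fun O _ => ?_⟩
    rw [G.cover_empty]
    exact mul_nonpos_of_nonpos_of_nonneg hneg.le (G.cover_nonneg O)
  push Not at hneg
  obtain ⟨O, hO, hmax⟩ : ∃ O : Finset V, M.Indep (O : Set V) ∧
      ∀ O' : Finset V, M.Indep (O' : Set V) → G.cover O' ≤ G.cover O := by
    obtain ⟨O, hO, hmax⟩ := Finset.exists_max_image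
      (Finset.univ.filter fun S : Finset V => M.Indep (S : Set V)) G.cover ⟨∅, by simp⟩
    exact ⟨O, by simpa using hO, fun O' hO' => hmax O' (by simpa using hO')⟩
  obtain ⟨K', c, hK', hind, hdeg⟩ := hK.exists_extensions ht0 hE hO
  set C := O ∩ K with hC
  have hOC : O \ C = O \ K := by simp [hC]
  have hCK' : Disjoint C K' := by
    rw [Finset.disjoint_left]
    intro u hu hu'
    exact (Finset.mem_sdiff.1 (hK' hu')).2 (Finset.mem_inter.1 hu).1
  have : Nonempty (Fin t) := ⟨⟨0, ht0⟩⟩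
  -- The `t` weights `1/t` add up to `1`, so the rounded vector is exactly the indicator vector of
  -- `S`.
  obtain ⟨S, hS, hCS, hSU, hval⟩ := Matroid.exists_round (M := M) (G.swapConvex_coverPot C)
    (β := (t : ℝ)⁻¹) (inv_nonneg.2 ht'.le) (C := C) (U := K)
    (fun j => C ∪ {u ∈ K' | c u = j}) (s := Finset.univ) Finset.univ_nonempty hind
    (fun j => Finset.subset_union_left)
    (fun j => Finset.union_subset Finset.inter_subset_right
      ((Finset.filter_subset _ _).trans (hK'.trans Finset.sdiff_subset))) 0
  refine ⟨S, hSU, hS, fun O' hO' => ?_⟩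
  rw [zero_add, zero_add, Finset.card_univ, Fintype.card_fin, mul_inv_cancel₀ ht'.ne',
    one_smul] at hval
  have hlow := G.le_coverPot hG hη ht0 (by linarith) hCK'
    (by rwa [hOC]) (x := ∑ j : Fin t, (t : ℝ)⁻¹ • Matroid.indVec (C ∪ {u ∈ K' | c u = j})) (by
      intro v hv
      simp only [Finset.sum_apply, Pi.smul_apply, Matroid.indVec, Finset.mem_union, hv, false_or,
        Finset.mem_filter, smul_eq_mul, mul_ite, mul_one, mul_zero]
      by_cases hvK : v ∈ K' <;> simp [hvK])
  calc (1 - ((η : ℝ) - 1) * ε) * G.cover O' ≤ (1 - ((η : ℝ) - 1) * ε) * G.cover O :=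
        mul_le_mul_of_nonneg_left (hmax O' hO') hneg
    _ ≤ (1 - ((η : ℝ) - 1) / t) * G.cover O :=
        mul_le_mul_of_nonneg_right (by linarith) (G.cover_nonneg O)
    _ ≤ G.cover S := (hlow.trans hval).trans (G.coverPot_indVec_le hCS)

lemma UnionIndep.card_le {τ k : ℕ} {S : Finset V} (hS : UnionIndep M τ S) (hk : M.eRank = k) :
    S.card ≤ τ * k := by
  obtain ⟨f, hf, -, rfl⟩ := hS
  refine Finset.card_biUnion_le.trans ?_
  calc ∑ j : Fin τ, (f j).card ≤ ∑ _j : Fin τ, k := Finset.sum_le_sum fun j _ => by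
        have := (hf j).encard_le_eRank
        rw [hk, Set.encard_coe_eq_coe_finsetCard] at this
        exact_mod_cast this
    _ = τ * k := by simp

lemma IsGreedyKernel.unionIndep {τ : ℕ} (hK : IsGreedyKernel G M τ K) : UnionIndep M τ K := by
  obtain ⟨l, -, -, -, rfl⟩ := hK
  classical
  induction l using List.reverseRecOn with
  | nil => exact unionIndep_empty M τ
  | append_singleton l a ih =>
    rw [greedy_append_singleton]
    split_ifs with h
    exacts [h, ih]

/-- Every greedy kernel of `τ M` with `τ ≥ 1 / ε` contains an approximate solution. -/
theorem IsGreedyKernel.containsApprox [Fintype V] {η τ : ℕ} (hη : 1 ≤ η) {ε : ℝ} (hε : 0 < ε)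
    (hτ : ⌈1 / ε⌉₊ ≤ τ) (hG : G.EdgeSizeLE η) (hE : M.E = Set.univ)
    (hK : IsGreedyKernel G M τ K) : ContainsApprox G M (1 - ((η : ℝ) - 1) * ε) K := by
  have h0 : 0 < ⌈1 / ε⌉₊ := Nat.ceil_pos.2 (by positivity)
  exact (hK.hasSpanningLayers (h0.trans_le hτ) hE).containsApprox hη hε
    ((Nat.le_ceil _).trans (by exact_mod_cast hτ)) hG hE

end Kernel

/-! ### Loops -/

namespace Prog

section Loops

variable {β γ : Type} {step : γ → β → γ} {cost : γ → β → ℕ} {step' : γ → γ} {cost' : γ → ℕ}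

/-- Knowing the position of the current entry in `l` lets a step use that `l` is sorted or has no
repetitions. -/
lemma foldl_invariant (Inv : List β → γ → Prop) {s : γ} {l : List β} (h0 : Inv [] s)
    (h : ∀ p y q s, l = p ++ y :: q → Inv p s → Inv (p ++ [y]) (step s y)) :
    Inv l (l.foldl step s) := by
  suffices H : ∀ q p s, l = p ++ q → Inv p s → Inv l (q.foldl step s) from H l [] s rfl h0
  intro q
  induction q with
  | nil => intro p s hl hp; simpa [hl] using hp
  | cons y q ih =>
    intro p s hl hp
    exact ih (p ++ [y]) _ (by simp [hl]) (h p y q s hl hp)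

lemma foldCost_le_of_invariant (Inv : List β → γ → Prop) (c : ℕ) {s : γ} {l : List β}
    (h0 : Inv [] s)
    (h : ∀ p y q s, l = p ++ y :: q → Inv p s → Inv (p ++ [y]) (step s y))
    (hc : ∀ p y q s, l = p ++ y :: q → Inv p s → cost s y ≤ c) :
    foldCost step cost s l ≤ l.length * (c + 1) + 1 := by
  suffices H : ∀ q p s, l = p ++ q → Inv p s →
      foldCost step cost s q ≤ q.length * (c + 1) + 1 from H l [] s rfl h0
  intro q
  induction q with
  | nil => intro p s _ _; simp [foldCost]
  | cons y q ih =>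
    intro p s hl hp
    have h1 := ih (p ++ [y]) _ (by simp [hl]) (h p y q s hl hp)
    have h2 := hc p y q s hl hp
    rw [foldCost, List.length_cons, add_mul, one_mul]
    omega

lemma foldCost_le (c : ℕ) {s : γ} {l : List β} (hc : ∀ s, ∀ y ∈ l, cost s y ≤ c) :
    foldCost step cost s l ≤ l.length * (c + 1) + 1 :=
  foldCost_le_of_invariant (fun _ _ => True) c trivial (fun _ _ _ _ _ _ => trivial)
    fun p y q s hl _ => hc s y (by simp [hl])

lemma iterate_invariant (Inv : ℕ → γ → Prop) {s : γ} (h0 : Inv 0 s) (m : ℕ)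
    (h : ∀ i < m, ∀ s, Inv i s → Inv (i + 1) (step' s)) : Inv m (step'^[m] s) := by
  induction m with
  | zero => exact h0
  | succ m ih =>
    rw [Function.iterate_succ_apply']
    exact h m (by omega) _ (ih fun i hi => h i (by omega))

lemma loopCost_le_of_invariant (Inv : γ → Prop) (c : ℕ) (h : ∀ s, Inv s → Inv (step' s))
    (hc : ∀ s, Inv s → cost' s ≤ c) (m : ℕ) : ∀ s, Inv s →
    loopCost step' cost' s m ≤ m * (c + 1) + 1 := by
  induction m with
  | zero => intro s _; simp [loopCost]
  | succ m ih =>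
    intro s hs
    have h1 := ih _ (h s hs)
    have h2 := hc s hs
    rw [loopCost, add_mul, one_mul]
    omega

end Loops

@[simp] lemma eval_id {a : Ty} (x : a.Val) : (id : Prog a a).eval x = x := rfl
@[simp] lemma eval_comp {a b c : Ty} (p : Prog b c) (q : Prog a b) (x : a.Val) :
    (comp p q).eval x = p.eval (q.eval x) := rfl
@[simp] lemma eval_unit {a : Ty} (x : a.Val) : (unit : Prog a .unit).eval x = () := rfl
@[simp] lemma eval_pair {a b c : Ty} (p : Prog a b) (q : Prog a c) (x : a.Val) :
    (pair p q).eval x = (p.eval x, q.eval x) := rfl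
@[simp] lemma eval_fst {a b : Ty} (x : a.Val × b.Val) : (fst : Prog (.prod a b) a).eval x = x.1 :=
  rfl
@[simp] lemma eval_snd {a b : Ty} (x : a.Val × b.Val) : (snd : Prog (.prod a b) b).eval x = x.2 :=
  rfl
@[simp] lemma eval_boolLit {a : Ty} (t : Bool) (x : a.Val) :
    (boolLit t : Prog a .bool).eval x = t := rfl
@[simp] lemma eval_ite {a b : Ty} (c : Prog a .bool) (p q : Prog a b) (x : a.Val) :
    (ite c p q).eval x = if c.eval x = true then p.eval x else q.eval x := rfl
@[simp] lemma eval_natLit {a : Ty} (m : ℕ) (x : a.Val) : (natLit m : Prog a .nat).eval x = m := rfl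
@[simp] lemma eval_natAdd (x : ℕ × ℕ) : natAdd.eval x = (x.1 + x.2 : ℕ) := rfl
@[simp] lemma eval_natLe (x : ℕ × ℕ) : natLe.eval x = decide (x.1 ≤ x.2) := rfl
@[simp] lemma eval_realZero {a : Ty} (x : a.Val) : (realZero : Prog a .real).eval x = (0 : ℝ) := rfl
@[simp] lemma eval_realOne {a : Ty} (x : a.Val) : (realOne : Prog a .real).eval x = (1 : ℝ) := rfl
@[simp] lemma eval_realAdd (x : ℝ × ℝ) : realAdd.eval x = (x.1 + x.2 : ℝ) := rfl
@[simp] lemma eval_realLe (x : ℝ × ℝ) : realLe.eval x = decide (x.1 ≤ x.2) := rfl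
@[simp] lemma eval_nil {a b : Ty} (x : a.Val) : (nil : Prog a (.list b)).eval x = [] := rfl
@[simp] lemma eval_cons {a : Ty} (x : a.Val × List a.Val) :
    (cons : Prog (.prod a (.list a)) _).eval x = x.1 :: x.2 := rfl

lemma cost_ite_le {a b : Ty} (c : Prog a .bool) (p q : Prog a b) (x : a.Val) :
    (ite c p q).cost x ≤ c.cost x + (p.cost x + q.cost x) + 1 := by
  rw [cost]; split_ifs <;> omega

lemma eval_fold {a b c : Ty} (p : Prog (.prod a (.prod c b)) c) (x : a.Val) (s : c.Val)
    (l : List b.Val) :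
    (fold p).eval (x, s, l) = l.foldl (fun s y => p.eval (x, s, y)) s := rfl

lemma eval_loop {a c : Ty} (p : Prog (.prod a c) c) (x : a.Val) (s : c.Val) (m : ℕ) :
    (loop p).eval (x, s, m) = (fun s => p.eval (x, s))^[m] s := rfl

@[simp] lemma cost_id {a : Ty} (x : a.Val) : (id : Prog a a).cost x = 1 := rfl
@[simp] lemma cost_comp {a b c : Ty} (p : Prog b c) (q : Prog a b) (x : a.Val) :
    (comp p q).cost x = q.cost x + p.cost (q.eval x) + 1 := rfl
@[simp] lemma cost_unit {a : Ty} (x : a.Val) : (unit : Prog a .unit).cost x = 1 := rfl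
@[simp] lemma cost_pair {a b c : Ty} (p : Prog a b) (q : Prog a c) (x : a.Val) :
    (pair p q).cost x = p.cost x + q.cost x + 1 := rfl
@[simp] lemma cost_fst {a b : Ty} (x : a.Val × b.Val) : (fst : Prog (.prod a b) a).cost x = 1 :=
  rfl
@[simp] lemma cost_snd {a b : Ty} (x : a.Val × b.Val) : (snd : Prog (.prod a b) b).cost x = 1 :=
  rfl
@[simp] lemma cost_boolLit {a : Ty} (t : Bool) (x : a.Val) :
    (boolLit t : Prog a .bool).cost x = 1 := rfl
@[simp] lemma cost_ite {a b : Ty} (c : Prog a .bool) (p q : Prog a b) (x : a.Val) :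
    (ite c p q).cost x = c.cost x + (if c.eval x = true then p.cost x else q.cost x) + 1 := rfl
@[simp] lemma cost_natLit {a : Ty} (m : ℕ) (x : a.Val) : (natLit m : Prog a .nat).cost x = 1 := rfl
@[simp] lemma cost_natAdd (x : ℕ × ℕ) : natAdd.cost x = 1 := rfl
@[simp] lemma cost_natLe (x : ℕ × ℕ) : natLe.cost x = 1 := rfl
@[simp] lemma cost_realZero {a : Ty} (x : a.Val) : (realZero : Prog a .real).cost x = 1 := rfl
@[simp] lemma cost_realOne {a : Ty} (x : a.Val) : (realOne : Prog a .real).cost x = 1 := rfl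
@[simp] lemma cost_realAdd (x : ℝ × ℝ) : realAdd.cost x = 1 := rfl
@[simp] lemma cost_realLe (x : ℝ × ℝ) : realLe.cost x = 1 := rfl
@[simp] lemma cost_nil {a b : Ty} (x : a.Val) : (nil : Prog a (.list b)).cost x = 1 := rfl
@[simp] lemma cost_cons {a : Ty} (x : a.Val × List a.Val) :
    (cons : Prog (.prod a (.list a)) _).cost x = 1 := rfl

lemma cost_fold_le_of_invariant {a b c : Ty} {p : Prog (.prod a (.prod c b)) c} {x : a.Val}
    {s : c.Val} {l : List b.Val} (Inv : List b.Val → c.Val → Prop) (m : ℕ) (h0 : Inv [] s)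
    (h : ∀ r y q s, l = r ++ y :: q → Inv r s → Inv (r ++ [y]) (p.eval (x, s, y)))
    (hc : ∀ r y q s, l = r ++ y :: q → Inv r s → p.cost (x, s, y) ≤ m) :
    (fold p).cost (x, s, l) ≤ l.length * (m + 1) + 1 :=
  foldCost_le_of_invariant Inv m h0 h hc

lemma cost_fold_le {a b c : Ty} {p : Prog (.prod a (.prod c b)) c} {x : a.Val}
    {s : c.Val} {l : List b.Val} (m : ℕ) (hc : ∀ s, ∀ y ∈ l, p.cost (x, s, y) ≤ m) :
    (fold p).cost (x, s, l) ≤ l.length * (m + 1) + 1 :=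
  foldCost_le m hc

lemma cost_loop_le {a c : Ty} {p : Prog (.prod a c) c} {x : a.Val} {s : c.Val}
    (Inv : c.Val → Prop) (m n : ℕ) (h0 : Inv s) (h : ∀ s, Inv s → Inv (p.eval (x, s)))
    (hc : ∀ s, Inv s → p.cost (x, s) ≤ m) :
    (loop p).cost (x, s, n) ≤ n * (m + 1) + 1 :=
  loopCost_le_of_invariant Inv m h hc n s h0

/-! ### Basic programs -/

abbrev LN : Ty := .list .nat

abbrev ET : Ty := .list (.prod (.list .nat) .real)

/-- The body of `memP`. -/
def memBody : Prog (.prod .nat (.prod .bool .nat)) .bool :=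
  .ite (.comp .natLe (.pair .fst (.comp .snd .snd)))
    (.ite (.comp .natLe (.pair (.comp .snd .snd) .fst)) (.boolLit true) (.comp .fst .snd))
    (.comp .fst .snd)

/-- Membership of a number in a list. -/
def memP : Prog (.prod .nat LN) .bool :=
  .comp (.fold memBody) (.pair .fst (.pair (.boolLit false) .snd))

lemma eval_memP (x : Ty.Val (.prod .nat LN)) : memP.eval x = decide (x.1 ∈ x.2) := by
  obtain ⟨v, l⟩ := x
  simp only [memP, eval_comp, eval_pair, eval_fst, eval_snd, eval_boolLit]
  rw [eval_fold]
  refine foldl_invariant (fun p s => s = decide (v ∈ p)) (by simp) ?_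
  rintro p y q s - rfl
  rcases lt_trichotomy v y with h | h | h
  · simp [memBody, h.le, h.not_ge, h.ne]
  · simp [memBody, h]
  · simp [memBody, h.not_ge, h.ne']

lemma cost_memP (v : ℕ) (l : List ℕ) : memP.cost (v, l) ≤ 40 * (l.length + 1) := by
  have h := cost_fold_le (p := memBody) (x := v) (s := false) (l := l) 30 fun s y _ => by
    simp [memBody]; split_ifs <;> norm_num
  simp [memP]
  omega

/-- The body of `anyP`. -/
def anyBody : Prog (.prod LN (.prod .bool .nat)) .bool :=
  .ite (.comp memP (.pair (.comp .snd .snd) .fst)) (.boolLit true) (.comp .fst .snd)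

/-- On input `(s, e)`, test whether the lists have a common entry. -/
def anyP : Prog (.prod LN LN) .bool :=
  .comp (.fold anyBody) (.pair .fst (.pair (.boolLit false) .snd))

lemma eval_anyP (x : Ty.Val (.prod LN LN)) : anyP.eval x = decide (∃ y ∈ x.2, y ∈ x.1) := by
  obtain ⟨s, e⟩ := x
  simp only [anyP, eval_comp, eval_pair, eval_fst, eval_snd, eval_boolLit]
  rw [eval_fold]
  refine foldl_invariant (fun p b => b = decide (∃ y ∈ p, y ∈ s)) (by simp) ?_
  rintro p y q b - rfl
  by_cases h : y ∈ s
  · simp [anyBody, eval_memP, h]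
  · simp [anyBody, eval_memP, h, or_and_right, exists_or]

lemma cost_anyP (s e : List ℕ) :
    anyP.cost (s, e) ≤ 100 * ((e.length + 1) * (s.length + 1)) := by
  have h := cost_fold_le (p := anyBody) (x := s) (s := false) (l := e) (40 * (s.length + 1) + 20)
    fun b y _ => by
      have := cost_memP y s
      refine (cost_ite_le _ _ _ _).trans ?_
      simp
      omega
  simp [anyP]
  nlinarith

/-- The body of `covP`. -/
def covBody : Prog (.prod LN (.prod .real (.prod LN .real))) .real :=
  .ite (.comp anyP (.pair .fst (.comp .fst (.comp .snd .snd))))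
    (.comp .realAdd (.pair (.comp .fst .snd) (.comp .snd (.comp .snd .snd)))) (.comp .fst .snd)

/-- The covered weight. -/
def covP : Prog (.prod ET LN) .real :=
  .comp (.fold covBody) (.pair .snd (.pair .realZero .fst))

/-- The total weight of the listed edges that have an entry in `s`. -/
def covL (Es : List (List ℕ × ℝ)) (s : List ℕ) : ℝ :=
  (Es.map fun p => if ∃ y ∈ p.1, y ∈ s then p.2 else 0).sum

lemma eval_covP (x : Ty.Val (.prod ET LN)) : covP.eval x = covL x.1 x.2 := by
  obtain ⟨Es, s⟩ := x
  simp only [covP, eval_comp, eval_pair, eval_fst, eval_snd, eval_realZero]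
  rw [eval_fold]
  refine foldl_invariant (fun p b => b = covL p s) (by simp [covL]) ?_
  rintro p y q b - rfl
  simp only [covBody, eval_ite, eval_comp, eval_pair, eval_fst, eval_snd, eval_realAdd, eval_anyP,
    covL, List.map_append,
    List.sum_append, decide_eq_true_eq]
  split_ifs with h <;> simp [h]

lemma cost_covP {Es : List (List ℕ × ℝ)} {h : ℕ} (hEs : ∀ p ∈ Es, p.1.length ≤ h) (s : List ℕ) :
    covP.cost (Es, s) ≤ 200 * ((Es.length + 1) * (h + 1) * (s.length + 1)) := by
  have hf := cost_fold_le (p := covBody) (x := s) (s := (0 : ℝ)) (l := Es)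
    (100 * ((h + 1) * (s.length + 1)) + 40) fun b y hy => by
      have h1 := cost_anyP s y.1
      have h2 : (y.1.length + 1) * (s.length + 1) ≤ (h + 1) * (s.length + 1) :=
        Nat.mul_le_mul_right _ (Nat.succ_le_succ (hEs y hy))
      refine (cost_ite_le _ _ _ _).trans ?_
      simp only [cost_comp, cost_pair, cost_fst, cost_snd, cost_realAdd,
        eval_pair, eval_comp, eval_fst, eval_snd]
      omega
  simp only [covP, cost_comp, cost_pair, cost_fst, cost_snd, cost_realZero,
        eval_pair, eval_fst, eval_snd, eval_realZero]
  have h3 : 1 ≤ (h + 1) * (s.length + 1) := Nat.mul_pos (by omega) (by omega)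
  rw [mul_assoc]
  nlinarith

/-- The degree of a vertex. -/
def degP : Prog (.prod ET .nat) .real := .comp covP (.pair .fst (.comp .cons (.pair .snd .nil)))

lemma eval_degP (x : Ty.Val (.prod ET .nat)) : degP.eval x = covL x.1 [x.2] := by
  simp only [degP, eval_comp, eval_pair, eval_fst, eval_snd, eval_cons, eval_nil, eval_covP]

lemma cost_degP {Es : List (List ℕ × ℝ)} {h : ℕ} (hEs : ∀ p ∈ Es, p.1.length ≤ h) (v : ℕ) :
    degP.cost (Es, v) ≤ 500 * ((Es.length + 1) * (h + 1)) := by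
  have h1 := cost_covP hEs [v]
  have h3 : 1 ≤ (Es.length + 1) * (h + 1) := Nat.mul_pos (by omega) (by omega)
  simp only [degP, cost_comp, cost_pair, cost_fst, cost_snd, cost_nil, cost_cons, eval_comp,
    eval_pair, eval_fst, eval_snd, eval_nil, eval_cons]
  simp only [List.length_cons, List.length_nil] at h1
  omega

/-- Prepend the reversal of the first list to the second one. -/
def revAppP {a : Ty} : Prog (.prod (.list a) (.list a)) (.list a) :=
  .comp (.fold (a := .unit) (.comp .cons (.pair (.comp .snd .snd) (.comp .fst .snd))))
    (.pair .unit (.pair .snd .fst))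

lemma eval_revAppP {a : Ty} (x : Ty.Val (.prod (.list a) (.list a))) :
    revAppP.eval x = x.1.reverse ++ x.2 := by
  obtain ⟨l, m⟩ := x
  simp only [revAppP, eval_comp, eval_pair, eval_fst, eval_snd, eval_unit]
  rw [eval_fold]
  refine foldl_invariant (fun p s => s = p.reverse ++ m) (by simp) ?_
  rintro p y q s - rfl
  simp

lemma cost_revAppP {a : Ty} (l m : List a.Val) : revAppP.cost (l, m) ≤ 20 * (l.length + 1) := by
  have h := cost_fold_le (a := .unit) (p := (.comp .cons (.pair (.comp .snd .snd)
    (.comp .fst .snd)) : Prog (.prod .unit (.prod (.list a) a)) (.list a))) (x := ()) (s := m)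
    (l := l) 9 fun s y _ => by simp
  simp only [revAppP, cost_comp, cost_pair, cost_fst, cost_snd, cost_unit, eval_pair, eval_fst,
    eval_snd, eval_unit]
  omega

end Prog

namespace Prog

/-! ### Sorting the vertices by degree -/

/-- The body of `splitP`. -/
def splitBody : Prog (.prod (.prod ET .nat) (.prod (.prod LN LN) .nat)) (.prod LN LN) :=
  .ite (.comp .realLe (.pair (.comp degP .fst)
      (.comp degP (.pair (.comp .fst .fst) (.comp .snd .snd)))))
    (.pair (.comp .cons (.pair (.comp .snd .snd) (.comp .fst (.comp .fst .snd))))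
      (.comp .snd (.comp .fst .snd)))
    (.pair (.comp .fst (.comp .fst .snd))
      (.comp .cons (.pair (.comp .snd .snd) (.comp .snd (.comp .fst .snd)))))

/-- Split a list into the entries of at least the degree of a given vertex and the other ones, in
reversed order. -/
def splitP : Prog (.prod ET (.prod LN .nat)) (.prod LN LN) :=
  .comp (.fold splitBody) (.pair (.pair .fst (.comp .snd .snd))
    (.pair (.pair .nil .nil) (.comp .fst .snd)))

open Classical in
lemma eval_splitP (x : Ty.Val (.prod ET (.prod LN .nat))) : splitP.eval x =
    ((x.2.1.filter fun y => covL x.1 [x.2.2] ≤ covL x.1 [y]).reverse,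
      (x.2.1.filter fun y => ¬ covL x.1 [x.2.2] ≤ covL x.1 [y]).reverse) := by
  obtain ⟨Es, l, u⟩ := x
  simp only [splitP, eval_comp, eval_pair, eval_fst, eval_snd, eval_nil]
  rw [eval_fold]
  refine foldl_invariant (fun p s => s =
    ((p.filter fun y => covL Es [u] ≤ covL Es [y]).reverse,
      (p.filter fun y => ¬ covL Es [u] ≤ covL Es [y]).reverse)) (by simp) ?_
  rintro p y q b - rfl
  simp only [splitBody, eval_ite, eval_comp, eval_pair, eval_fst, eval_snd, eval_realLe, eval_degP,
    eval_cons, decide_eq_true_eq]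
  by_cases h : covL Es [u] ≤ covL Es [y]
  · simp [h]
  · simp [h, not_le.1 h]

lemma cost_splitP {Es : List (List ℕ × ℝ)} {h : ℕ} (hEs : ∀ p ∈ Es, p.1.length ≤ h) (l : List ℕ)
    (u : ℕ) : splitP.cost (Es, l, u) ≤ 1200 * ((Es.length + 1) * (h + 1) * (l.length + 1)) := by
  have hW : 1 ≤ (Es.length + 1) * (h + 1) := Nat.mul_pos (by omega) (by omega)
  have hf := cost_fold_le (p := splitBody) (x := (Es, u)) (s := (([] : List ℕ), ([] : List ℕ)))
    (l := l) (1000 * ((Es.length + 1) * (h + 1)) + 60) fun s y _ => by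
      have h1 := cost_degP hEs u
      have h2 := cost_degP hEs y
      refine (cost_ite_le _ _ _ _).trans ?_
      simp only [cost_comp, cost_pair, cost_fst, cost_snd, cost_realLe, cost_cons,
        eval_pair, eval_comp, eval_fst, eval_snd]
      omega
  simp only [splitP, cost_comp, cost_pair, cost_fst, cost_snd, cost_nil, eval_pair, eval_comp,
    eval_fst, eval_snd, eval_nil]
  nlinarith

/-- Insert a vertex into a list which is sorted by degree. -/
def insP : Prog (.prod ET (.prod LN .nat)) LN :=
  .comp (.comp revAppP (.pair (.comp .fst .snd)
      (.comp .cons (.pair .fst (.comp revAppP (.pair (.comp .snd .snd) .nil))))))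
    (.pair (.comp .snd .snd) splitP)

open Classical in
lemma eval_insP (x : Ty.Val (.prod ET (.prod LN .nat))) : insP.eval x =
    (x.2.1.filter fun y => covL x.1 [x.2.2] ≤ covL x.1 [y]) ++
      x.2.2 :: x.2.1.filter fun y => ¬ covL x.1 [x.2.2] ≤ covL x.1 [y] := by
  simp only [insP, eval_comp, eval_pair, eval_fst, eval_snd, eval_nil, eval_cons, eval_revAppP,
    eval_splitP, List.reverse_reverse, List.append_nil]

lemma eval_insP_perm (x : Ty.Val (.prod ET (.prod LN .nat))) :
    (insP.eval x).Perm (x.2.2 :: x.2.1) := by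
  rw [eval_insP]
  refine List.perm_middle.trans (List.Perm.cons _ ?_)
  have := List.filter_append_perm (fun z => decide (covL x.1 [x.2.2] ≤ covL x.1 [z])) x.2.1
  simp only [decide_not]
  exact this

lemma cost_insP {Es : List (List ℕ × ℝ)} {h : ℕ} (hEs : ∀ p ∈ Es, p.1.length ≤ h) (l : List ℕ)
    (u : ℕ) : insP.cost (Es, l, u) ≤ 1300 * ((Es.length + 1) * (h + 1) * (l.length + 1)) := by
  have h1 := cost_splitP hEs l u
  have h2 := eval_splitP (Es, l, u)
  have h3 := cost_revAppP (a := .nat) (splitP.eval (Es, l, u)).2 []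
  have h4 := cost_revAppP (a := .nat) (splitP.eval (Es, l, u)).1
    (u :: revAppP.eval ((splitP.eval (Es, l, u)).2, []))
  have h5 : ∀ P : ℕ → Bool, (l.filter P).length ≤ l.length := fun P => List.length_filter_le _ _
  have h6 : (splitP.eval (Es, l, u)).1.length ≤ l.length := by
    rw [h2]; simpa using h5 _
  have h7 : (splitP.eval (Es, l, u)).2.length ≤ l.length := by
    rw [h2]
    have := h5 fun y => decide (¬ covL Es [u] ≤ covL Es [y])
    simpa only [List.length_reverse] using this
  have hW : 1 ≤ (Es.length + 1) * (h + 1) := Nat.mul_pos (by omega) (by omega)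
  have h8 : 1 * (l.length + 1) ≤ (Es.length + 1) * (h + 1) * (l.length + 1) :=
    Nat.mul_le_mul_right _ hW
  simp only [insP, cost_comp, cost_pair, cost_fst, cost_snd, cost_nil, cost_cons, eval_pair,
    eval_comp, eval_fst, eval_snd, eval_nil, eval_cons]
  omega

/-- Sort a list of vertices by non-increasing degree. -/
def sortP : Prog (.prod ET LN) LN := .comp (.fold insP) (.pair .fst (.pair .nil .snd))

lemma eval_sortP (x : Ty.Val (.prod ET LN)) : (sortP.eval x).Perm x.2 ∧
    List.Pairwise (fun u v => covL x.1 [v] ≤ covL x.1 [u]) (sortP.eval x) := by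
  obtain ⟨Es, l⟩ := x
  simp only [sortP, eval_comp, eval_pair, eval_fst, eval_snd, eval_nil]
  rw [eval_fold]
  refine foldl_invariant (fun p s => List.Perm s p ∧
    List.Pairwise (fun u v => covL Es [v] ≤ covL Es [u]) s) (by simp) ?_
  rintro p y q s - ⟨h1, h2⟩
  constructor
  · exact (eval_insP_perm _).trans ((h1.cons y).trans (List.perm_append_singleton y p).symm)
  rw [eval_insP]
  · rw [List.pairwise_append]
    refine ⟨h2.filter _, List.pairwise_cons.2 ⟨fun z hz => ?_, h2.filter _⟩, fun z hz w hw => ?_⟩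
    · have := List.of_mem_filter hz
      simp only [decide_eq_true_eq, not_le] at this
      exact this.le
    · have hz := List.of_mem_filter hz
      simp only [decide_eq_true_eq] at hz
      rcases List.mem_cons.1 hw with rfl | hw
      · exact hz
      · have := List.of_mem_filter hw
        simp only [decide_eq_true_eq, not_le] at this
        exact this.le.trans hz

lemma cost_sortP {Es : List (List ℕ × ℝ)} {h : ℕ} (hEs : ∀ p ∈ Es, p.1.length ≤ h) (l : List ℕ) :
    sortP.cost (Es, l) ≤ 1400 * ((Es.length + 1) * (h + 1) * (l.length + 1) ^ 2) := by
  have hW : 1 ≤ (Es.length + 1) * (h + 1) := Nat.mul_pos (by omega) (by omega)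
  have hf := cost_fold_le_of_invariant (p := insP) (x := Es) (s := ([] : List ℕ)) (l := l)
    (fun p s => List.length s = p.length) (1300 * ((Es.length + 1) * (h + 1) * (l.length + 1)))
    rfl (by
      rintro p y q s - hs
      rw [(eval_insP_perm _).length_eq, List.length_cons, List.length_append, hs]
      rfl) (by
      rintro p y q s hl hs
      refine (cost_insP hEs s y).trans ?_
      have : s.length ≤ l.length := by rw [hs, hl]; simp
      gcongr)
  simp only [sortP, cost_comp, cost_pair, cost_fst, cost_snd, cost_nil, eval_pair, eval_fst,
    eval_snd, eval_nil]
  nlinarith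

/-- The body of `rangeP`. -/
def rangeBody : Prog (.prod .unit (.prod .nat LN)) (.prod .nat LN) :=
  .pair (.comp .natAdd (.pair (.comp .fst .snd) (.natLit 1)))
    (.comp .cons (.pair (.comp .fst .snd) (.comp .snd .snd)))

/-- The list of all vertices. -/
def rangeP : Prog .nat LN :=
  .comp .snd (.comp (.loop rangeBody) (.pair .unit (.pair (.pair (.natLit 0) .nil) .id)))

lemma eval_rangeP (n : ℕ) : rangeP.eval n = (List.range n).reverse := by
  simp only [rangeP, eval_comp, eval_pair, eval_snd, eval_unit, eval_natLit, eval_nil, eval_id]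
  rw [eval_loop]
  have := iterate_invariant (step' := fun s => rangeBody.eval ((), s))
    (fun i s => s = (i, (List.range i).reverse)) (s := (0, [])) (by simp) n (by
      rintro i - s rfl
      simp [rangeBody, List.range_succ])
  exact congrArg Prod.snd this

lemma cost_rangeP (n : ℕ) : rangeP.cost n ≤ 30 * (n + 1) := by
  have h := cost_loop_le (p := rangeBody) (x := ()) (s := (0, [])) (fun _ => True) 20 n trivial
    (fun _ _ => trivial) fun s _ => by simp [rangeBody]
  simp only [rangeP, cost_comp, cost_pair, cost_snd, cost_unit, cost_natLit, cost_nil, cost_id,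
    eval_pair, eval_unit, eval_natLit, eval_nil, eval_id]
  simp only [Ty.Val] at h ⊢
  omega

end Prog

namespace Prog

/-! ### The algorithm for a given independence test -/

/-- The program `q` decides, with at most `Q` steps, whether a list with the hereditary property
`P` can be extended by a further vertex. -/
structure IsOracle {m : Ty} (q : Prog (.prod m LN) .bool) (D : m.Val) (n : ℕ)
    (P : List ℕ → Prop) (Q : ℕ) : Prop where
  nil : P []
  nodup : ∀ l, P l → l.Nodup
  lt : ∀ l, P l → ∀ x ∈ l, x < n
  tail : ∀ v l, P (v :: l) → P l
  eval : ∀ v l, P l → v ∉ l → v < n → (q.eval (D, v :: l) = true ↔ P (v :: l))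
  cost : ∀ v l, P l → v ∉ l → v < n → q.cost (D, v :: l) ≤ Q

lemma length_le_of_nodup {n : ℕ} {l : List ℕ} (hl : l.Nodup) (h : ∀ x ∈ l, x < n) :
    l.length ≤ n := by
  have := (List.subperm_of_subset hl fun x hx => List.mem_range.2 (h x hx)).length_le
  simpa using this

variable {m : Ty} (q : Prog (.prod m LN) .bool)

/-- The body of `roundP`. -/
def roundBody : Prog (.prod (.prod m LN) (.prod LN .nat)) LN :=
  .ite (.comp memP (.pair (.comp .snd .snd) (.comp .snd .fst))) (.comp .fst .snd)
    (.ite (.comp q (.pair (.comp .fst .fst) (.comp .cons (.pair (.comp .snd .snd)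
      (.comp .fst .snd)))))
      (.comp .cons (.pair (.comp .snd .snd) (.comp .fst .snd))) (.comp .fst .snd))

/-- A greedy basis of the vertices outside of `K`. -/
def roundP : Prog (.prod m (.prod LN LN)) LN :=
  .comp (.fold (roundBody q)) (.pair (.pair .fst (.comp .snd .snd)) (.pair .nil (.comp .fst .snd)))

variable {q} {D : m.Val} {n : ℕ} {P : List ℕ → Prop} {Q : ℕ}

lemma eval_roundBody (D : m.Val) (K B : List ℕ) (v : ℕ) :
    (roundBody q).eval ((D, K), B, v) =
      if v ∈ K then B else if q.eval (D, v :: B) = true then v :: B else B := by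
  simp only [roundBody, eval_ite, eval_comp, eval_pair, eval_fst, eval_snd, eval_cons, eval_memP,
    decide_eq_true_eq]
  rfl

lemma IsOracle.round_step (hq : IsOracle q D n P Q) {srt : List ℕ} (hlt : ∀ x ∈ srt, x < n)
    (hnd : srt.Nodup) (K : List ℕ) {p r B : List ℕ} {v : ℕ} (hs : srt = p ++ v :: r)
    (hB : P B ∧ ∀ x ∈ B, x ∈ p ∧ x ∉ K) :
    P ((roundBody q).eval ((D, K), B, v)) ∧
      ∀ x ∈ ((roundBody q).eval ((D, K), B, v) : List ℕ), x ∈ p ++ [v] ∧ x ∉ K := by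
  obtain ⟨hPB, hBp⟩ := hB
  have hvn : v < n := hlt v (by simp [hs])
  have hvB : v ∉ B := by
    intro h
    rw [hs, List.nodup_append] at hnd
    exact hnd.2.2 _ (hBp v h).1 v (by simp) rfl
  rw [eval_roundBody]
  split_ifs with h1 h2
  · exact ⟨hPB, fun x hx => ⟨by simp [(hBp x hx).1], (hBp x hx).2⟩⟩
  · refine ⟨(hq.eval v B hPB hvB hvn).1 h2, fun x hx => ?_⟩
    rcases List.mem_cons.1 hx with rfl | hx
    · exact ⟨by simp, h1⟩
    · exact ⟨by simp [(hBp x hx).1], (hBp x hx).2⟩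
  · exact ⟨hPB, fun x hx => ⟨by simp [(hBp x hx).1], (hBp x hx).2⟩⟩

/-- The witness `B₀` for a rejected vertex is the state of the basis at its rejection. As `P` is
only assumed to pass to tails, that state is remembered as it was rather than recovered from the
final basis by filtering. -/
lemma IsOracle.round_spec (hq : IsOracle q D n P Q) {srt : List ℕ} (hlt : ∀ x ∈ srt, x < n)
    (hnd : srt.Nodup) {f : ℕ → ℝ} (hpw : srt.Pairwise fun u v => f v ≤ f u) (K : List ℕ) :
    P ((roundP q).eval (D, srt, K)) ∧
      (∀ x ∈ ((roundP q).eval (D, srt, K) : List ℕ), x ∈ srt ∧ x ∉ K) ∧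
      ∀ v ∈ srt, v ∉ K → v ∉ ((roundP q).eval (D, srt, K) : List ℕ) →
        ∃ B₀ : List ℕ, P B₀ ∧ B₀ ⊆ (roundP q).eval (D, srt, K) ∧ (∀ u ∈ B₀, f v ≤ f u) ∧
          v ∉ B₀ ∧ ¬ P (v :: B₀) := by
  simp only [roundP, eval_comp, eval_pair, eval_fst, eval_snd, eval_nil]
  rw [eval_fold]
  have key := foldl_invariant (step := fun s y => (roundBody q).eval ((D, K), s, y))
    (fun p B => (P B ∧ ∀ x ∈ B, x ∈ p ∧ x ∉ K) ∧ ∀ v ∈ p, v ∉ K → v ∉ B →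
      ∃ B₀ : List ℕ, P B₀ ∧ B₀ ⊆ B ∧ (∀ u ∈ B₀, f v ≤ f u) ∧ v ∉ B₀ ∧ ¬ P (v :: B₀))
    (s := ([] : List ℕ)) (l := srt) ⟨⟨hq.nil, by simp⟩, by simp⟩ (by
      rintro p y r B hs ⟨hB, hrej⟩
      refine ⟨hq.round_step hlt hnd K hs hB, fun v hv hvK hvB => ?_⟩
      have hsub : B ⊆ (roundBody q).eval ((D, K), B, y) := by
        rw [eval_roundBody]
        split_ifs
        · exact List.Subset.refl _
        · exact List.subset_cons_self _ _
        · exact List.Subset.refl _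
      by_cases hvp : v ∈ p
      · obtain ⟨B₀, h1, h2, h3, h4⟩ := hrej v hvp hvK fun h => hvB (hsub h)
        exact ⟨B₀, h1, List.Subset.trans h2 hsub, h3, h4⟩
      obtain rfl : v = y := by simpa [hvp] using hv
      have hvB' : v ∉ B := fun h => hvB (hsub h)
      refine ⟨B, hB.1, hsub, fun u hu => ?_, hvB', fun hP => ?_⟩
      · rw [hs, List.pairwise_append] at hpw
        exact hpw.2.2 u (hB.2 u hu).1 v (by simp)
      · rw [eval_roundBody, if_neg hvK, if_pos ((hq.eval v B hB.1 hvB' (hlt v (by simp [hs]))).2 hP)]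
          at hvB
        exact hvB (List.mem_cons_self ..))
  exact ⟨key.1.1, key.1.2, key.2⟩

lemma IsOracle.cost_roundP (hq : IsOracle q D n P Q) {srt : List ℕ} (hlt : ∀ x ∈ srt, x < n)
    (hnd : srt.Nodup) {K : List ℕ} (hK : K.length ≤ n) :
    (roundP q).cost (D, srt, K) ≤ 100 * ((n + 1) ^ 2 * (Q + 1)) := by
  have hf := cost_fold_le_of_invariant (p := roundBody q) (x := (D, K)) (s := ([] : List ℕ))
    (l := srt) (fun p B => P B ∧ ∀ x ∈ B, x ∈ p ∧ x ∉ K) (40 * (n + 1) + Q + 40)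
    ⟨hq.nil, by simp⟩ (fun p v r B hs hB => hq.round_step hlt hnd K hs hB) (by
      intro p v r B hs hB
      have h1 := cost_memP v K
      have h2 : q.cost (D, v :: B) ≤ Q := hq.cost v B hB.1 (by
        intro h
        rw [hs, List.nodup_append] at hnd
        exact hnd.2.2 _ (hB.2 v h).1 v (by simp) rfl) (hlt v (by simp [hs]))
      refine (cost_ite_le _ _ _ _).trans ?_
      have h3 := cost_ite_le (.comp q (.pair (.comp .fst .fst) (.comp .cons (.pair (.comp .snd .snd)
        (.comp .fst .snd))))) (.comp .cons (.pair (.comp .snd .snd) (.comp .fst .snd)))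
        (.comp .fst .snd : Prog (.prod (.prod m LN) (.prod LN .nat)) LN) ((D, K), B, v)
      simp only [cost_comp, cost_pair, cost_fst, cost_snd, cost_cons, eval_pair, eval_comp,
        eval_fst, eval_snd, eval_cons] at h3 ⊢
      omega)
  have hlen := length_le_of_nodup hnd hlt
  have h2 : srt.length * (40 * (n + 1) + Q + 40 + 1) ≤ n * (40 * (n + 1) + Q + 40 + 1) :=
    Nat.mul_le_mul_right _ hlen
  simp only [roundP, cost_comp, cost_pair, cost_fst, cost_snd, cost_nil, eval_pair, eval_comp,
    eval_fst, eval_snd, eval_nil]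
  have h3 : (fold (roundBody q)).cost ((D, K), [], srt) + 12 ≤ 100 * ((n + 1) ^ 2 * (Q + 1)) := by
    nlinarith [Nat.zero_le (n * Q), Nat.zero_le (n * n * Q)]
  omega

variable (q) in
/-- The body of `kernelP`. -/
def kernelBody : Prog (.prod (.prod m (.prod .real LN)) (.prod .real LN)) (.prod .real LN) :=
  .ite (.comp .realLe (.pair .realOne (.comp .fst .snd))) .snd
    (.pair (.comp .realAdd (.pair (.comp .fst .snd) (.comp .fst (.comp .snd .fst))))
      (.comp revAppP (.pair (.comp (roundP q) (.pair (.comp .fst .fst)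
        (.pair (.comp .snd (.comp .snd .fst)) (.comp .snd .snd)))) (.comp .snd .snd))))

variable (q) in
/-- The union of `min n ⌈1 / ε⌉` successive greedy bases. -/
def kernelP : Prog (.prod m (.prod .real (.prod LN .nat))) LN :=
  .comp .snd (.comp (.loop (kernelBody q))
    (.pair (.pair .fst (.pair (.comp .fst .snd) (.comp .fst (.comp .snd .snd))))
      (.pair (.pair .realZero .nil) (.comp .snd (.comp .snd .snd)))))

lemma eval_kernelBody (D : m.Val) (ε acc : ℝ) (srt K : List ℕ) :
    (kernelBody q).eval ((D, ε, srt), acc, K) = if 1 ≤ acc then (acc, K) else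
      (acc + ε, List.reverse ((roundP q).eval (D, srt, K)) ++ K) := by
  simp only [kernelBody, eval_ite, eval_comp, eval_pair, eval_fst, eval_snd, eval_realLe,
    eval_realOne, eval_realAdd, eval_revAppP, decide_eq_true_eq]

/-- The language has no division or rounding, so `⌈1/ε⌉` is not computed: `ε` is added up until the
sum reaches `1`, in at most `n` passes. Here `j` counts the effective rounds; after the threshold is
reached the remaining passes leave the state unchanged. -/
lemma kernelP_spec (D : m.Val) (ε : ℝ) (srt : List ℕ) (n : ℕ) (R : ℕ → List ℕ → Prop)
    (h0 : R 0 []) (hstep : ∀ (j : ℕ) (K : List ℕ), j * ε < 1 → R j K →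
      R (j + 1) (List.reverse ((roundP q).eval (D, srt, K)) ++ K)) :
    ∃ j ≤ n, R j ((kernelP q).eval (D, ε, srt, n)) ∧ (j = n ∨ 1 ≤ j * ε) := by
  simp only [kernelP, eval_comp, eval_pair, eval_fst, eval_snd, eval_realZero, eval_nil]
  rw [eval_loop]
  have := iterate_invariant (step' := fun s => (kernelBody q).eval ((D, ε, srt), s))
    (fun i (s : ℝ × List ℕ) => ∃ j ≤ i, s.1 = j * ε ∧ R j s.2 ∧ (j = i ∨ 1 ≤ j * ε))
    (s := ((0 : ℝ), ([] : List ℕ))) ⟨0, le_rfl, by simp, h0, Or.inl rfl⟩ n (by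
      rintro i - ⟨acc, K⟩ ⟨j, hji, hacc, hR, hj⟩
      simp only at hacc hR
      subst hacc
      rw [eval_kernelBody]
      split_ifs with h
      · exact ⟨j, by omega, rfl, hR, Or.inr h⟩
      · obtain rfl := hj.resolve_right h
        exact ⟨j + 1, le_rfl, by push_cast; ring, hstep j K (not_le.1 h) hR, Or.inl rfl⟩)
  obtain ⟨j, h1, -, h2, h3⟩ := this
  exact ⟨j, h1, h2, h3⟩

lemma IsOracle.round_append (hq : IsOracle q D n P Q) {srt : List ℕ} (hlt : ∀ x ∈ srt, x < n)
    (hnd : srt.Nodup) {K : List ℕ} (hK : K.Nodup ∧ ∀ x ∈ K, x < n) :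
    (List.reverse ((roundP q).eval (D, srt, K)) ++ K).Nodup ∧
      ∀ x ∈ List.reverse ((roundP q).eval (D, srt, K)) ++ K, x < n := by
  obtain ⟨h1, h2, -⟩ := hq.round_spec hlt hnd (f := fun _ => 0)
    (List.pairwise_of_forall fun _ _ => le_rfl) K
  constructor
  · rw [List.nodup_append]
    refine ⟨List.nodup_reverse.2 (hq.nodup _ h1), hK.1, ?_⟩
    rintro a ha b hb rfl
    exact (h2 a (List.mem_reverse.1 ha)).2 hb
  · intro x hx
    rcases List.mem_append.1 hx with hx | hx
    · exact hq.lt _ h1 x (List.mem_reverse.1 hx)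
    · exact hK.2 x hx

lemma IsOracle.cost_kernelP (hq : IsOracle q D n P Q) {srt : List ℕ} (hlt : ∀ x ∈ srt, x < n)
    (hnd : srt.Nodup) (ε : ℝ) :
    (kernelP q).cost (D, ε, srt, n) ≤ 300 * ((n + 1) ^ 3 * (Q + 1)) := by
  have hl := cost_loop_le (p := kernelBody q) (x := (D, ε, srt)) (s := ((0 : ℝ), ([] : List ℕ)))
    (fun s : ℝ × List ℕ => s.2.Nodup ∧ ∀ x ∈ s.2, x < n)
    (100 * ((n + 1) ^ 2 * (Q + 1)) + 20 * (n + 1) + 60) n (by simp) (by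
      rintro ⟨acc, K⟩ hK
      rw [eval_kernelBody]
      split_ifs
      · exact hK
      · exact hq.round_append hlt hnd hK) (by
      rintro ⟨acc, K⟩ hK
      obtain ⟨h1, -, -⟩ := hq.round_spec hlt hnd (f := fun _ => 0)
        (List.pairwise_of_forall fun _ _ => le_rfl) K
      have h2 := length_le_of_nodup (hq.nodup _ h1) (hq.lt _ h1)
      have h3 : (roundP q).cost (D, srt, K) ≤ _ := hq.cost_roundP hlt hnd (length_le_of_nodup hK.1 hK.2)
      have h4 := cost_revAppP (a := .nat) ((roundP q).eval (D, srt, K)) K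
      refine (cost_ite_le _ _ _ _).trans ?_
      simp only [cost_comp, cost_pair, cost_fst, cost_snd, cost_realLe, cost_realOne, cost_realAdd,
        eval_pair, eval_comp, eval_fst, eval_snd]
      omega)
  simp only [kernelP, cost_comp, cost_pair, cost_fst, cost_snd, cost_nil, cost_realZero, eval_pair,
    eval_comp, eval_fst, eval_snd, eval_nil, eval_realZero]
  have h3 : (loop (kernelBody q)).cost ((D, ε, srt), ((0 : ℝ), []), n) + 30 ≤
      300 * ((n + 1) ^ 3 * (Q + 1)) := by
    nlinarith [Nat.zero_le (n * Q), Nat.zero_le (n * n * Q), Nat.zero_le (n * n * n * Q),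
      Nat.zero_le (n * n * n)]
  omega

/-! ### Enumerating the independent subsets and selecting the best one. -/

variable (q) in
/-- The inner body of `enumP`. -/
def enumInner : Prog (.prod (.prod m .nat) (.prod (.list LN) LN)) (.list LN) :=
  .ite (.comp q (.pair (.comp .fst .fst) (.comp .cons (.pair (.comp .snd .fst) (.comp .snd .snd)))))
    (.comp .cons (.pair (.comp .cons (.pair (.comp .snd .fst) (.comp .snd .snd)))
      (.comp .fst .snd)))
    (.comp .fst .snd)

variable (q) in
/-- The body of `enumP`. -/
def enumBody : Prog (.prod m (.prod (.list LN) .nat)) (.list LN) :=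
  .comp (.fold (enumInner q)) (.pair (.pair .fst (.comp .snd .snd))
    (.pair (.comp .fst .snd) (.comp .fst .snd)))

variable (q) in
/-- The list of all independent subsets of a list. -/
def enumP : Prog (.prod m LN) (.list LN) :=
  .comp (.fold (enumBody q)) (.pair .fst (.pair (.comp .cons (.pair .nil .nil)) .snd))

lemma eval_enumBody (D : m.Val) (L : List (List ℕ)) (u : ℕ) :
    (enumBody q).eval (D, L, u) =
      ((L.filter fun s => q.eval (D, u :: s)).map (u :: ·)).reverse ++ L := by
  simp only [enumBody, eval_comp, eval_pair, eval_fst, eval_snd]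
  rw [eval_fold]
  refine foldl_invariant (fun p L' => L' =
    ((p.filter fun s => q.eval (D, u :: s)).map (u :: ·)).reverse ++ L) (by simp) ?_
  rintro p y r L' - rfl
  have hI : ∀ L' : List (List ℕ), (enumInner q).eval ((D, u), L', y) =
    if q.eval (D, u :: y) = true then (u :: y) :: L' else L' := fun _ => rfl
  rw [hI, List.filter_append, List.filter_singleton]
  by_cases h : q.eval (D, u :: y) = true
  · simp [h]
  · simp [h]

/-- The state of the enumeration after the entries `p`: all subsets of `p` with property `P`,
and the number of these subsets, weighted by `x` to the power of the size, is bounded. -/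
def EnumInv (P : List ℕ → Prop) (x : ℝ) (p : List ℕ) (L : List (List ℕ)) : Prop :=
  (∀ s ∈ L, P s ∧ s ⊆ p) ∧ (∀ s, s.Sublist p.reverse → P s → s ∈ L) ∧
    (L.map fun s => x ^ s.length).sum ≤ (1 + x) ^ p.length

/-- Every new set is `u` prepended to an old one, with `x` times its weight, so the total weight
grows by a factor of at most `1 + x`. Heredity makes sure that no set with property `P` is missed.
-/
lemma IsOracle.enum_step (hq : IsOracle q D n P Q) {x : ℝ} (hx : 0 ≤ x) {K : List ℕ}
    (hK : K.Nodup ∧ ∀ x ∈ K, x < n) {p r : List ℕ} {u : ℕ} {L : List (List ℕ)}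
    (hs : K = p ++ u :: r) (hL : EnumInv P x p L) :
    EnumInv P x (p ++ [u]) ((enumBody q).eval (D, L, u)) := by
  obtain ⟨h1, h2, h3⟩ := hL
  have hun : u < n := hK.2 u (by simp [hs])
  have hup : u ∉ p := by
    intro h
    have := hK.1
    rw [hs, List.nodup_append] at this
    exact this.2.2 u h u (by simp) rfl
  have hev : ∀ s ∈ L, (q.eval (D, u :: s) = true ↔ P (u :: s)) := fun s hs =>
    hq.eval u s (h1 s hs).1 (fun h => hup ((h1 s hs).2 h)) hun
  rw [eval_enumBody]
  refine ⟨fun s hs => ?_, fun s hs hP => ?_, ?_⟩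
  · rw [List.mem_append, List.mem_reverse, List.mem_map] at hs
    rcases hs with ⟨s', hs', rfl⟩ | hs
    · obtain ⟨hs', hq'⟩ := List.mem_filter.1 hs'
      refine ⟨(hev s' hs').1 hq', List.cons_subset.2 ⟨by simp, ?_⟩⟩
      exact List.Subset.trans (h1 s' hs').2 (List.subset_append_left _ _)
    · exact ⟨(h1 s hs).1, List.Subset.trans (h1 s hs).2 (List.subset_append_left _ _)⟩
  · rw [List.reverse_append, List.reverse_singleton, List.singleton_append,
      List.sublist_cons_iff] at hs
    rw [List.mem_append, List.mem_reverse, List.mem_map]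
    rcases hs with hs | ⟨s', rfl, hs'⟩
    · exact Or.inr (h2 s hs hP)
    · have hs'L := h2 s' hs' (hq.tail _ _ hP)
      exact Or.inl ⟨s', List.mem_filter.2 ⟨hs'L, (hev s' hs'L).2 hP⟩, rfl⟩
  · rw [List.map_append, List.sum_append, List.map_reverse, List.sum_reverse, List.map_map,
      List.length_append, List.length_singleton, pow_succ, mul_add, mul_one, add_comm]
    have h4 : ((L.filter fun s => q.eval (D, u :: s)).map
        ((fun s => x ^ s.length) ∘ (u :: ·))).sum ≤ (L.map fun s => x ^ s.length).sum * x := by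
      clear h1 h2 h3 hev
      induction L with
      | nil => simp
      | cons s L ih =>
        have h5 : 0 ≤ x ^ s.length * x := by positivity
        by_cases h : q.eval (D, u :: s) = true
        · rw [List.filter_cons_of_pos (p := fun s => q.eval (D, u :: s)) h]
          simp only [List.map_cons, List.sum_cons, Function.comp_apply, List.length_cons, pow_succ,
            add_mul]
          exact add_le_add le_rfl ih
        · rw [List.filter_cons_of_neg (p := fun s => q.eval (D, u :: s)) h]
          simp only [List.map_cons, List.sum_cons, add_mul]
          linarith
    exact add_le_add h3 (h4.trans (mul_le_mul_of_nonneg_right h3 hx))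

lemma IsOracle.enumInv_zero (hq : IsOracle q D n P Q) (x : ℝ) : EnumInv P x [] [[]] := by
  refine ⟨?_, ?_, by simp⟩
  · simp [hq.nil]
  · intro s hs _
    simpa using hs

lemma IsOracle.enumInv (hq : IsOracle q D n P Q) {x : ℝ} (hx : 0 ≤ x) {K : List ℕ}
    (hK : K.Nodup ∧ ∀ x ∈ K, x < n) : EnumInv P x K ((enumP q).eval (D, K)) := by
  simp only [enumP, eval_comp, eval_pair, eval_fst, eval_snd, eval_nil, eval_cons]
  rw [eval_fold]
  exact foldl_invariant (EnumInv P x) (hq.enumInv_zero x) fun p u r L hs hL =>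
    hq.enum_step hx hK hs hL

/-- The number of enumerated sets. -/
lemma EnumInv.length_le {k t : ℕ} (ht : 0 < t) (hk : ∀ l, P l → l.length ≤ k) {p : List ℕ}
    {L : List (List ℕ)} (hL : EnumInv P (t : ℝ)⁻¹ p L) (hp : p.length ≤ k * t) :
    L.length ≤ (3 * t) ^ k := by
  have ht' : (0 : ℝ) < t := by exact_mod_cast ht
  have ht1 : (1 : ℝ) ≤ t := by exact_mod_cast ht
  -- A set of at most `k` elements has weight at least `t^(-k)`. The total weight is at most `(1 +
  -- 1/t)^(kt) ≤ e^k ≤ 3^k`, which replaces an estimate of binomial coefficients.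
  have h1 : (L.length : ℝ) * ((t : ℝ)⁻¹) ^ k ≤ (L.map fun s => (t : ℝ)⁻¹ ^ s.length).sum := by
    have := hL.1
    clear hL
    induction L with
    | nil => simp
    | cons s L ih =>
      rw [List.length_cons, Nat.cast_succ, add_mul, one_mul, add_comm, List.map_cons,
        List.sum_cons]
      refine add_le_add ?_ (ih fun s hs => this s (List.mem_cons_of_mem _ hs))
      exact pow_le_pow_of_le_one (inv_nonneg.2 ht'.le) (inv_le_one_of_one_le₀ ht1)
        (hk s (this s (List.mem_cons_self ..)).1)
  have h2 : (1 + (t : ℝ)⁻¹) ^ p.length ≤ 3 ^ k := by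
    calc (1 + (t : ℝ)⁻¹) ^ p.length ≤ (1 + (t : ℝ)⁻¹) ^ (k * t) :=
          pow_le_pow_right₀ (by linarith [inv_nonneg.2 ht'.le]) hp
      _ = ((1 + (t : ℝ)⁻¹) ^ t) ^ k := by rw [mul_comm, pow_mul]
      _ ≤ 3 ^ k := by
          refine pow_le_pow_left₀ (by positivity) ?_ k
          calc (1 + (t : ℝ)⁻¹) ^ t ≤ (Real.exp ((t : ℝ)⁻¹)) ^ t := by
                refine pow_le_pow_left₀ (by positivity) ?_ t
                rw [add_comm]
                exact Real.add_one_le_exp _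
            _ = Real.exp 1 := by
                rw [← Real.exp_nat_mul, mul_inv_cancel₀ ht'.ne']
            _ ≤ 3 := Real.exp_one_lt_d9.le.trans (by norm_num)
  have h3 := h1.trans (hL.2.2.trans h2)
  rw [inv_pow, ← div_eq_mul_inv, div_le_iff₀ (by positivity), ← mul_pow] at h3
  exact_mod_cast h3

/-- The list of sets only grows, so a bound for its final length bounds the number of tests in every
round. -/
lemma IsOracle.cost_enumP (hq : IsOracle q D n P Q) {K : List ℕ}
    (hK : K.Nodup ∧ ∀ x ∈ K, x < n) {N : ℕ} (hN : ((enumP q).eval (D, K)).length ≤ N) :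
    (enumP q).cost (D, K) ≤ 100 * ((n + 1) * (N + 1) * (Q + 1)) := by
  have hmono : ∀ (r : List ℕ) (L : List (List ℕ)), L.length ≤
      (r.foldl (fun s y => (enumBody q).eval (D, s, y)) L : List (List ℕ)).length := by
    intro r
    induction r with
    | nil => intro L; exact le_rfl
    | cons u r ih =>
      intro L
      refine le_trans ?_ (ih _)
      simp only
      rw [eval_enumBody]
      simp
  simp only [enumP, eval_comp, eval_pair, eval_fst, eval_snd, eval_nil, eval_cons] at hN
  rw [eval_fold] at hN
  have hf := cost_fold_le_of_invariant (p := enumBody q) (x := D) (s := [([] : List ℕ)])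
    (l := K) (fun p L => EnumInv P 1 p L ∧
      L = p.foldl (fun s y => (enumBody q).eval (D, s, y)) [([] : List ℕ)])
    (N * (Q + 50) + 40) ⟨hq.enumInv_zero 1, rfl⟩ (by
      rintro p u r L hs ⟨hL, hL'⟩
      refine ⟨hq.enum_step zero_le_one hK hs hL, ?_⟩
      rw [List.foldl_append, ← hL']
      rfl) (by
      rintro p u r L hs ⟨hL, hL'⟩
      have hlen : L.length ≤ N := by
        refine le_trans ?_ hN
        rw [hs, List.foldl_append, ← hL']
        exact hmono _ L
      have hf := cost_fold_le (p := enumInner q) (x := (D, u)) (s := L) (l := L) (Q + 40) (by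
        intro L' s hs'
        have hc : q.cost (D, u :: s) ≤ Q := hq.cost u s (hL.1 s hs').1 (by
          intro h
          have := hK.1
          rw [hs, List.nodup_append] at this
          exact this.2.2 u ((hL.1 s hs').2 h) u (by simp) rfl) (hK.2 u (by simp [hs]))
        refine (cost_ite_le _ _ _ _).trans ?_
        simp only [cost_comp, cost_pair, cost_fst, cost_snd, cost_cons, eval_pair, eval_comp,
          eval_fst, eval_snd, eval_cons]
        omega)
      have h1 : L.length * (Q + 40 + 1) ≤ N * (Q + 50) := Nat.mul_le_mul hlen (by omega)
      simp only [enumBody, cost_comp, cost_pair, cost_fst, cost_snd, eval_pair, eval_comp,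
        eval_fst, eval_snd]
      omega)
  have hlen := length_le_of_nodup hK.1 hK.2
  simp only [enumP, cost_comp, cost_pair, cost_fst, cost_snd, cost_nil, cost_cons, eval_pair,
    eval_comp, eval_fst, eval_snd, eval_nil, eval_cons]
  have h2 : K.length * (N * (Q + 50) + 40 + 1) ≤ n * (N * (Q + 50) + 40 + 1) :=
    Nat.mul_le_mul_right _ hlen
  have h3 : (fold (enumBody q)).cost (D, [[]], K) + 12 ≤
      100 * ((n + 1) * (N + 1) * (Q + 1)) := by
    nlinarith [Nat.zero_le (n * N), Nat.zero_le (n * N * Q), Nat.zero_le (n * Q),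
      Nat.zero_le (N * Q)]
  omega

/-- The body of `bestP`. -/
def bestBody : Prog (.prod ET (.prod LN LN)) LN :=
  .ite (.comp .realLe (.pair (.comp covP (.pair .fst (.comp .fst .snd)))
    (.comp covP (.pair .fst (.comp .snd .snd))))) (.comp .snd .snd) (.comp .fst .snd)

/-- A set with the largest covered weight in a list of sets. -/
def bestP : Prog (.prod ET (.list LN)) LN :=
  .comp (.fold bestBody) (.pair .fst (.pair .nil .snd))

lemma eval_bestBody (x : Ty.Val (.prod ET (.prod LN LN))) : bestBody.eval x =
    if covL x.1 x.2.1 ≤ covL x.1 x.2.2 then x.2.2 else x.2.1 := by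
  simp only [bestBody, eval_ite, eval_comp, eval_pair, eval_fst, eval_snd, eval_realLe, eval_covP,
    decide_eq_true_eq]

lemma bestP_spec (Es : List (List ℕ × ℝ)) (L : List (List ℕ)) :
    (bestP.eval (Es, L) = ([] : List ℕ) ∨ bestP.eval (Es, L) ∈ L) ∧
      ∀ s ∈ L, covL Es s ≤ covL Es (bestP.eval (Es, L)) := by
  simp only [bestP, eval_comp, eval_pair, eval_fst, eval_snd, eval_nil]
  rw [eval_fold]
  refine foldl_invariant (fun p (b : List ℕ) => (b = [] ∨ b ∈ p) ∧ ∀ s ∈ p, covL Es s ≤ covL Es b)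
    (by simp) ?_
  rintro p y r b - ⟨h1, h2⟩
  rw [eval_bestBody]
  simp only
  split_ifs with h
  · refine ⟨Or.inr (by simp), fun s hs => ?_⟩
    rcases List.mem_append.1 hs with hs | hs
    · exact (h2 s hs).trans h
    · rw [List.mem_singleton.1 hs]
  · refine ⟨h1.imp_right fun h => by simp [h], fun s hs => ?_⟩
    rcases List.mem_append.1 hs with hs | hs
    · exact h2 s hs
    · rw [List.mem_singleton.1 hs]
      exact (not_le.1 h).le

lemma cost_bestP {Es : List (List ℕ × ℝ)} {h : ℕ} (hEs : ∀ p ∈ Es, p.1.length ≤ h)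
    {L : List (List ℕ)} (hL : ∀ s ∈ L, s.length ≤ n) :
    bestP.cost (Es, L) ≤ 600 * ((Es.length + 1) * (h + 1) * (n + 1) * (L.length + 1)) := by
  have hf := cost_fold_le_of_invariant (p := bestBody) (x := Es) (s := ([] : List ℕ)) (l := L)
    (fun _ b => List.length b ≤ n) (400 * ((Es.length + 1) * (h + 1) * (n + 1)) + 40) (by simp) (by
      rintro p y r b hs hb
      rw [eval_bestBody]
      simp only
      split_ifs
      · exact hL y (by simp [hs])
      · exact hb) (by
      rintro p y r b hs hb
      have h1 := cost_covP hEs b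
      have h2 := cost_covP hEs y
      have h3 : (Es.length + 1) * (h + 1) * (List.length b + 1) ≤
        (Es.length + 1) * (h + 1) * (n + 1) := Nat.mul_le_mul_left _ (by omega)
      have h4 : (Es.length + 1) * (h + 1) * (List.length y + 1) ≤
        (Es.length + 1) * (h + 1) * (n + 1) := Nat.mul_le_mul_left _ (by
          have := hL y (by simp [hs])
          omega)
      refine (cost_ite_le _ _ _ _).trans ?_
      simp only [cost_comp, cost_pair, cost_fst, cost_snd, cost_realLe, eval_pair, eval_comp,
        eval_fst, eval_snd]
      omega)
  have hW : 1 ≤ (Es.length + 1) * (h + 1) * (n + 1) :=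
    Nat.mul_pos (Nat.mul_pos (by omega) (by omega)) (by omega)
  simp only [bestP, cost_comp, cost_pair, cost_fst, cost_snd, cost_nil, eval_pair, eval_fst,
    eval_snd, eval_nil]
  have h3 : (fold bestBody).cost (Es, [], L) + 10 ≤
      600 * ((Es.length + 1) * (h + 1) * (n + 1) * (L.length + 1)) := by
    nlinarith
  omega

/-! ### The complete algorithm and its cost. -/

variable (q) in
/-- Compute the kernel of the input. -/
def mainKernelP : Prog (InputTy m) LN :=
  .comp (kernelP q) (.pair (.comp .snd (.comp .snd .snd)) (.pair (.comp .fst .snd)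
    (.pair (.comp sortP (.pair (.comp .fst (.comp .snd .snd)) (.comp rangeP .fst))) .fst)))

variable (q) in
/-- The algorithm: find the best independent subset of the kernel. -/
def mainP : Prog (InputTy m) LN :=
  .comp bestP (.pair (.comp .fst (.comp .snd .snd))
    (.comp (enumP q) (.pair (.comp .snd (.comp .snd .snd)) (mainKernelP q))))

lemma eval_mainKernelP (n : ℕ) (ε : ℝ) (Es : List (List ℕ × ℝ)) (D : m.Val) :
    (mainKernelP q).eval (n, ε, Es, D) =
      (kernelP q).eval (D, ε, sortP.eval (Es, (List.range n).reverse), n) := by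
  simp only [mainKernelP, eval_comp, eval_pair, eval_fst, eval_snd, eval_rangeP]

lemma eval_mainP (n : ℕ) (ε : ℝ) (Es : List (List ℕ × ℝ)) (D : m.Val) :
    (mainP q).eval (n, ε, Es, D) =
      bestP.eval (Es, (enumP q).eval (D, (mainKernelP q).eval (n, ε, Es, D))) := by
  simp only [mainP, eval_comp, eval_pair, eval_fst, eval_snd]

lemma sorted_spec (Es : List (List ℕ × ℝ)) (n : ℕ) :
    List.Nodup (sortP.eval (Es, (List.range n).reverse)) ∧
    (∀ x, x ∈ (sortP.eval (Es, (List.range n).reverse) : List ℕ) ↔ x < n) ∧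
    List.Pairwise (fun u v => covL Es [v] ≤ covL Es [u])
      (sortP.eval (Es, (List.range n).reverse)) := by
  obtain ⟨h1, h2⟩ := eval_sortP (Es, (List.range n).reverse)
  refine ⟨h1.nodup_iff.2 (List.nodup_reverse.2 List.nodup_range), fun x => ?_, h2⟩
  rw [h1.mem_iff]
  simp

lemma IsOracle.cost_mainP (hq : IsOracle q D n P Q) (ε : ℝ) {Es : List (List ℕ × ℝ)} {h : ℕ}
    (hEs : ∀ p ∈ Es, p.1.length ≤ h) {N : ℕ}
    (hK : ((mainKernelP q).eval (n, ε, Es, D)).Nodup ∧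
      ∀ x ∈ ((mainKernelP q).eval (n, ε, Es, D) : List ℕ), x < n)
    (hN : ((enumP q).eval (D, (mainKernelP q).eval (n, ε, Es, D))).length ≤ N) :
    (mainP q).cost (n, ε, Es, D) ≤
      3000 * ((Es.length + 1) * (h + 1) * (n + 1) ^ 3 * (N + 1) * (Q + 1)) := by
  obtain ⟨s1, s2, -⟩ := sorted_spec Es n
  have c1 := cost_rangeP n
  have c2 := cost_sortP hEs (List.range n).reverse
  have c3 := hq.cost_kernelP (fun x hx => (s2 x).1 hx) s1 ε
  have c4 := hq.cost_enumP hK hN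
  have c5 := cost_bestP (n := n) hEs (L := (enumP q).eval (D, (mainKernelP q).eval (n, ε, Es, D)))
    fun s hs => by
      have := ((hq.enumInv zero_le_one hK).1 s hs).1
      exact length_le_of_nodup (hq.nodup _ this) (hq.lt _ this)
  simp only [List.length_reverse, List.length_range] at c2
  -- The summand `100` pays for passing data between the five stages.
  have key : (mainP q).cost (n, ε, Es, D) ≤ rangeP.cost n +
      sortP.cost (Es, (List.range n).reverse) +
      (kernelP q).cost (D, ε, sortP.eval (Es, (List.range n).reverse), n) +
      (enumP q).cost (D, (mainKernelP q).eval (n, ε, Es, D)) +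
      bestP.cost (Es, (enumP q).eval (D, (mainKernelP q).eval (n, ε, Es, D))) + 100 := by
    rw [eval_mainKernelP]
    simp only [mainP, mainKernelP, cost_comp, cost_pair, cost_fst, cost_snd, eval_pair, eval_comp,
      eval_fst, eval_snd, eval_rangeP]
    omega
  refine key.trans ?_
  set E := Es.length + 1
  set X := n + 1
  set H := h + 1
  set N' := N + 1
  set Q' := Q + 1
  have hE : 1 ≤ E := by omega
  have hX : 1 ≤ X := by omega
  have hH : 1 ≤ H := by omega
  have hN' : 1 ≤ N' := by omega
  have hQ' : 1 ≤ Q' := by omega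
  have hX2 : X ^ 2 ≤ X ^ 3 := Nat.pow_le_pow_right hX (by norm_num)
  have hX1 : X ≤ X ^ 3 := Nat.le_self_pow (by norm_num) X
  have e1 : X ≤ E * H * X ^ 3 * N' * Q' :=
    calc X = 1 * 1 * X * 1 * 1 := by ring
      _ ≤ _ := by gcongr
  have e2 : E * H * X ^ 2 ≤ E * H * X ^ 3 * N' * Q' :=
    calc E * H * X ^ 2 = E * H * X ^ 2 * 1 * 1 := by ring
      _ ≤ _ := by gcongr
  have e3 : X ^ 3 * Q' ≤ E * H * X ^ 3 * N' * Q' :=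
    calc X ^ 3 * Q' = 1 * 1 * X ^ 3 * 1 * Q' := by ring
      _ ≤ _ := by gcongr
  have e4 : X * N' * Q' ≤ E * H * X ^ 3 * N' * Q' :=
    calc X * N' * Q' = 1 * 1 * X * N' * Q' := by ring
      _ ≤ _ := by gcongr
  have e5 : E * H * X * (((enumP q).eval (D, (mainKernelP q).eval (n, ε, Es, D))).length + 1) ≤
      E * H * X ^ 3 * N' * Q' :=
    calc _ ≤ E * H * X ^ 3 * N' * 1 := by
          rw [mul_one]
          gcongr
          omega
      _ ≤ _ := by gcongr
  have e6 : 1 ≤ E * H * X ^ 3 * N' * Q' := hX.trans e1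
  omega

end Prog

/-! ### Correctness of the algorithm -/

/-- The set of vertices listed in `l`. -/
def toF (n : ℕ) (l : List ℕ) : Finset (Fin n) := {v | (v : ℕ) ∈ l}

/-! ### Lists representing sets and weighted edges. -/

section Encoding

variable {n : ℕ} {l : List ℕ}

lemma mem_toF {v : Fin n} : v ∈ toF n l ↔ (v : ℕ) ∈ l := by simp [toF]

lemma EncodesSet.eq_toF {S : Finset (Fin n)} (h : EncodesSet l S) : S = toF n l := by
  obtain ⟨l', -, rfl, rfl⟩ := h
  ext v
  simp [mem_toF, Fin.val_inj]

lemma EncodesSet.nodup {S : Finset (Fin n)} (h : EncodesSet l S) : l.Nodup := by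
  obtain ⟨l', h, -, rfl⟩ := h
  exact h.map Fin.val_injective

lemma EncodesSet.lt {S : Finset (Fin n)} (h : EncodesSet l S) : ∀ x ∈ l, x < n := by
  obtain ⟨l', -, -, rfl⟩ := h
  intro x hx
  obtain ⟨v, -, rfl⟩ := List.mem_map.1 hx
  exact v.2

lemma EncodesSet.card_eq {S : Finset (Fin n)} (h : EncodesSet l S) : S.card = l.length := by
  obtain ⟨l', h, rfl, rfl⟩ := h
  rw [List.toFinset_card_of_nodup h, List.length_map]

lemma encodesSet_toF (h : l.Nodup) (hlt : ∀ x ∈ l, x < n) : EncodesSet l (toF n l) := by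
  refine ⟨l.pmap (fun x hx => ⟨x, hx⟩) hlt, ?_, ?_, ?_⟩
  · exact h.pmap fun a _ b _ hab => congrArg Fin.val hab
  · ext v
    simp only [List.mem_toFinset, List.mem_pmap, mem_toF]
    exact ⟨fun ⟨a, ha, hv⟩ => by rw [← hv]; exact ha, fun hv => ⟨v, hv, rfl⟩⟩
  · rw [List.map_pmap]
    simp

lemma toF_cons {v : ℕ} (hv : v < n) : toF n (v :: l) = insert ⟨v, hv⟩ (toF n l) := by
  ext u
  simp [mem_toF, Fin.ext_iff]

lemma toF_singleton (v : Fin n) : toF n [(v : ℕ)] = {v} := by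
  ext u
  simp [mem_toF, Fin.ext_iff]

open Classical in
/-- The entries of `l` that belong to `S`. -/
lemma exists_sublist_toF_eq {S : Finset (Fin n)} (hS : S ⊆ toF n l) :
    ∃ s : List ℕ, s.Sublist l ∧ toF n s = S := by
  refine ⟨l.filter fun x => ∃ h : x < n, (⟨x, h⟩ : Fin n) ∈ S, List.filter_sublist, ?_⟩
  ext v
  rw [mem_toF, List.mem_filter]
  simp only [Fin.is_lt, Fin.eta, exists_true_left, decide_eq_true_eq, and_iff_right_iff_imp]
  exact fun hv => mem_toF.1 (hS hv)

variable {G : WHypergraph (Fin n)} {Es : List (List ℕ × ℝ)}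

lemma EncodesEdges.covL_eq (h : EncodesEdges Es G) (l : List ℕ) :
    Prog.covL Es l = G.cover (toF n l) := by
  obtain ⟨es, hnd, hes, hf⟩ := h
  rw [WHypergraph.cover, Finset.sum_filter, ← hes, List.sum_toFinset _ hnd, Prog.covL]
  clear hnd hes
  induction hf with
  | nil => rfl
  | @cons p e Es es hpe _ ih =>
    have hiff : (∃ y ∈ p.1, y ∈ l) ↔ (e ∩ toF n l).Nonempty := by
      rw [hpe.1.eq_toF]
      constructor
      · rintro ⟨y, hy, hyl⟩
        exact ⟨⟨y, hpe.1.lt y hy⟩, Finset.mem_inter.2 ⟨mem_toF.2 hy, mem_toF.2 hyl⟩⟩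
      · rintro ⟨v, hv⟩
        rw [Finset.mem_inter, mem_toF, mem_toF] at hv
        exact ⟨v, hv⟩
    simp only [List.map_cons, List.sum_cons, ih, hpe.2, hiff]

lemma EncodesEdges.length_le_of_mem (h : EncodesEdges Es G) : ∀ p ∈ Es, p.1.length ≤ n := by
  obtain ⟨es, -, -, hf⟩ := h
  intro p hp
  induction hf with
  | nil => simp at hp
  | cons hpe _ ih =>
    rcases List.mem_cons.1 hp with rfl | hp
    · exact Prog.length_le_of_nodup hpe.1.nodup hpe.1.lt
    · exact ih hp

-- A set of at most `η` vertices is the set of proper entries of an `η`-tuple over `Option (Fin n)`.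
-- For fixed `η` this makes the edge list polynomially long.
open Classical in
lemma card_filter_card_le (n η : ℕ) :
    ((Finset.univ : Finset (Finset (Fin n))).filter fun e => e.card ≤ η).card ≤ (n + 1) ^ η := by
  have : ((Finset.univ : Finset (Finset (Fin n))).filter fun e => e.card ≤ η) ⊆
      (Finset.univ : Finset (Fin η → Option (Fin n))).image
        fun f => Finset.univ.filter fun v => ∃ i, f i = some v := by
    intro e he
    have he : e.card ≤ η := (Finset.mem_filter.1 he).2
    rw [Finset.mem_image]
    refine ⟨fun i => e.toList[(i : ℕ)]?, Finset.mem_univ _, ?_⟩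
    ext v
    simp only [Finset.mem_filter, Finset.mem_univ, true_and]
    rw [← Finset.mem_toList, List.mem_iff_getElem?]
    constructor
    · rintro ⟨i, hi⟩
      exact ⟨i, hi⟩
    · rintro ⟨i, hi⟩
      obtain ⟨hlt, -⟩ := List.getElem?_eq_some_iff.1 hi
      exact ⟨⟨i, by rw [Finset.length_toList] at hlt; omega⟩, hi⟩
  refine (Finset.card_le_card this).trans (Finset.card_image_le.trans ?_)
  simp

lemma EncodesEdges.length_le (h : EncodesEdges Es G) {η : ℕ} (hG : G.EdgeSizeLE η) :
    Es.length ≤ (n + 1) ^ η := by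
  obtain ⟨es, hnd, hes, hf⟩ := h
  rw [hf.length_eq, ← List.toFinset_card_of_nodup hnd, hes]
  refine le_trans (Finset.card_le_card fun e he => ?_) (card_filter_card_le n η)
  simpa using hG e he

end Encoding

/-! ### Successive greedy bases as spanning layers. -/

namespace Prog

/-- The list `l` enumerates an independent set without repetition. -/
def IndepList {n : ℕ} (M : Matroid (Fin n)) (l : List ℕ) : Prop :=
  l.Nodup ∧ (∀ x ∈ l, x < n) ∧ M.Indep (toF n l : Set (Fin n))

lemma IndepList.length_le {n k : ℕ} {M : Matroid (Fin n)} (hk : M.eRank = k) {l : List ℕ}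
    (h : IndepList M l) : l.length ≤ k := by
  have h1 := h.2.2.encard_le_eRank
  rw [hk, Set.encard_coe_eq_coe_finsetCard, (encodesSet_toF h.1 h.2.1).card_eq] at h1
  exact_mod_cast h1

variable {m : Ty} {q : Prog (.prod m LN) .bool} {D : m.Val} {n Q : ℕ} {M : Matroid (Fin n)}
  {G : WHypergraph (Fin n)} {Es : List (List ℕ × ℝ)} {k : ℕ} {ε : ℝ}

/-- The invariant of the kernel computation after `j` rounds, `t` being the bound of the number of
rounds. -/
def KernelInv (G : WHypergraph (Fin n)) (M : Matroid (Fin n)) (k t j : ℕ) (K : List ℕ) : Prop :=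
  (K.Nodup ∧ ∀ x ∈ K, x < n) ∧ K.length ≤ k * j ∧ j ≤ t ∧
    ∃ B : ℕ → Finset (Fin n), (∀ i i', i ≠ i' → Disjoint (B i) (B i')) ∧
      (∀ i, B i ⊆ toF n K) ∧ (∀ i, j ≤ i → B i = ∅) ∧
      ∀ i < j, ∀ v ∉ toF n K,
        v ∈ M.closure ({u ∈ B i | G.wdeg v ≤ G.wdeg u} : Finset (Fin n))

lemma covL_singleton (hEs : EncodesEdges Es G) (v : Fin n) : covL Es [(v : ℕ)] = G.wdeg v := by
  rw [hEs.covL_eq, toF_singleton, G.cover_singleton]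

/-- The basis found in the round becomes layer `j`. A vertex that is still outside was rejected by
independent elements of the basis of at least its degree, and so lies in their closure. -/
lemma IsOracle.kernelInv_step (hq : IsOracle q D n (IndepList M) Q) (hE : M.E = Set.univ)
    (hk : M.eRank = k) (hEs : EncodesEdges Es G) (hε : 0 < ε) {j : ℕ} {K : List ℕ}
    (hj : j * ε < 1) (hK : KernelInv G M k ⌈1 / ε⌉₊ j K) :
    KernelInv G M k ⌈1 / ε⌉₊ (j + 1) (List.reverse ((roundP q).eval
      (D, sortP.eval (Es, (List.range n).reverse), K)) ++ K) := by
  obtain ⟨s1, s2, s3⟩ := sorted_spec Es n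
  set srt : List ℕ := sortP.eval (Es, (List.range n).reverse) with hsrt
  obtain ⟨hK1, hK2, hK3, B, hB1, hB2, hB3, hB4⟩ := hK
  obtain ⟨r1, r2, r3⟩ := hq.round_spec (fun x hx => (s2 x).1 hx) s1
    (f := fun x => covL Es [x]) s3 K
  have hgood := hq.round_append (fun x hx => (s2 x).1 hx) s1 hK1
  set R : List ℕ := (roundP q).eval (D, srt, K) with hR
  set K' := R.reverse ++ K with hK'
  have hRK' : toF n R ⊆ toF n K' := fun v hv => by
    rw [mem_toF] at hv ⊢
    simp [hK', hv]
  have hKK' : toF n K ⊆ toF n K' := fun v hv => by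
    rw [mem_toF] at hv ⊢
    simp [hK', hv]
  have hdisj : Disjoint (toF n R) (toF n K) := by
    rw [Finset.disjoint_left]
    intro v hv hv'
    exact (r2 v (mem_toF.1 hv)).2 (mem_toF.1 hv')
  refine ⟨hgood, ?_, ?_, Function.update B j (toF n R), ?_, ?_, ?_, ?_⟩
  · have := r1.length_le hk
    rw [hK', List.length_append, List.length_reverse, mul_add, mul_one]
    omega
  · rw [Nat.succ_le_iff, Nat.lt_ceil, lt_div_iff₀ hε]
    exact hj
  · have hlast : ∀ i, i ≠ j → Disjoint (B i) (toF n R) := fun i _ =>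
      (hdisj.mono_right (hB2 i)).symm
    intro i i' hii
    by_cases hi : i = j
    · subst hi
      rw [Function.update_self, Function.update_of_ne hii.symm]
      exact (hlast i' hii.symm).symm
    · rw [Function.update_of_ne hi]
      by_cases hi' : i' = j
      · subst hi'
        rw [Function.update_self]
        exact hlast i hi
      · rw [Function.update_of_ne hi']
        exact hB1 i i' hii
  · intro i
    by_cases hi : i = j
    · subst hi
      rwa [Function.update_self]
    · rw [Function.update_of_ne hi]
      exact (hB2 i).trans hKK'
  · intro i hi
    rw [Function.update_of_ne (by omega)]
    exact hB3 i (by omega)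
  · intro i hi v hv
    by_cases hij : i = j
    · subst hij
      rw [Function.update_self]
      have hvR : (v : ℕ) ∉ R := fun h => hv (hRK' (mem_toF.2 h))
      have hvK : (v : ℕ) ∉ K := fun h => hv (hKK' (mem_toF.2 h))
      obtain ⟨B₀, h1, h2, h3, h4, h5⟩ := r3 v ((s2 v).2 v.2) hvK hvR
      have hcl : v ∈ M.closure (toF n B₀) := by
        by_contra h
        refine h5 ⟨List.nodup_cons.2 ⟨h4, h1.1⟩, ?_, ?_⟩
        · intro x hx
          rcases List.mem_cons.1 hx with rfl | hx
          · exact v.2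
          · exact h1.2.1 x hx
        · rw [toF_cons v.2, Finset.coe_insert]
          exact (h1.2.2.notMem_closure_iff_of_notMem (by simpa [mem_toF] using h4)
            (by simp [hE])).1 h
      refine M.closure_subset_closure ?_ hcl
      rw [Finset.coe_subset]
      intro u hu
      rw [Finset.mem_filter]
      have hu := mem_toF.1 hu
      refine ⟨mem_toF.2 (h2 hu), ?_⟩
      have := h3 u hu
      rwa [covL_singleton hEs, covL_singleton hEs] at this
    · rw [Function.update_of_ne hij]
      exact hB4 i (by omega) v fun h => hv (hKK' h)

/-- If the rounds end because `jε ≥ 1`, there are enough layers. If they end after `n` rounds, the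
missing layers are empty and must still span every outside vertex `v`. Were `v` not in the closure
of the empty set, all `n` layers would be nonempty; being disjoint and avoiding `v`, they would need
`n + 1` vertices. -/
lemma KernelInv.hasSpanningLayers {j : ℕ} {K : List ℕ} (hε : 0 < ε)
    (hK : KernelInv G M k ⌈1 / ε⌉₊ j K) (hj : j = n ∨ 1 ≤ j * ε) :
    HasSpanningLayers G M ⌈1 / ε⌉₊ (toF n K) := by
  obtain ⟨-, -, hK3, B, hB1, hB2, hB3, hB4⟩ := hK
  have hall : ∀ i, i < ⌈1 / ε⌉₊ → ∀ v ∉ toF n K,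
      v ∈ M.closure ({u ∈ B i | G.wdeg v ≤ G.wdeg u} : Finset (Fin n)) := by
    intro i hi v hv
    by_cases hij : i < j
    · exact hB4 i hij v hv
    obtain rfl : j = n := by
      refine hj.resolve_right fun h => ?_
      rw [← div_le_iff₀ hε] at h
      have := Nat.ceil_le.2 h
      omega
    by_contra hcon
    have hne : ∀ i' < j, (B i').Nonempty := by
      intro i' hi'
      rw [Finset.nonempty_iff_ne_empty]
      intro hemp
      have := hB4 i' hi' v hv
      rw [hemp, Finset.filter_empty] at this
      exact hcon (M.closure_subset_closure (by simp) this)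
    have h1 : j ≤ ((Finset.range j).biUnion B).card := by
      rw [Finset.card_biUnion fun i _ i' _ h => hB1 i i' h]
      calc j = ∑ _i ∈ Finset.range j, 1 := by simp
        _ ≤ _ := Finset.sum_le_sum fun i hi => (hne i (Finset.mem_range.1 hi)).card_pos
    have h2 : (insert v ((Finset.range j).biUnion B)).card ≤ j := by
      simpa using Finset.card_le_univ (insert v ((Finset.range j).biUnion B))
    rw [Finset.card_insert_of_notMem] at h2
    · omega
    · rw [Finset.mem_biUnion]
      rintro ⟨i, -, hi⟩
      exact hv (hB2 i hi)
  intro d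
  refine ⟨fun i => {u ∈ B i | d ≤ G.wdeg u}, fun i i' hii => ?_, fun i u hu => ?_,
    fun v hv hd i => ?_⟩
  · exact (hB1 i i' fun h => hii (Fin.ext h)).mono (Finset.filter_subset _ _)
      (Finset.filter_subset _ _)
  · obtain ⟨h1, h2⟩ := Finset.mem_filter.1 hu
    exact ⟨hB2 i h1, h2⟩
  · refine M.closure_subset_closure ?_ (hall i i.2 v hv)
    rw [Finset.coe_subset]
    exact Finset.monotone_filter_right _ fun u _ hu => hd.trans hu

/-- The algorithm computes an approximate solution; its running time is polynomial in the size of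
the input, the time of the independence test, and `(3 ⌈1 / ε⌉) ^ k`. -/
theorem mainP_spec {η : ℕ} (hη : 1 ≤ η) (hG : G.EdgeSizeLE η) (hE : M.E = Set.univ)
    (hk : M.eRank = k) (hε : 0 < ε) (hEs : EncodesEdges Es G)
    (hq : IsOracle q D n (IndepList M) Q) :
    (∃ S : Finset (Fin n), EncodesSet ((mainP q).eval (n, ε, Es, D)) S ∧
      G.IsApprox M (1 - ((η : ℝ) - 1) * ε) S) ∧
    (mainP q).cost (n, ε, Es, D) ≤
      12000 * ((n + 1) ^ (η + 4) * (3 * ⌈1 / ε⌉₊) ^ k * (Q + 1)) := by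
  obtain ⟨j, -, hR, hj⟩ := kernelP_spec (q := q) D ε (sortP.eval (Es, (List.range n).reverse)) n
    (KernelInv G M k ⌈1 / ε⌉₊) ⟨by simp, by simp, by simp, fun _ => ∅, by simp, by simp, by simp,
      by simp⟩ fun j K hj hK => hq.kernelInv_step hE hk hEs hε hj hK
  rw [← eval_mainKernelP] at hR
  set K : List ℕ := (mainKernelP q).eval (n, ε, Es, D) with hKdef
  have ht : 0 < ⌈1 / ε⌉₊ := Nat.ceil_pos.2 (by positivity)
  have hP : ∀ l, IndepList M l → l.length ≤ k := fun l hl => hl.length_le hk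
  have henum := hq.enumInv (x := ((⌈1 / ε⌉₊ : ℕ) : ℝ)⁻¹) (by positivity) hR.1
  have hlen := henum.length_le ht hP (hR.2.1.trans (Nat.mul_le_mul_left k hR.2.2.1))
  constructor
  · obtain ⟨S, hSK, hS, hSapprox⟩ := (hR.hasSpanningLayers hε hj).containsApprox hη hε
      (Nat.le_ceil _) hG hE
    obtain ⟨b1, b2⟩ := bestP_spec Es ((enumP q).eval (D, K))
    rw [eval_mainP, ← hKdef]
    set b : List ℕ := bestP.eval (Es, (enumP q).eval (D, K)) with hb
    -- The search for the maximum starts from the empty list, which is independent too.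
    have hbP : IndepList M b := by
      rcases b1 with h | h
      · rw [h]; exact hq.nil
      · exact (henum.1 b h).1
    refine ⟨toF n b, encodesSet_toF hbP.1 hbP.2.1, hbP.2.2, fun O hO => ?_⟩
    -- The enumeration prepends later entries, so it lists subsets in the order of `K.reverse`.
    obtain ⟨s, hs, hsS⟩ := exists_sublist_toF_eq (l := K.reverse) (S := S) (fun v hv => by
      rw [mem_toF, List.mem_reverse]
      exact mem_toF.1 (hSK hv))
    have hsP : IndepList M s := by
      refine ⟨hs.nodup (List.nodup_reverse.2 hR.1.1), fun x hx => ?_, by rwa [hsS]⟩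
      exact hR.1.2 x (List.mem_reverse.1 (hs.subset hx))
    have h1 := b2 s (henum.2.1 s hs hsP)
    rw [hEs.covL_eq, hEs.covL_eq, hsS] at h1
    exact (hSapprox O hO).trans h1
  · refine (hq.cost_mainP ε hEs.length_le_of_mem hR.1 hlen).trans ?_
    have e1 := hEs.length_le hG
    have e2 : 1 ≤ (n + 1) ^ η := Nat.one_le_pow _ _ (by omega)
    have e3 : 1 ≤ (3 * ⌈1 / ε⌉₊) ^ k := Nat.one_le_pow _ _ (by omega)
    calc 3000 * ((Es.length + 1) * (n + 1) * (n + 1) ^ 3 * ((3 * ⌈1 / ε⌉₊) ^ k + 1) * (Q + 1))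
        ≤ 3000 * ((2 * (n + 1) ^ η) * (n + 1) * (n + 1) ^ 3 * (2 * (3 * ⌈1 / ε⌉₊) ^ k) *
          (Q + 1)) := by
          gcongr <;> omega
      _ = _ := by ring

end Prog

namespace Prog

/-! ### The independence tests -/

/-- The body of `countP`. -/
def countBody : Prog (.prod LN (.prod .nat .nat)) .nat :=
  .ite (.comp memP (.pair (.comp .snd .snd) .fst))
    (.comp .natAdd (.pair (.comp .fst .snd) (.natLit 1))) (.comp .fst .snd)

/-- The number of entries of the second list that belong to the first one. -/
def countP : Prog (.prod LN LN) .nat :=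
  .comp (.fold countBody) (.pair .fst (.pair (.natLit 0) .snd))

lemma eval_countP (x : Ty.Val (.prod LN LN)) :
    countP.eval x = List.countP (fun y => decide (y ∈ x.1)) x.2 := by
  obtain ⟨s, l⟩ := x
  simp only [countP, eval_comp, eval_pair, eval_fst, eval_snd, eval_natLit]
  rw [eval_fold]
  refine foldl_invariant (fun p (c : ℕ) => c = List.countP (fun y => decide (y ∈ s)) p) (by simp) ?_
  rintro p y q c - rfl
  have : ∀ c : ℕ, countBody.eval (s, c, y) = if memP.eval (y, s) = true then c + 1 else c :=
    fun _ => rfl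
  rw [this, eval_memP, List.countP_append, List.countP_singleton]
  by_cases h : y ∈ s
  · simp [h]
  · simp [h]

lemma cost_countP (s l : List ℕ) :
    countP.cost (s, l) ≤ 100 * ((l.length + 1) * (s.length + 1)) := by
  have h := cost_fold_le (p := countBody) (x := s) (s := 0) (l := l) (40 * (s.length + 1) + 20)
    fun b y _ => by
      have := cost_memP y s
      refine (cost_ite_le _ _ _ _).trans ?_
      simp
      omega
  simp only [countP, cost_comp, cost_pair, cost_fst, cost_snd, cost_natLit, eval_pair, eval_fst,
    eval_snd, eval_natLit]
  simp only [Ty.Val] at h ⊢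
  nlinarith

/-- The body of `capP`. -/
def capBody : Prog (.prod LN (.prod .bool (.prod LN .nat))) .bool :=
  .ite (.comp .natLe (.pair (.comp countP (.pair .fst (.comp .fst (.comp .snd .snd))))
    (.comp .snd (.comp .snd .snd)))) (.comp .fst .snd) (.boolLit false)

/-- Test whether a set satisfies all capacity constraints. -/
def capP : Prog (.prod CapacityTy LN) .bool :=
  .comp (.fold capBody) (.pair .snd (.pair (.boolLit true) .fst))

lemma eval_capP (Fs : List (List ℕ × ℕ)) (s : List ℕ) : capP.eval (Fs, s) =
    decide (∀ p ∈ Fs, List.countP (fun y => decide (y ∈ s)) p.1 ≤ p.2) := by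
  simp only [capP, eval_comp, eval_pair, eval_fst, eval_snd, eval_boolLit]
  rw [eval_fold]
  refine foldl_invariant (fun (r : List (List ℕ × ℕ)) (t : Bool) => t =
    decide (∀ p ∈ r, List.countP (fun y => decide (y ∈ s)) p.1 ≤ p.2)) (by simp) ?_
  rintro r p q t - rfl
  have : ∀ t : Bool, capBody.eval (s, t, p) =
    if decide (countP.eval (s, p.1) ≤ p.2) = true then t else false := fun _ => rfl
  rw [this, eval_countP]
  by_cases h : List.countP (fun y => decide (y ∈ s)) p.1 ≤ p.2
  · simp only [h, decide_true, if_true, decide_eq_decide]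
    exact ⟨fun hr p' hp' => (List.mem_append.1 hp').elim (hr p') fun hp' => by
        rw [List.mem_singleton.1 hp']; exact h,
      fun hr p' hp' => hr p' (List.mem_append_left _ hp')⟩
  · simp only [h, decide_false, Bool.false_eq_true, if_false]
    symm
    rw [decide_eq_false_iff_not]
    exact fun hr => h (hr p (by simp))

lemma cost_capP {Fs : List (List ℕ × ℕ)} {h : ℕ} (hFs : ∀ p ∈ Fs, p.1.length ≤ h) (s : List ℕ) :
    capP.cost (Fs, s) ≤ 200 * ((Fs.length + 1) * (h + 1) * (s.length + 1)) := by
  have hf := cost_fold_le (p := capBody) (x := s) (s := true) (l := Fs)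
    (100 * ((h + 1) * (s.length + 1)) + 40) fun b y hy => by
      have h1 := cost_countP s y.1
      have h2 : (y.1.length + 1) * (s.length + 1) ≤ (h + 1) * (s.length + 1) :=
        Nat.mul_le_mul_right _ (Nat.succ_le_succ (hFs y hy))
      refine (cost_ite_le _ _ _ _).trans ?_
      simp only [cost_comp, cost_pair, cost_fst, cost_snd, cost_natLe, cost_boolLit,
        eval_pair, eval_comp, eval_fst, eval_snd]
      omega
  simp only [capP, cost_comp, cost_pair, cost_fst, cost_snd, cost_boolLit, eval_pair, eval_fst,
    eval_snd, eval_boolLit]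
  have h3 : 1 ≤ (h + 1) * (s.length + 1) := Nat.mul_pos (by omega) (by omega)
  rw [mul_assoc]
  nlinarith

end Prog

lemma EncodesSet.countP_eq {n : ℕ} {l : List ℕ} {S : Finset (Fin n)} (h : EncodesSet l S)
    (s : List ℕ) : List.countP (fun y => decide (y ∈ s)) l = (toF n s ∩ S).card := by
  obtain ⟨l', hnd, rfl, rfl⟩ := h
  rw [List.countP_map, List.countP_eq_length_filter,
    ← List.toFinset_card_of_nodup (hnd.filter _)]
  congr 1
  ext v
  simp [mem_toF, and_comm]

lemma EncodesCapacities.forall_iff {n r : ℕ} {Fs : List (List ℕ × ℕ)} {F : Fin r → Finset (Fin n)}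
    {b : Fin r → ℕ} (h : EncodesCapacities Fs F b) {C : List ℕ → ℕ → Prop}
    {C' : Finset (Fin n) → ℕ → Prop} (hC : ∀ l S c, EncodesSet l S → (C l c ↔ C' S c)) :
    (∀ p ∈ Fs, C p.1 p.2) ↔ ∀ i, C' (F i) (b i) := by
  have : (∀ p ∈ Fs, C p.1 p.2) ↔ ∀ i ∈ List.finRange r, C' (F i) (b i) := by
    unfold EncodesCapacities at h
    generalize List.finRange r = L at h
    induction h with
    | nil => simp
    | cons hp _ ih => simp only [List.forall_mem_cons, ih, hp.2, hC _ _ _ hp.1]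
  simpa using this

/-- The claimed running time does not mention `r`, so `r` must be polynomial in `n`. Members sharing
a vertex are nested, and nested sets of equal size coincide; hence a chosen vertex and the size
determine a nonempty member. With the empty set this allows at most `n(n+1) + 1` members. -/
lemma IsLaminarMatroid.card_le {n r : ℕ} {M : Matroid (Fin n)} {F : Fin r → Finset (Fin n)}
    {b : Fin r → ℕ} (h : IsLaminarMatroid M F b) : r ≤ (n + 1) ^ 2 := by
  classical
  obtain ⟨hinj, hlam, -⟩ := h
  set g : Fin r → Option (Fin n × Fin (n + 1)) := fun i =>
    if hi : (F i).Nonempty then some (hi.choose, ⟨(F i).card, by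
      have := Finset.card_le_univ (F i)
      simp at this
      omega⟩) else none with hg
  have hginj : Function.Injective g := by
    intro i j hij
    by_contra hne
    by_cases hi : (F i).Nonempty
    · by_cases hj : (F j).Nonempty
      · simp only [hg, dif_pos hi, dif_pos hj, Option.some.injEq, Prod.mk.injEq,
          Fin.mk.injEq] at hij
        have hvi := hi.choose_spec
        have hvj := hj.choose_spec
        rw [← hij.1] at hvj
        rcases hlam i j hne with h | h | h
        · exact Finset.disjoint_left.1 h hvi hvj
        · exact hne (hinj (Finset.eq_of_subset_of_card_le h hij.2.ge))
        · exact hne (hinj (Finset.eq_of_subset_of_card_le h hij.2.le).symm)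
      · simp [hg, dif_pos hi, dif_neg hj] at hij
    · by_cases hj : (F j).Nonempty
      · simp [hg, dif_neg hi, dif_pos hj] at hij
      · rw [Finset.not_nonempty_iff_eq_empty] at hi hj
        exact hne (hinj (hi.trans hj.symm))
  have := Fintype.card_le_of_injective g hginj
  simp only [Fintype.card_fin, Fintype.card_option, Fintype.card_prod] at this
  nlinarith

lemma IsPartitionMatroid.isLaminarMatroid {V : Type u} [DecidableEq V] {M : Matroid V} {r : ℕ}
    {F : Fin r → Finset V} {b : Fin r → ℕ} (h : IsPartitionMatroid M F b) :
    IsLaminarMatroid M F b := by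
  obtain ⟨h1, h2, -, h4⟩ := h
  refine ⟨fun i j hij => ?_, fun i j hij => Or.inl (h2 i j hij), h4⟩
  by_contra hne
  have := h2 i j hne
  rw [hij, disjoint_self] at this
  exact (h1 j).ne_empty this

namespace Prog

/-- The exponent `4` collects `2` for the number of sets, `1` for the length of each set and `1` for
the length of the tested list. -/
lemma isOracle_capP {n r : ℕ} {M : Matroid (Fin n)} {F : Fin r → Finset (Fin n)}
    {b : Fin r → ℕ} (h : IsLaminarMatroid M F b) {Fs : List (List ℕ × ℕ)}
    (hFs : EncodesCapacities Fs F b) :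
    IsOracle capP Fs n (IndepList M) (400 * (n + 1) ^ 4) where
  nil := ⟨by simp, by simp, by simp [toF]⟩
  nodup l hl := hl.1
  lt l hl := hl.2.1
  tail v l hl := by
    refine ⟨(List.nodup_cons.1 hl.1).2, fun x hx => hl.2.1 x (List.mem_cons_of_mem _ hx),
      hl.2.2.subset fun u hu => ?_⟩
    have hu := mem_toF.1 (Finset.mem_coe.1 hu)
    exact Finset.mem_coe.2 (mem_toF.2 (List.mem_cons_of_mem _ hu))
  eval v l hl hv hvn := by
    rw [eval_capP, decide_eq_true_eq, hFs.forall_iff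
      (C := fun l' c => List.countP (fun y => decide (y ∈ v :: l)) l' ≤ c) (C' := fun S c => (toF n (v :: l) ∩ S).card ≤ c) fun l' S c hl' => by rw [hl'.countP_eq]]
    rw [← h.2.2.2]
    refine ⟨fun hind => ⟨List.nodup_cons.2 ⟨hv, hl.1⟩, ?_, hind⟩, fun hP => hP.2.2⟩
    intro x hx
    rcases List.mem_cons.1 hx with rfl | hx
    exacts [hvn, hl.2.1 x hx]
  cost v l hl hv hvn := by
    have hlen : Fs.length = r := by
      have := List.Forall₂.length_eq hFs
      simpa using this
    have hr := h.card_le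
    have hle : ∀ p ∈ Fs, p.1.length ≤ n := (hFs.forall_iff (C := fun l _ => l.length ≤ n)
      (C' := fun S _ => S.card ≤ n) fun l S c hl => by rw [hl.card_eq]).2 fun i => by
        simpa using Finset.card_le_univ (F i)
    have hvl : (v :: l).length ≤ n := length_le_of_nodup (List.nodup_cons.2 ⟨hv, hl.1⟩) (by
      intro x hx
      rcases List.mem_cons.1 hx with rfl | hx
      exacts [hvn, hl.2.1 x hx])
    refine (cost_capP hle (v :: l)).trans ?_
    have hX : 1 ≤ (n + 1) ^ 2 := Nat.one_le_pow _ _ (by omega)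
    calc 200 * ((Fs.length + 1) * (n + 1) * ((v :: l).length + 1))
        ≤ 200 * ((2 * (n + 1) ^ 2) * (n + 1) * (n + 1)) := by
          gcongr
          omega
      _ = 400 * (n + 1) ^ 4 := by ring

end Prog

/-! ### Testing independence in transversal matroids by Hall's condition. -/

namespace Prog

/-- The body of `hitP`. -/
def hitBody : Prog (.prod LN (.prod .nat LN)) .nat :=
  .ite (.comp anyP (.pair .fst (.comp .snd .snd)))
    (.comp .natAdd (.pair (.comp .fst .snd) (.natLit 1))) (.comp .fst .snd)

/-- The number of sets of a family that meet a given set. -/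
def hitP : Prog (.prod FamilyTy LN) .nat :=
  .comp (.fold hitBody) (.pair .snd (.pair (.natLit 0) .fst))

lemma eval_hitP (x : Ty.Val (.prod FamilyTy LN)) :
    hitP.eval x = List.countP (fun l => decide (∃ y ∈ l, y ∈ x.2)) x.1 := by
  obtain ⟨Fs, s⟩ := x
  simp only [hitP, eval_comp, eval_pair, eval_fst, eval_snd, eval_natLit]
  rw [eval_fold]
  refine foldl_invariant (fun (p : List (List ℕ)) (c : ℕ) =>
    c = List.countP (fun l => decide (∃ y ∈ l, y ∈ s)) p) (by simp) ?_
  rintro p l q c - rfl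
  have : ∀ c : ℕ, hitBody.eval (s, c, l) = if anyP.eval (s, l) = true then c + 1 else c :=
    fun _ => rfl
  rw [this, eval_anyP, List.countP_append, List.countP_singleton]
  by_cases h : ∃ y ∈ l, y ∈ s
  · simp only [h, decide_true, if_true]
  · simp only [h, decide_false, Bool.false_eq_true, if_false, add_zero]

lemma cost_hitP {Fs : List (List ℕ)} {h : ℕ} (hFs : ∀ l ∈ Fs, l.length ≤ h) (s : List ℕ) :
    hitP.cost (Fs, s) ≤ 200 * ((Fs.length + 1) * (h + 1) * (s.length + 1)) := by
  have hf := cost_fold_le (p := hitBody) (x := s) (s := 0) (l := Fs)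
    (100 * ((h + 1) * (s.length + 1)) + 40) fun b y hy => by
      have h1 := cost_anyP s y
      have h2 : (List.length y + 1) * (s.length + 1) ≤ (h + 1) * (s.length + 1) :=
        Nat.mul_le_mul_right _ (Nat.succ_le_succ (hFs y hy))
      refine (cost_ite_le _ _ _ _).trans ?_
      simp only [cost_comp, cost_pair, cost_fst, cost_snd, cost_natAdd, cost_natLit,
        eval_pair, eval_comp, eval_fst, eval_snd]
      omega
  simp only [hitP, cost_comp, cost_pair, cost_fst, cost_snd, cost_natLit, eval_pair, eval_fst,
    eval_snd, eval_natLit]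
  simp only [Ty.Val] at hf ⊢
  have h3 : 1 ≤ (h + 1) * (s.length + 1) := Nat.mul_pos (by omega) (by omega)
  rw [mul_assoc]
  nlinarith

/-- The list of all subsets of a set. -/
def subsetsP : Prog LN (.list LN) :=
  .comp (enumP (m := .unit) (.boolLit true)) (.pair .unit .id)

/-- The body of `transP`. -/
def transBody : Prog (.prod FamilyTy (.prod .bool LN)) .bool :=
  .ite (.comp .natLe (.pair (.comp countP (.pair (.comp .snd .snd) (.comp .snd .snd)))
    (.comp hitP (.pair .fst (.comp .snd .snd))))) (.comp .fst .snd) (.boolLit false)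

/-- Test the condition of Hall's theorem for all subsets of a given set. -/
def transP : Prog (.prod FamilyTy LN) .bool :=
  .comp (.fold transBody) (.pair .fst (.pair (.boolLit true) (.comp subsetsP .snd)))

lemma eval_transP (Fs : List (List ℕ)) (s : List ℕ) : transP.eval (Fs, s) =
    decide (∀ T ∈ (subsetsP.eval s : List (List ℕ)),
      T.length ≤ List.countP (fun l => decide (∃ y ∈ l, y ∈ T)) Fs) := by
  simp only [transP, eval_comp, eval_pair, eval_fst, eval_snd, eval_boolLit]
  rw [eval_fold]
  refine foldl_invariant (fun (r : List (List ℕ)) (t : Bool) => t = decide (∀ T ∈ r,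
    T.length ≤ List.countP (fun l => decide (∃ y ∈ l, y ∈ T)) Fs)) (by simp) ?_
  rintro r T q t - rfl
  have : ∀ t : Bool, transBody.eval (Fs, t, T) =
    if decide (countP.eval (T, T) ≤ hitP.eval (Fs, T)) = true then t else false := fun _ => rfl
  rw [this, eval_countP, eval_hitP]
  have hT : List.countP (fun y => decide (y ∈ T)) T = List.length T := by
    rw [List.countP_eq_length]
    simp
  simp only
  rw [hT]
  by_cases h : List.length T ≤ List.countP (fun l => decide (∃ y ∈ l, y ∈ T)) Fs
  · simp only [h, decide_true, if_true, decide_eq_decide]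
    exact ⟨fun hr T' hT' => (List.mem_append.1 hT').elim (hr T') fun hT' => by
        rw [List.mem_singleton.1 hT']; exact h,
      fun hr T' hT' => hr T' (List.mem_append_left _ hT')⟩
  · simp only [h, decide_false, Bool.false_eq_true, if_false]
    symm
    rw [decide_eq_false_iff_not]
    exact fun hr => h (hr T (by simp))

lemma isOracle_true (n : ℕ) : IsOracle (m := .unit) (.boolLit true) () n
    (fun l => l.Nodup ∧ ∀ x ∈ l, x < n) 1 where
  nil := by simp
  nodup l hl := hl.1
  lt l hl := hl.2
  tail v l hl := ⟨(List.nodup_cons.1 hl.1).2, fun x hx => hl.2 x (List.mem_cons_of_mem _ hx)⟩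
  eval v l hl hv hvn := by
    simp only [eval_boolLit, true_iff]
    refine ⟨List.nodup_cons.2 ⟨hv, hl.1⟩, fun x hx => ?_⟩
    rcases List.mem_cons.1 hx with rfl | hx
    exacts [hvn, hl.2 x hx]
  cost v l _ _ _ := le_rfl

/-- The enumeration is reused with a test that always succeeds; at `x = 1` its weight bound reads `2
^ s.length`. -/
lemma subsetsP_spec {n : ℕ} {s : List ℕ} (hs : s.Nodup ∧ ∀ x ∈ s, x < n) :
    (∀ T ∈ (subsetsP.eval s : List (List ℕ)), (T.Nodup ∧ ∀ x ∈ T, x < n) ∧ T ⊆ s) ∧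
    (∀ T : List ℕ, T.Sublist s.reverse → T ∈ (subsetsP.eval s : List (List ℕ))) ∧
    (subsetsP.eval s : List (List ℕ)).length ≤ 2 ^ s.length ∧
    subsetsP.cost s ≤ 300 * ((n + 1) * (2 ^ s.length + 1)) := by
  obtain ⟨h1, h2, h3⟩ := (isOracle_true n).enumInv zero_le_one hs
  have hlen : ((enumP (m := .unit) (.boolLit true)).eval ((), s) : List (List ℕ)).length ≤
      2 ^ s.length := by
    have h4 : (1 : ℝ) + 1 = 2 := by norm_num
    simp only [one_pow, List.map_const', List.sum_replicate, nsmul_eq_mul, mul_one, h4] at h3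
    exact_mod_cast h3
  have hc := (isOracle_true n).cost_enumP hs hlen
  refine ⟨h1, fun T hT => h2 T hT ⟨hT.nodup (List.nodup_reverse.2 hs.1), fun x hx =>
    hs.2 x (List.mem_reverse.1 (hT.subset hx))⟩, hlen, ?_⟩
  have h5 : 1 ≤ (n + 1) * (2 ^ s.length + 1) := Nat.mul_pos (by omega) (by omega)
  simp only [subsetsP, cost_comp, cost_pair, cost_unit, cost_id, eval_pair, eval_unit, eval_id]
  omega

lemma cost_transP {n : ℕ} {Fs : List (List ℕ)} (hFs : ∀ l ∈ Fs, l.length ≤ n) {s : List ℕ}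
    (hs : s.Nodup ∧ ∀ x ∈ s, x < n) :
    transP.cost (Fs, s) ≤ 1600 * ((Fs.length + 1) * (n + 1) ^ 2 * 2 ^ s.length) := by
  obtain ⟨h1, -, h3, h4⟩ := subsetsP_spec hs
  have hf := cost_fold_le (p := transBody) (x := Fs) (s := true) (l := subsetsP.eval s)
    (400 * ((Fs.length + 1) * (n + 1) * (n + 1))) fun b T hT => by
      have hT' := (h1 T hT).1
      have hTn := length_le_of_nodup hT'.1 hT'.2
      have e1 := cost_countP T T
      have e2 := cost_hitP hFs T
      have e3 : (Fs.length + 1) * (n + 1) * (List.length T + 1) ≤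
        (Fs.length + 1) * (n + 1) * (n + 1) := Nat.mul_le_mul_left _ (by omega)
      have e4 : (List.length T + 1) * (List.length T + 1) ≤
          (Fs.length + 1) * (n + 1) * (n + 1) :=
        calc _ ≤ 1 * (n + 1) * (n + 1) := by
              rw [one_mul]; exact Nat.mul_le_mul (by omega) (by omega)
          _ ≤ _ := by gcongr; omega
      have e5 : 1 ≤ (Fs.length + 1) * (n + 1) * (n + 1) := by
        refine le_trans ?_ e4
        exact Nat.mul_pos (by omega) (by omega)
      refine (cost_ite_le _ _ _ _).trans ?_
      simp only [cost_comp, cost_pair, cost_fst, cost_snd, cost_natLe, cost_boolLit,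
        eval_pair, eval_comp, eval_fst, eval_snd]
      omega
  have hp : 1 ≤ 2 ^ s.length := Nat.one_le_two_pow
  have f1 : List.length (subsetsP.eval s) * (400 * ((Fs.length + 1) * (n + 1) * (n + 1)) + 1) ≤
      2 ^ s.length * (400 * ((Fs.length + 1) * (n + 1) * (n + 1)) + 1) :=
    Nat.mul_le_mul_right _ h3
  have f2 : (n + 1) * 2 ^ s.length ≤ (Fs.length + 1) * (n + 1) ^ 2 * 2 ^ s.length :=
    calc (n + 1) * 2 ^ s.length = 1 * (n + 1) ^ 1 * 2 ^ s.length := by ring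
      _ ≤ _ := by gcongr <;> omega
  have f3 : 2 ^ s.length ≤ (n + 1) * 2 ^ s.length := Nat.le_mul_of_pos_left _ (by omega)
  have f4 : n + 1 ≤ (n + 1) * 2 ^ s.length := Nat.le_mul_of_pos_right _ (by omega)
  have f5 : 2 ^ s.length * (400 * ((Fs.length + 1) * (n + 1) * (n + 1)) + 1) =
      400 * ((Fs.length + 1) * (n + 1) ^ 2 * 2 ^ s.length) + 2 ^ s.length := by ring
  have f6 : (n + 1) * (2 ^ s.length + 1) = (n + 1) * 2 ^ s.length + (n + 1) := by ring
  simp only [transP, cost_comp, cost_pair, cost_fst, cost_snd, cost_boolLit, eval_pair, eval_comp,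
    eval_fst, eval_snd, eval_boolLit]
  omega

end Prog

open Classical in
/-- Hall's theorem for the sets in a transversal matroid. -/
lemma exists_injective_iff_forall_card_le {V : Type*} [DecidableEq V] {r : ℕ}
    (F : Fin r → Finset V) (S : Finset V) :
    (∃ φ : {u // u ∈ S} → Fin r, Function.Injective φ ∧ ∀ u, u.1 ∈ F (φ u)) ↔
      ∀ A ⊆ S, A.card ≤ (Finset.univ.filter fun i => (F i ∩ A).Nonempty).card := by
  -- Hall's theorem for the family assigning to `u` the indices of the sets containing `u`: the
  -- neighbours of `A` are the indices of the sets meeting `A`.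
  have hall := Finset.all_card_le_biUnion_card_iff_exists_injective
    (fun u : {u // u ∈ S} => Finset.univ.filter fun i => u.1 ∈ F i)
  simp only [Finset.mem_filter, Finset.mem_univ, true_and] at hall
  rw [← hall]
  constructor
  · intro h A hA
    have := h (A.subtype (· ∈ S))
    rw [Finset.card_subtype, Finset.filter_true_of_mem fun u hu => hA hu] at this
    refine this.trans (Finset.card_le_card fun i hi => ?_)
    obtain ⟨u, hu, hi⟩ := Finset.mem_biUnion.1 hi
    rw [Finset.mem_filter] at hi ⊢
    exact ⟨Finset.mem_univ _, u.1, Finset.mem_inter.2 ⟨hi.2, Finset.mem_subtype.1 hu⟩⟩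
  · intro h A
    have := h (A.map (Function.Embedding.subtype _)) (by
      intro u hu
      obtain ⟨v, -, rfl⟩ := Finset.mem_map.1 hu
      exact v.2)
    rw [Finset.card_map] at this
    refine this.trans (Finset.card_le_card fun i hi => ?_)
    obtain ⟨u, hu⟩ := (Finset.mem_filter.1 hi).2
    obtain ⟨h1, h2⟩ := Finset.mem_inter.1 hu
    obtain ⟨v, hv, rfl⟩ := Finset.mem_map.1 h2
    exact Finset.mem_biUnion.2 ⟨v, hv, Finset.mem_filter.2 ⟨Finset.mem_univ _, h1⟩⟩

open Classical in
lemma EncodesFamily.countP_eq {n r : ℕ} {Fs : List (List ℕ)} {F : Fin r → Finset (Fin n)}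
    (h : EncodesFamily Fs F) (T : List ℕ) :
    List.countP (fun l => decide (∃ y ∈ l, y ∈ T)) Fs =
      (Finset.univ.filter fun i => (F i ∩ toF n T).Nonempty).card := by
  have h1 : List.countP (fun l => decide (∃ y ∈ l, y ∈ T)) Fs =
      List.countP (fun i => decide (F i ∩ toF n T).Nonempty) (List.finRange r) := by
    unfold EncodesFamily at h
    generalize List.finRange r = L at h
    induction h with
    | nil => rfl
    | @cons l i Fs L hl _ ih =>
      have hiff : (∃ y ∈ l, y ∈ T) ↔ (F i ∩ toF n T).Nonempty := by
        rw [hl.eq_toF]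
        constructor
        · rintro ⟨y, hy, hyl⟩
          exact ⟨⟨y, hl.lt y hy⟩, Finset.mem_inter.2 ⟨mem_toF.2 hy, mem_toF.2 hyl⟩⟩
        · rintro ⟨v, hv⟩
          rw [Finset.mem_inter, mem_toF, mem_toF] at hv
          exact ⟨v, hv⟩
      rw [List.countP_cons, List.countP_cons, ih]
      simp only [hiff]
  rw [h1, List.countP_eq_length_filter,
    ← List.toFinset_card_of_nodup ((List.nodup_finRange r).filter _)]
  congr 1
  ext i
  simp

lemma EncodesFamily.length_le {n r : ℕ} {Fs : List (List ℕ)} {F : Fin r → Finset (Fin n)}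
    (h : EncodesFamily Fs F) : ∀ l ∈ Fs, l.length ≤ n := by
  unfold EncodesFamily at h
  generalize List.finRange r = L at h
  intro p hp
  induction h with
  | nil => simp at hp
  | cons hpe _ ih =>
    rcases List.mem_cons.1 hp with rfl | hp
    · exact Prog.length_le_of_nodup hpe.nodup hpe.lt
    · exact ih hp

namespace Prog

lemma eval_transP_iff {n r : ℕ} {M : Matroid (Fin n)} {F : Fin r → Finset (Fin n)}
    (h : IsTransversalMatroid M F) {Fs : List (List ℕ)} (hFs : EncodesFamily Fs F) {s : List ℕ}
    (hs : s.Nodup ∧ ∀ x ∈ s, x < n) :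
    transP.eval (Fs, s) = true ↔ M.Indep (toF n s : Set (Fin n)) := by
  obtain ⟨h1, h2, -⟩ := subsetsP_spec hs
  rw [eval_transP, decide_eq_true_eq, h.2, exists_injective_iff_forall_card_le]
  constructor
  · intro hT A hA
    obtain ⟨T, hTs, rfl⟩ := exists_sublist_toF_eq (l := s.reverse) (S := A) (fun v hv => by
      rw [mem_toF, List.mem_reverse]
      exact mem_toF.1 (hA hv))
    have hTm := h2 T hTs
    have := hT T hTm
    rwa [hFs.countP_eq, ← (encodesSet_toF (h1 T hTm).1.1 (h1 T hTm).1.2).card_eq] at this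
  · intro hA T hT
    rw [hFs.countP_eq, ← (encodesSet_toF (h1 T hT).1.1 (h1 T hT).1.2).card_eq]
    exact hA _ fun v hv => mem_toF.2 ((h1 T hT).2 (mem_toF.1 hv))

/-- Only an independent set with one further vertex is ever tested. It has at most `k + 1` elements,
so checking all its subsets costs a factor `2^(k+1)`, within the exponential dependence allowed on
`k`. -/
lemma isOracle_transP {n r k : ℕ} {M : Matroid (Fin n)} {F : Fin r → Finset (Fin n)}
    (h : IsTransversalMatroid M F) (hk : M.eRank = k) {Fs : List (List ℕ)}
    (hFs : EncodesFamily Fs F) :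
    IsOracle transP Fs n (IndepList M) (1600 * ((r + 1) * (n + 1) ^ 2 * 2 ^ (k + 1))) where
  nil := ⟨by simp, by simp, by simp [toF]⟩
  nodup l hl := hl.1
  lt l hl := hl.2.1
  tail v l hl := by
    refine ⟨(List.nodup_cons.1 hl.1).2, fun x hx => hl.2.1 x (List.mem_cons_of_mem _ hx),
      hl.2.2.subset fun u hu => ?_⟩
    have hu := mem_toF.1 (Finset.mem_coe.1 hu)
    exact Finset.mem_coe.2 (mem_toF.2 (List.mem_cons_of_mem _ hu))
  eval v l hl hv hvn := by
    have hs : (v :: l).Nodup ∧ ∀ x ∈ v :: l, x < n := by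
      refine ⟨List.nodup_cons.2 ⟨hv, hl.1⟩, fun x hx => ?_⟩
      rcases List.mem_cons.1 hx with rfl | hx
      exacts [hvn, hl.2.1 x hx]
    rw [eval_transP_iff h hFs hs]
    exact ⟨fun hind => ⟨hs.1, hs.2, hind⟩, fun hP => hP.2.2⟩
  cost v l hl hv hvn := by
    have hs : (v :: l).Nodup ∧ ∀ x ∈ v :: l, x < n := by
      refine ⟨List.nodup_cons.2 ⟨hv, hl.1⟩, fun x hx => ?_⟩
      rcases List.mem_cons.1 hx with rfl | hx
      exacts [hvn, hl.2.1 x hx]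
    have hlen : Fs.length = r := by
      have := List.Forall₂.length_eq hFs
      simpa using this
    refine (cost_transP hFs.length_le hs).trans ?_
    rw [hlen]
    have := hl.length_le hk
    gcongr
    · norm_num
    · simpa using this

end Prog

/-! ### Kernel sizes, and the transversal case of rank zero. -/

section KernelBounds

variable {V : Type u} [DecidableEq V] {G : WHypergraph V} {M : Matroid V}

/-- For `k ≥ 1` there are at least `⌈1/ε⌉` copies. For `k = 0` there is one too few, but then only
the empty set is independent. -/
lemma IsTransversalMatroid.containsApprox [Fintype V] {η r k : ℕ} {F : Fin r → Finset V}
    (hη : 1 ≤ η) {ε : ℝ} (hε : 0 < ε) (hG : G.EdgeSizeLE η) (h : IsTransversalMatroid M F)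
    (hk : M.eRank = k) {K : Finset V} (hK : IsGreedyKernel G M (⌈1 / ε⌉₊ + k - 1) K) :
    ContainsApprox G M (1 - ((η : ℝ) - 1) * ε) K := by
  rcases Nat.eq_zero_or_pos k with rfl | hk0
  · refine ⟨∅, Finset.empty_subset _, by simp, fun O hO => ?_⟩
    have hO' : O.card ≤ 0 := by
      have h1 := hO.encard_le_eRank
      rw [hk, Set.encard_coe_eq_coe_finsetCard] at h1
      exact_mod_cast h1
    rw [Nat.le_zero, Finset.card_eq_zero] at hO'
    rw [hO', G.cover_empty, mul_zero]
  · exact hK.containsApprox hη hε (by omega) hG h.1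

lemma IsGreedyKernel.card_le {k τ : ℕ} {K : Finset V} (hk : M.eRank = k)
    (hK : IsGreedyKernel G M τ K) : K.card ≤ τ * k :=
  hK.unionIndep.card_le hk

end KernelBounds

/-! ### Bringing the running times into the claimed form. -/

section RunningTime

lemma cost_bound_capacity (η n k : ℕ) {ε : ℝ} (hε : 0 < ε) :
    ((12000 * ((n + 1) ^ (η + 4) * (3 * ⌈1 / ε⌉₊) ^ k * (400 * (n + 1) ^ 4 + 1)) : ℕ) : ℝ) ≤
      ((4812000 : ℕ) : ℝ) * (max 2 (1 / ε)) ^ ((η + 8) * k) * ((n : ℝ) + 1) ^ (η + 8) := by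
  set m : ℝ := max 2 (1 / ε)
  have hm2 : (2 : ℝ) ≤ m := le_max_left _ _
  have hmε : 1 / ε ≤ m := le_max_right _ _
  have hn : (1 : ℝ) ≤ (n : ℝ) + 1 := by linarith [(Nat.cast_nonneg n : (0 : ℝ) ≤ n)]
  have ht : (⌈1 / ε⌉₊ : ℝ) ≤ m + 1 := by
    linarith [(Nat.ceil_lt_add_one (one_div_pos.2 hε).le).le]
  -- As `m ≥ 2`, `m^4 ≥ 8m ≥ 3(m + 1)`; this absorbs the factor `3^k` into the exponent. The leading
  -- constant is `12000 · 401`.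
  have h3 : 3 * (⌈1 / ε⌉₊ : ℝ) ≤ m ^ 4 := by
    have h8 : (2 : ℝ) ^ 3 ≤ m ^ 3 := by gcongr
    have : m ^ 4 = m ^ 3 * m := by ring
    nlinarith
  have hpow : (3 * (⌈1 / ε⌉₊ : ℝ)) ^ k ≤ m ^ ((η + 8) * k) := by
    calc (3 * (⌈1 / ε⌉₊ : ℝ)) ^ k ≤ (m ^ 4) ^ k := by gcongr
      _ = m ^ (4 * k) := by rw [pow_mul]
      _ ≤ m ^ ((η + 8) * k) := pow_le_pow_right₀ (by linarith) (by gcongr; omega)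
  have hq : 400 * ((n : ℝ) + 1) ^ 4 + 1 ≤ 401 * ((n : ℝ) + 1) ^ 4 := by
    linarith [one_le_pow₀ hn (n := 4)]
  push_cast
  calc (12000 : ℝ) * (((n : ℝ) + 1) ^ (η + 4) * (3 * (⌈1 / ε⌉₊ : ℝ)) ^ k *
        (400 * ((n : ℝ) + 1) ^ 4 + 1))
      ≤ 12000 * (((n : ℝ) + 1) ^ (η + 4) * m ^ ((η + 8) * k) * (401 * ((n : ℝ) + 1) ^ 4)) := by
        gcongr
    _ = 4812000 * m ^ ((η + 8) * k) * ((n : ℝ) + 1) ^ (η + 8) := by ring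

lemma cost_bound_transversal (η n k r : ℕ) {ε : ℝ} (hε : 0 < ε) :
    ((12000 * ((n + 1) ^ (η + 4) * (3 * ⌈1 / ε⌉₊) ^ k *
        (1600 * ((r + 1) * (n + 1) ^ 2 * 2 ^ (k + 1)) + 1)) : ℕ) : ℝ) ≤
      ((230472000 : ℕ) : ℝ) * (1 / ε + k) ^ ((η + 7) * k) *
        ((n : ℝ) + r + 1) ^ (η + 7) := by
  set b : ℝ := 1 / ε + k
  have hε' : 0 < 1 / ε := one_div_pos.2 hε
  have hn : (0 : ℝ) ≤ n := Nat.cast_nonneg n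
  have hr : (0 : ℝ) ≤ r := Nat.cast_nonneg r
  set N : ℝ := (n : ℝ) + r + 1
  have hN : (1 : ℝ) ≤ N := by linarith
  have ht : (⌈1 / ε⌉₊ : ℝ) ≤ 1 / ε + 1 := (Nat.ceil_lt_add_one hε'.le).le
  -- For `k ≥ 2` the base `b` is at least `2` and absorbs constants as before. For `k = 1` it may be
  -- arbitrarily close to `1`, which is why the factor `6` is kept; the leading constant is `12000 ·
  -- 3201 · 6`.
  have hpow : (3 * (⌈1 / ε⌉₊ : ℝ)) ^ k * 2 ^ k ≤ 6 * b ^ ((η + 7) * k) := by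
    rcases Nat.eq_zero_or_pos k with rfl | hk0
    · simp
    have hk1 : (1 : ℝ) ≤ k := by exact_mod_cast hk0
    have hb1 : (1 : ℝ) ≤ b := by simp only [b]; linarith
    have htb : (⌈1 / ε⌉₊ : ℝ) ≤ b := by simp only [b]; linarith
    rcases (Nat.succ_le_of_lt hk0).eq_or_lt with hk | hk
    · have := le_self_pow₀ hb1 (n := (η + 7) * k) (by positivity)
      rw [← hk] at this ⊢
      simp only [pow_one]
      linarith
    · have hk' : (2 : ℝ) ≤ k := by exact_mod_cast hk
      have hb : (2 : ℝ) ≤ b := by simp only [b]; linarith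
      have h6 : 3 * (⌈1 / ε⌉₊ : ℝ) * 2 ≤ b ^ 4 := by
        have h8 : (2 : ℝ) ^ 3 ≤ b ^ 3 := by gcongr
        have : b ^ 4 = b ^ 3 * b := by ring
        nlinarith
      have hb0 : 0 ≤ b ^ ((η + 7) * k) := by positivity
      calc (3 * (⌈1 / ε⌉₊ : ℝ)) ^ k * 2 ^ k = (3 * (⌈1 / ε⌉₊ : ℝ) * 2) ^ k := (mul_pow _ _ _).symm
        _ ≤ (b ^ 4) ^ k := by gcongr
        _ = b ^ (4 * k) := by rw [pow_mul]
        _ ≤ b ^ ((η + 7) * k) := pow_le_pow_right₀ (by linarith) (by gcongr; omega)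
        _ ≤ 6 * b ^ ((η + 7) * k) := by linarith
  have hq : 1600 * (((r : ℝ) + 1) * ((n : ℝ) + 1) ^ 2 * 2 ^ (k + 1)) + 1 ≤
      3201 * N ^ 3 * 2 ^ k := by
    have h1 : ((r : ℝ) + 1) * ((n : ℝ) + 1) ^ 2 ≤ N * N ^ 2 := by
      gcongr <;> (simp only [N]; linarith)
    have h2 : (1 : ℝ) ≤ 2 ^ k := one_le_pow₀ (by norm_num)
    have h3 : (1 : ℝ) ≤ N ^ 3 * 2 ^ k := one_le_mul_of_one_le_of_one_le (one_le_pow₀ hN) h2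
    have h4 := mul_le_mul_of_nonneg_right h1 (zero_le_one.trans h2)
    have h5 : N * N ^ 2 * 2 ^ k = N ^ 3 * 2 ^ k := by ring
    rw [pow_succ (2 : ℝ) k]
    linarith
  have hnN : (n : ℝ) + 1 ≤ N := by simp only [N]; linarith
  push_cast
  calc (12000 : ℝ) * (((n : ℝ) + 1) ^ (η + 4) * (3 * (⌈1 / ε⌉₊ : ℝ)) ^ k *
        (1600 * (((r : ℝ) + 1) * ((n : ℝ) + 1) ^ 2 * 2 ^ (k + 1)) + 1))
      ≤ 12000 * (N ^ (η + 4) * (3 * (⌈1 / ε⌉₊ : ℝ)) ^ k * (3201 * N ^ 3 * 2 ^ k)) := by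
        gcongr
    _ = 12000 * 3201 * N ^ (η + 7) * ((3 * (⌈1 / ε⌉₊ : ℝ)) ^ k * 2 ^ k) := by ring
    _ ≤ 12000 * 3201 * N ^ (η + 7) * (6 * b ^ ((η + 7) * k)) := by gcongr
    _ = 230472000 * b ^ ((η + 7) * k) * N ^ (η + 7) := by ring

end RunningTime

/-- The algorithm for laminar matroids; partition matroids are laminar. -/
lemma exists_prog_laminar (η : ℕ) (hη : 1 ≤ η) :
    ∃ (p : Prog (InputTy CapacityTy) (.list .nat)) (C c : ℕ),
      ∀ (n : ℕ) (G : WHypergraph (Fin n)) (M : Matroid (Fin n)) (k r : ℕ)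
        (F : Fin r → Finset (Fin n)) (b : Fin r → ℕ) (ε : ℝ)
        (Es : List (List ℕ × ℝ)) (Fs : List (List ℕ × ℕ)),
        G.EdgeSizeLE η → IsLaminarMatroid M F b → M.eRank = k → 0 < ε →
        EncodesEdges Es G → EncodesCapacities Fs F b →
        (∃ S : Finset (Fin n), EncodesSet (p.eval (n, ε, Es, Fs)) S ∧
          G.IsApprox M (1 - ((η : ℝ) - 1) * ε) S) ∧
        (p.cost (n, ε, Es, Fs) : ℝ) ≤
          C * (max 2 (1 / ε)) ^ (c * k) * ((n : ℝ) + 1) ^ c := by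
  refine ⟨Prog.mainP Prog.capP, 4812000, η + 8, ?_⟩
  intro n G M k r F b ε Es Fs hG hM hk hε hEs hFs
  obtain ⟨hS, hcost⟩ :=
    Prog.mainP_spec hη hG hM.2.2.1 hk hε hEs (Prog.isOracle_capP hM hFs)
  exact ⟨hS, (Nat.cast_le.2 hcost).trans (cost_bound_capacity η n k hε)⟩

theorem mainTheorem3 (η : ℕ) (hη : 2 ≤ η) :
    -- the kernels, for partition, laminar and transversal matroids
    (∀ (V : Type u) [Fintype V] [DecidableEq V] (G : WHypergraph V) (M : Matroid V) (k r : ℕ)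
        (F : Fin r → Finset V) (b : Fin r → ℕ) (ε : ℝ) (K : Finset V),
        G.EdgeSizeLE η → IsPartitionMatroid M F b → M.eRank = k → 0 < ε →
        IsGreedyKernel G M ⌈1 / ε⌉₊ K →
        K.card ≤ k * ⌈1 / ε⌉₊ ∧ ContainsApprox G M (1 - ((η : ℝ) - 1) * ε) K) ∧
    (∀ (V : Type u) [Fintype V] [DecidableEq V] (G : WHypergraph V) (M : Matroid V) (k r : ℕ)
        (F : Fin r → Finset V) (b : Fin r → ℕ) (ε : ℝ) (K : Finset V),
        G.EdgeSizeLE η → IsLaminarMatroid M F b → M.eRank = k → 0 < ε →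
        IsGreedyKernel G M (2 * ⌈1 / ε⌉₊) K →
        K.card ≤ 2 * k * ⌈1 / ε⌉₊ ∧ ContainsApprox G M (1 - ((η : ℝ) - 1) * ε) K) ∧
    (∀ (V : Type u) [Fintype V] [DecidableEq V] (G : WHypergraph V) (M : Matroid V) (k r : ℕ)
        (F : Fin r → Finset V) (ε : ℝ) (K : Finset V),
        G.EdgeSizeLE η → IsTransversalMatroid M F → M.eRank = k → 0 < ε →
        IsGreedyKernel G M (⌈1 / ε⌉₊ + k - 1) K →
        K.card ≤ k * ⌈1 / ε⌉₊ + k * (k - 1) ∧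
          ContainsApprox G M (1 - ((η : ℝ) - 1) * ε) K) ∧
    -- the algorithms, for partition, laminar and transversal matroids
    (∃ (p : Prog (InputTy CapacityTy) (.list .nat)) (C c : ℕ),
      ∀ (n : ℕ) (G : WHypergraph (Fin n)) (M : Matroid (Fin n)) (k r : ℕ)
        (F : Fin r → Finset (Fin n)) (b : Fin r → ℕ) (ε : ℝ)
        (Es : List (List ℕ × ℝ)) (Fs : List (List ℕ × ℕ)),
        G.EdgeSizeLE η → IsPartitionMatroid M F b → M.eRank = k → 0 < ε →
        EncodesEdges Es G → EncodesCapacities Fs F b →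
        (∃ S : Finset (Fin n), EncodesSet (p.eval (n, ε, Es, Fs)) S ∧
          G.IsApprox M (1 - ((η : ℝ) - 1) * ε) S) ∧
        (p.cost (n, ε, Es, Fs) : ℝ) ≤ C * (max 2 (1 / ε)) ^ (c * k) * ((n : ℝ) + 1) ^ c) ∧
    (∃ (p : Prog (InputTy CapacityTy) (.list .nat)) (C c : ℕ),
      ∀ (n : ℕ) (G : WHypergraph (Fin n)) (M : Matroid (Fin n)) (k r : ℕ)
        (F : Fin r → Finset (Fin n)) (b : Fin r → ℕ) (ε : ℝ)
        (Es : List (List ℕ × ℝ)) (Fs : List (List ℕ × ℕ)),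
        G.EdgeSizeLE η → IsLaminarMatroid M F b → M.eRank = k → 0 < ε →
        EncodesEdges Es G → EncodesCapacities Fs F b →
        (∃ S : Finset (Fin n), EncodesSet (p.eval (n, ε, Es, Fs)) S ∧
          G.IsApprox M (1 - ((η : ℝ) - 1) * ε) S) ∧
        (p.cost (n, ε, Es, Fs) : ℝ) ≤ C * (max 2 (1 / ε)) ^ (c * k) * ((n : ℝ) + 1) ^ c) ∧
    (∃ (p : Prog (InputTy FamilyTy) (.list .nat)) (C c : ℕ),
      ∀ (n : ℕ) (G : WHypergraph (Fin n)) (M : Matroid (Fin n)) (k r : ℕ)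
        (F : Fin r → Finset (Fin n)) (ε : ℝ)
        (Es : List (List ℕ × ℝ)) (Fs : List (List ℕ)),
        G.EdgeSizeLE η → IsTransversalMatroid M F → M.eRank = k → 0 < ε →
        EncodesEdges Es G → EncodesFamily Fs F →
        (∃ S : Finset (Fin n), EncodesSet (p.eval (n, ε, Es, Fs)) S ∧
          G.IsApprox M (1 - ((η : ℝ) - 1) * ε) S) ∧
        (p.cost (n, ε, Es, Fs) : ℝ) ≤
          C * (1 / ε + k) ^ (c * k) * ((n : ℝ) + r + 1) ^ c) := by
  have hη1 : 1 ≤ η := by omega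
  obtain ⟨p, C, c, hp⟩ := exists_prog_laminar η hη1
  refine ⟨?_, ?_, ?_, ⟨p, C, c, ?_⟩, ⟨p, C, c, hp⟩,
    ⟨Prog.mainP Prog.transP, 230472000, η + 7, ?_⟩⟩
  · intro V _ _ G M k r F b ε K hG hM hk hε hK
    exact ⟨(hK.card_le hk).trans_eq (mul_comm _ _),
      hK.containsApprox hη1 hε le_rfl hG hM.2.2.2.1⟩
  · intro V _ _ G M k r F b ε K hG hM hk hε hK
    exact ⟨(hK.card_le hk).trans_eq (by ring),
      hK.containsApprox hη1 hε (by omega) hG hM.2.2.1⟩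
  · intro V _ _ G M k r F ε K hG hM hk hε hK
    refine ⟨(hK.card_le hk).trans ?_, hM.containsApprox hη1 hε hG hk hK⟩
    -- Separating `k = 0` removes the truncated subtraction from `(⌈1/ε⌉ + k - 1) · k`.
    rcases k with _ | k
    · simp
    · exact le_of_eq (by rw [← add_assoc, Nat.add_sub_cancel, Nat.add_sub_cancel]; ring)
  · intro n G M k r F b ε Es Fs hG hM
    exact hp n G M k r F b ε Es Fs hG hM.isLaminarMatroid
  · intro n G M k r F ε Es Fs hG hM hk hε hEs hFs
    obtain ⟨hS, hcost⟩ :=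
      Prog.mainP_spec hη1 hG hM.1 hk hε hEs (Prog.isOracle_transP hM hk hFs)
    exact ⟨hS, (Nat.cast_le.2 hcost).trans (cost_bound_transversal η n k r hε)⟩
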